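/- Let $M$ be a compact smooth manifold of dimension $8$ (without boundary) with a $Spin(7)$-structure, that is, a smooth $4$-form $\Phi$ which near every point can be written, in some smooth local coframe $e_0,\dots,e_7$, as $$\Phi=-e_{0127}+e_{0236}-e_{0347}-e_{0567}+e_{0146}+e_{0245}-e_{0135}-e_{3456}-e_{1457}-e_{1256}-e_{1234}-e_{2357}-e_{1367}+e_{2467},$$ where $e_{abcd}=e_a\wedge e_b\wedge e_c\wedge e_d$. Let $g$ be the Riemannian metric induced by $\Phi$ (the one for which these coframes are orthonormal), $\nabla^g$ its Levi-Civita connection, and $\delta$ the codifferential, $(\delta\alpha)(X_2,\dots,X_p)=-\sum_i(\nabla^g_{e_i}\alpha)(e_i,X_2,\dots,X_p)$ for a local orthonormal frame $(e_i)$. Let $\theta$ be the Lee form, $\theta_a=\frac1{42}\sum_{i,j,k}(\delta\Phi)_{ijk}\Phi_{ijka}$ in an orthonormal frame. Let $\nabla$ be the $Spin(7)$-torsion connection, i.e. the unique linear connection with $\nabla g=0$, $\nabla\Phi=0$ whose torsion $T(X,Y,Z)=g(\nabla_XY-\nabla_YX-[X,Y],Z)$ is totally skew-symmetric. Let $Ric(Y,Z)=\sum_i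 g(R(e_i,Y)Z,e_i)$ and $Scal=\sum_i Ric(e_i,e_i)$ be the Ricci tensor and the scalar curvature of $\nabla$, where $R(X,Y)=[\nabla_X,\nabla_Y]-\nabla_{[X,Y]}$, let $Scal^g$ be the scalar curvature of $\nabla^g$, and let $\|T\|^2=\sum_{i,j,k}T(e_i,e_j,e_k)^2$. Suppose that the torsion $3$-form is closed, $dT=0$. Then the following conditions are equivalent: a) the connection $\nabla$ is Ricci flat, $Ric=0$; b) the norm of the torsion is locally constant, $d\|T\|^2=0$; c) the Lee form is $\nabla$-parallel, $\nabla\theta=0$; d) the scalar curvature of $\nabla$ vanishes, $Scal=0$; e) the Riemannian scalar curvature $Scal^g$ is locally constant; f) the Lee form is co-closed, $\delta\theta=0$. (If $M$ is connected, "locally constant" means "constant".) In each of these six cases the torsion $T$ is a harmonic $3$-form, $dT=0$ and $\delta T=0$. -/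

import Mathlib

open Bundle FiberBundle VectorField
open scoped Manifold ContDiff Topology InnerProductSpace

noncomputable section

section Riemannian

set_option linter.unusedSectionVars false

variable {E : Type*} [NormedAddCommGroup E] [NormedSpace ℝ E] [FiniteDimensional ℝ E]
  {H : Type*} [TopologicalSpace H] {I : ModelWithCorners ℝ E H}
  {M : Type*} [TopologicalSpace M] [ChartedSpace H M] [IsManifold I ∞ M]
  [RiemannianBundle (fun x : M ↦ TangentSpace I x)]
  [IsContMDiffRiemannianBundle I ∞ E (fun x : M ↦ TangentSpace I x)]

instance tangentSpace_finiteDimensional (x : M) : FiniteDimensional ℝ (TangentSpace I x) :=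
  inferInstanceAs (FiniteDimensional ℝ E)

variable (I) in
/-- An orthonormal basis of the tangent space at `x`; all traces below are taken in it. -/
def orthoBasis (x : M) :
    OrthonormalBasis (Fin (Module.finrank ℝ (TangentSpace I x))) ℝ (TangentSpace I x) :=
  stdOrthonormalBasis ℝ (TangentSpace I x)

/-! ### The Levi-Civita connection -/

/-- The right-hand side of the Koszul formula, `g(∇_X Y, Z)` for the Levi-Civita connection. -/
def koszul (Y X Z : Π x : M, TangentSpace I x) (x : M) : ℝ :=
  (1 / 2 : ℝ) *
    (mvfderiv I (fun y ↦ ⟪Y y, Z y⟫_ℝ) x (X x) + mvfderiv I (fun y ↦ ⟪X y, Z y⟫_ℝ) x (Y x)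
      - mvfderiv I (fun y ↦ ⟪X y, Y y⟫_ℝ) x (Z x)
      + ⟪mlieBracket I X Y x, Z x⟫_ℝ - ⟪mlieBracket I X Z x, Y x⟫_ℝ
      - ⟪mlieBracket I Y Z x, X x⟫_ℝ)

theorem mdiff_inner {X Y : Π x : M, TangentSpace I x} {x : M}
    (hX : MDiffAt (T% X) x) (hY : MDiffAt (T% Y) x) :
    MDiffAt (fun y ↦ ⟪X y, Y y⟫_ℝ) x :=
  MDifferentiableAt.inner_bundle (F := E) (E := fun x : M ↦ TangentSpace I x) (b := fun y ↦ y) hX hY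

theorem koszul_tensorial {Y Z : Π x : M, TangentSpace I x} {x : M}
    (hY : MDiffAt (T% Y) x) (hZ : MDiffAt (T% Z) x) :
    TensorialAt I E (fun X ↦ koszul Y X Z x) x where
  smul {f X} hf hX := by
    have : IsManifold I 2 M := inferInstance
    have : CompleteSpace E := FiniteDimensional.complete ℝ E
    simp [koszul, inner_smul_left,
      mvfderiv_fun_mul hf (mdiff_inner hX hZ), mvfderiv_fun_mul hf (mdiff_inner hX hY),
      mlieBracket_smul_left hf hX, inner_add_left, inner_smul_right]
    rw [real_inner_comm (Z x) (X x)]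
    ring
  add {X X'} hX hX' := by
    have : IsManifold I 2 M := inferInstance
    have : CompleteSpace E := FiniteDimensional.complete ℝ E
    simp [koszul, 
      mvfderiv_fun_add (mdiff_inner hX hZ) (mdiff_inner hX' hZ), mvfderiv_fun_add (mdiff_inner hX hY) (mdiff_inner hX' hY),
      mlieBracket_add_left hX hX', inner_add_left, inner_add_right]
    ring

theorem koszul_add {Y Y' X Z : Π x : M, TangentSpace I x} {x : M}
    (hY : MDiffAt (T% Y) x) (hY' : MDiffAt (T% Y') x) (hX : MDiffAt (T% X) x)
    (hZ : MDiffAt (T% Z) x) :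
    koszul (Y + Y') X Z x = koszul Y X Z x + koszul Y' X Z x := by
  have : IsManifold I 2 M := inferInstance
  have : CompleteSpace E := FiniteDimensional.complete ℝ E
  simp [koszul, 
      mvfderiv_fun_add (mdiff_inner hY hZ) (mdiff_inner hY' hZ), mvfderiv_fun_add (mdiff_inner hX hY) (mdiff_inner hX hY'),
      mlieBracket_add_left hY hY', mlieBracket_add_right hY hY', inner_add_left, inner_add_right]
  ring

theorem koszul_smul {f : M → ℝ} {Y X Z : Π x : M, TangentSpace I x} {x : M}
    (hf : MDiffAt f x) (hY : MDiffAt (T% Y) x) (hX : MDiffAt (T% X) x)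
    (hZ : MDiffAt (T% Z) x) :
    koszul (f • Y) X Z x = f x * koszul Y X Z x + mvfderiv I f x (X x) * ⟪Y x, Z x⟫_ℝ := by
  have : IsManifold I 2 M := inferInstance
  have : CompleteSpace E := FiniteDimensional.complete ℝ E
  simp [koszul, inner_smul_left, inner_smul_right,
      mvfderiv_fun_mul hf (mdiff_inner hY hZ), mvfderiv_fun_mul hf (mdiff_inner hX hY),
      mlieBracket_smul_left hf hY, mlieBracket_smul_right hf hY, inner_add_left]
  rw [real_inner_comm (X x) (Y x)]
  ring

open Classical in
/-- `∇^g Y`, given by the Koszul formula where `Y` is differentiable (and zero elsewhere, as no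
condition is put on a covariant derivative there). -/
def leviCivitaFun (Y : Π x : M, TangentSpace I x) (x : M) :
    TangentSpace I x →L[ℝ] TangentSpace I x :=
  if hY : MDiffAt (T% Y) x then
    ∑ i, (TensorialAt.mkHom (fun X ↦ koszul Y X (extend E (orthoBasis I x i)) x) x
      (koszul_tensorial hY (mdifferentiableAt_extend ..))).smulRight (orthoBasis I x i)
  else 0

theorem leviCivitaFun_apply {Y : Π x : M, TangentSpace I x} {x : M} (hY : MDiffAt (T% Y) x)
    (v : TangentSpace I x) :
    leviCivitaFun Y x v =
      ∑ i, koszul Y (extend E v) (extend E (orthoBasis I x i)) x • orthoBasis I x i := by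
  simp [leviCivitaFun, hY, TensorialAt.mkHom_apply_eq_extend]

variable (I M) in
/-- The Levi-Civita connection `∇^g`. -/
def leviCivita : CovariantDerivative I E (fun x : M ↦ TangentSpace I x) where
  toFun := leviCivitaFun
  isCovariantDerivativeOnUniv :=
    { add := by
        intro Y Y' x hY hY' _
        ext1 v
        rw [leviCivitaFun_apply (mdifferentiableAt_add_section hY hY'), add_apply,
          leviCivitaFun_apply hY, leviCivitaFun_apply hY', ← Finset.sum_add_distrib]
        refine Finset.sum_congr rfl fun i _ ↦ ?_
        rw [koszul_add hY hY' (mdifferentiableAt_extend ..) (mdifferentiableAt_extend ..), add_smul]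
      leibniz := by
        intro Y f x hY hf _
        ext1 v
        have hb : Y x = ∑ i, ⟪Y x, orthoBasis I x i⟫_ℝ • orthoBasis I x i := by
          conv_lhs => rw [← (orthoBasis I x).sum_repr' (Y x)]
          exact Finset.sum_congr rfl fun i _ ↦ by rw [real_inner_comm]
        rw [leviCivitaFun_apply (hf.smul_section hY), add_apply,
          smul_apply, leviCivitaFun_apply hY,
          ContinuousLinearMap.smulRight_apply]
        conv_rhs => rw [hb]
        rw [Finset.smul_sum, Finset.smul_sum, ← Finset.sum_add_distrib]
        refine Finset.sum_congr rfl fun i _ ↦ ?_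
        rw [koszul_smul hf hY (mdifferentiableAt_extend ..) (mdifferentiableAt_extend ..)]
        simp [add_smul, mul_smul] }

/-! ### Covariant tensor fields

A covariant `k`-tensor field is a real function of a point and of `k` tangent vectors there.
Derivatives of tensor fields are computed by extending the given tangent vectors to local vector
fields by `FiberBundle.extend`; for differentiable tensor fields the extension does not matter. -/

variable (I M) in
abbrev TensorField (k : ℕ) := (x : M) → (Fin k → TangentSpace I x) → ℝ

/-- `(∇ α)(v₀, v₁, …, v_k) = (∇_{v₀} α)(v₁, …, v_k)`. -/
def covDeriv (cov : CovariantDerivative I E (fun x : M ↦ TangentSpace I x)) {k : ℕ}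
    (α : TensorField I M k) : TensorField I M (k + 1) := fun x v ↦
  mvfderiv I (fun y ↦ α y (fun i ↦ extend E (v i.succ) y)) x (v 0)
    - ∑ i : Fin k, α x (Function.update (fun j : Fin k ↦ v j.succ) i
        (cov (extend E (v i.succ)) x (v 0)))

/-- `∇ α = 0`. -/
def IsParallel (cov : CovariantDerivative I E (fun x : M ↦ TangentSpace I x)) {k : ℕ}
    (α : TensorField I M k) : Prop := ∀ x v, covDeriv cov α x v = 0

variable (I M) in
/-- The metric `g` as a tensor field. -/
def metricTensor : TensorField I M 2 := fun _ v ↦ ⟪v 0, v 1⟫_ℝ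

/-- Total skew-symmetry. -/
def IsSkew {k : ℕ} (α : TensorField I M k) : Prop :=
  ∀ x v (σ : Equiv.Perm (Fin k)), α x (v ∘ σ) = ((Equiv.Perm.sign σ : ℤ) : ℝ) * α x v

/-- The tensor norm `‖α‖² = ∑ (α_{i₁ … i_k})²`, the sum being over all `k`-tuples of indices. -/
def normSq {k : ℕ} (α : TensorField I M k) (x : M) : ℝ :=
  ∑ j : Fin k → Fin (Module.finrank ℝ (TangentSpace I x)), α x (fun m ↦ orthoBasis I x (j m)) ^ 2

/-- The codifferential `(δα)(v₁, …, v_k) = -∑ᵢ (∇^g_{eᵢ} α)(eᵢ, v₁, …, v_k)`. -/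
def codiff {k : ℕ} (α : TensorField I M (k + 1)) : TensorField I M k := fun x v ↦
  -∑ i, covDeriv (leviCivita I M) α x
    (Matrix.vecCons (orthoBasis I x i) (Matrix.vecCons (orthoBasis I x i) v))

/-- `δα = 0`. -/
def IsCoclosed {k : ℕ} (α : TensorField I M (k + 1)) : Prop := ∀ x v, codiff α x v = 0

/-- The exterior derivative of a 3-form,
`dα(X₀, …, X₃) = ∑ᵢ (-1)ⁱ Xᵢ(α(…, X̂ᵢ, …)) + ∑_{i<j} (-1)^{i+j} α([Xᵢ, Xⱼ], …, X̂ᵢ, …, X̂ⱼ, …)`. -/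
def extDerivThree (α : TensorField I M 3) : TensorField I M 4 := fun x v ↦
  let X : Fin 4 → Π y : M, TangentSpace I y := fun i ↦ extend E (v i)
  let D : Fin 4 → Fin 4 → Fin 4 → Fin 4 → ℝ := fun i j k l ↦
    mvfderiv I (fun y ↦ α y ![X j y, X k y, X l y]) x (v i)
  let B : Fin 4 → Fin 4 → Fin 4 → Fin 4 → ℝ := fun i j k l ↦
    α x ![mlieBracket I (X i) (X j) x, v k, v l]
  D 0 1 2 3 - D 1 0 2 3 + D 2 0 1 3 - D 3 0 1 2
    - B 0 1 2 3 + B 0 2 1 3 - B 0 3 1 2 - B 1 2 0 3 + B 1 3 0 2 - B 2 3 0 1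

/-- `dα = 0` for a 3-form `α`. -/
def IsClosedThree (α : TensorField I M 3) : Prop := ∀ x v, extDerivThree α x v = 0

/-- A 3-form `α` with `dα = 0` and `δα = 0`. -/
def IsHarmonicThree (α : TensorField I M 3) : Prop := IsClosedThree α ∧ IsCoclosed α

/-! ### Torsion and curvature of a connection -/

/-- `T(X, Y, Z) = g(∇_X Y - ∇_Y X - [X, Y], Z)`. -/
def torsionTensor [CompleteSpace E]
    (cov : CovariantDerivative I E (fun x : M ↦ TangentSpace I x)) : TensorField I M 3 :=
  fun x v ↦ ⟪cov.torsion x (v 0) (v 1), v 2⟫_ℝ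

/-- `R(u, v)w = [∇_u, ∇_v]w - ∇_{[u, v]}w`. -/
def curvature (cov : CovariantDerivative I E (fun x : M ↦ TangentSpace I x)) (x : M)
    (u v w : TangentSpace I x) : TangentSpace I x :=
  let U : Π y : M, TangentSpace I y := extend E u
  let V : Π y : M, TangentSpace I y := extend E v
  let W : Π y : M, TangentSpace I y := extend E w
  cov (fun y ↦ cov W y (V y)) x u - cov (fun y ↦ cov W y (U y)) x v
    - cov W x (mlieBracket I U V x)

/-- `Ric(v, w) = ∑ᵢ g(R(eᵢ, v)w, eᵢ)`. -/
def ricci (cov : CovariantDerivative I E (fun x : M ↦ TangentSpace I x)) (x : M)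
    (v w : TangentSpace I x) : ℝ :=
  ∑ i, ⟪curvature cov x (orthoBasis I x i) v w, orthoBasis I x i⟫_ℝ

def scalarCurvature (cov : CovariantDerivative I E (fun x : M ↦ TangentSpace I x)) (x : M) : ℝ :=
  ∑ i, ricci cov x (orthoBasis I x i) (orthoBasis I x i)

/-! ### The connection `leviCivita` is metric and torsion-free -/

theorem koszul_tensorial_right {Y X : Π x : M, TangentSpace I x} {x : M}
    (hY : MDiffAt (T% Y) x) (hX : MDiffAt (T% X) x) :
    TensorialAt I E (fun Z ↦ koszul Y X Z x) x where
  smul {f Z} hf hZ := by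
    have : IsManifold I 2 M := inferInstance
    have : CompleteSpace E := FiniteDimensional.complete ℝ E
    simp [koszul, inner_smul_left, inner_smul_right,
      mvfderiv_fun_mul hf (mdiff_inner hX hZ), mvfderiv_fun_mul hf (mdiff_inner hY hZ),
      mlieBracket_smul_right hf hZ, inner_add_left]
    rw [real_inner_comm (Z x) (X x), real_inner_comm (Z x) (Y x)]
    ring
  add {Z Z'} hZ hZ' := by
    have : IsManifold I 2 M := inferInstance
    have : CompleteSpace E := FiniteDimensional.complete ℝ E
    simp [koszul,
      mvfderiv_fun_add (mdiff_inner hX hZ) (mdiff_inner hX hZ'),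
      mvfderiv_fun_add (mdiff_inner hY hZ) (mdiff_inner hY hZ'),
      mlieBracket_add_right hZ hZ', inner_add_left, inner_add_right]
    ring

theorem inner_leviCivita {X Y Z : Π x : M, TangentSpace I x} {x : M} (hX : MDiffAt (T% X) x)
    (hY : MDiffAt (T% Y) x) (hZ : MDiffAt (T% Z) x) :
    ⟪leviCivita I M Y x (X x), Z x⟫_ℝ = koszul Y X Z x := by
  have h1 : leviCivita I M Y x (X x) =
      ∑ i, koszul Y X (extend E (orthoBasis I x i)) x • orthoBasis I x i := by
    refine (leviCivitaFun_apply hY (X x)).trans (Finset.sum_congr rfl fun i _ ↦ ?_)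
    rw [(koszul_tensorial hY (mdifferentiableAt_extend ..)).pointwise
      (mdifferentiableAt_extend ..) hX (by simp)]
  have h2 : koszul Y X Z x = TensorialAt.mkHom _ x (koszul_tensorial_right hY hX) (Z x) :=
    (TensorialAt.mkHom_apply (koszul_tensorial_right hY hX) hZ).symm
  rw [h1, h2]
  conv_rhs => rw [← (orthoBasis I x).sum_repr' (Z x)]
  simp [sum_inner, inner_smul_left, TensorialAt.mkHom_apply_eq_extend, mul_comm]

theorem leviCivita_isMetric : IsParallel (leviCivita I M) (metricTensor I M) := by
  intro x v
  set X : Π y : M, TangentSpace I y := extend E (v 0) with hXd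
  set Y : Π y : M, TangentSpace I y := extend E (v 1) with hYd
  set Z : Π y : M, TangentSpace I y := extend E (v 2) with hZd
  have hX : MDiffAt (T% X) x := mdifferentiableAt_extend ..
  have hY : MDiffAt (T% Y) x := mdifferentiableAt_extend ..
  have hZ : MDiffAt (T% Z) x := mdifferentiableAt_extend ..
  have eX : X x = v 0 := extend_apply_self ..
  have eY : Y x = v 1 := extend_apply_self ..
  have eZ : Z x = v 2 := extend_apply_self ..
  have h := inner_leviCivita hX hY hZ
  have h' := inner_leviCivita hX hZ hY
  rw [real_inner_comm] at h'
  rw [eX, eZ] at h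
  rw [eX, eY] at h'
  have key : mvfderiv I (fun y ↦ ⟪Y y, Z y⟫_ℝ) x (v 0) =
      koszul Y X Z x + koszul Z X Y x := by
    simp only [koszul, eX, eY, eZ]
    rw [mlieBracket_swap_apply (V := Z) (W := Y)]
    simp only [real_inner_comm (Y _) (Z _), inner_neg_left]
    ring
  have e1 : covDeriv (leviCivita I M) (metricTensor I M) x v =
      mvfderiv I (fun y ↦ ⟪Y y, Z y⟫_ℝ) x (v 0) -
        (⟪leviCivita I M Y x (v 0), v 2⟫_ℝ + ⟪v 1, leviCivita I M Z x (v 0)⟫_ℝ) := by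
    simp only [covDeriv, metricTensor, Fin.sum_univ_two]
    rfl
  rw [e1, h, h', key]
  ring

theorem leviCivita_torsion [CompleteSpace E] : (leviCivita I M).torsion = 0 := by
  rw [CovariantDerivative.torsion_eq_zero_iff]
  intro X Y x hX hY
  refine ext_inner_right ℝ fun v ↦ ?_
  have hv : MDiffAt (T% (extend E v)) x := mdifferentiableAt_extend ..
  have h := inner_leviCivita hX hY hv
  have h' := inner_leviCivita hY hX hv
  simp only [extend_apply_self] at h h'
  rw [inner_sub_left, h, h']
  simp only [koszul, extend_apply_self]
  rw [mlieBracket_swap_apply (V := Y) (W := X)]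
  simp only [real_inner_comm (Y _) (X _), inner_neg_left]
  ring

end Riemannian

/-! ### `Spin(7)`-structures -/

/-- The 4-form `e_{abcd} = e_a ∧ e_b ∧ e_c ∧ e_d` on `ℝ⁸`. -/
def wedgeFour (a b c d : Fin 8) (v : Fin 4 → Fin 8 → ℝ) : ℝ :=
  Matrix.det (Matrix.of fun m n : Fin 4 ↦ v m (![a, b, c, d] n))

/-- The standard `Spin(7)`-form on `ℝ⁸`. -/
def standardForm (v : Fin 4 → Fin 8 → ℝ) : ℝ :=
  - wedgeFour 0 1 2 7 v + wedgeFour 0 2 3 6 v - wedgeFour 0 3 4 7 v - wedgeFour 0 5 6 7 v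
  + wedgeFour 0 1 4 6 v + wedgeFour 0 2 4 5 v - wedgeFour 0 1 3 5 v
  - wedgeFour 3 4 5 6 v - wedgeFour 1 4 5 7 v - wedgeFour 1 2 5 6 v - wedgeFour 1 2 3 4 v
  - wedgeFour 2 3 5 7 v - wedgeFour 1 3 6 7 v + wedgeFour 2 4 6 7 v

section Spin7

variable (M : Type*) [TopologicalSpace M] [ChartedSpace (EuclideanSpace ℝ (Fin 8)) M]
  [IsManifold (𝓡 8) ∞ M] [RiemannianBundle (fun x : M ↦ TangentSpace (𝓡 8) x)]
  [IsContMDiffRiemannianBundle (𝓡 8) ∞ (EuclideanSpace ℝ (Fin 8))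
    (fun x : M ↦ TangentSpace (𝓡 8) x)]

/-- A `Spin(7)`-structure on the 8-manifold `M`: a 4-form `Φ` which is, near every point, the
standard form in some smooth frame `e`. The Riemannian metric `g` of `M` is the one induced by `Φ`,
that is, these frames are orthonormal, and the dual coframe consists of the `g(e i, ·)`.
The smoothness of `Φ` follows from that of the frames. -/
structure Spin7Structure where
  form : (x : M) → (TangentSpace (𝓡 8) x) [⋀^Fin 4]→L[ℝ] ℝ
  exists_frame : ∀ x : M, ∃ U : Set M, IsOpen U ∧ x ∈ U ∧
    ∃ e : Fin 8 → (y : M) → TangentSpace (𝓡 8) y,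
      IsLocalFrameOn (𝓡 8) (EuclideanSpace ℝ (Fin 8)) ∞ e U ∧
      ∀ y ∈ U, Orthonormal ℝ (fun i ↦ e i y) ∧
        ∀ v : Fin 4 → TangentSpace (𝓡 8) y,
          form y v = standardForm (fun m i ↦ ⟪e i y, v m⟫_ℝ)

namespace Spin7Structure

variable {M} (S : Spin7Structure M)

/-- The fundamental form `Φ` as a tensor field. -/
def fundamentalForm : TensorField (𝓡 8) M 4 := fun x v ↦ S.form x v

/-- The Lee form `θ_a = (1/42) (δΦ)_{ijk} Φ_{ijka}`. -/
def leeForm : TensorField (𝓡 8) M 1 := fun x v ↦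
  (1 / 42 : ℝ) * ∑ i, ∑ j, ∑ k,
    codiff S.fundamentalForm x ![orthoBasis (𝓡 8) x i, orthoBasis (𝓡 8) x j, orthoBasis (𝓡 8) x k]
      * S.form x ![orthoBasis (𝓡 8) x i, orthoBasis (𝓡 8) x j, orthoBasis (𝓡 8) x k, v 0]

/-- A smooth linear connection `∇` with `∇g = 0`, `∇Φ = 0` and totally skew-symmetric torsion. -/
structure IsTorsionConnection
    (cov : CovariantDerivative (𝓡 8) (EuclideanSpace ℝ (Fin 8))
      (fun x : M ↦ TangentSpace (𝓡 8) x)) : Prop where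
  smooth : CovariantDerivative.ContMDiffCovariantDerivative cov ∞
  metric : IsParallel cov (metricTensor (𝓡 8) M)
  form : IsParallel cov S.fundamentalForm
  skew : IsSkew (torsionTensor cov)

/-- The `Spin(7)`-torsion connection: the connection `∇` satisfying `IsTorsionConnection`. Such a
connection exists on every `Spin(7)`-manifold, and its values on differentiable vector fields are
determined uniquely. -/
def torsionConnection : CovariantDerivative (𝓡 8) (EuclideanSpace ℝ (Fin 8))
    (fun x : M ↦ TangentSpace (𝓡 8) x) :=
  @Classical.epsilon _ ⟨leviCivita (𝓡 8) M⟩ S.IsTorsionConnection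

/-- The torsion 3-form `T` of the `Spin(7)`-torsion connection. -/
def torsionForm : TensorField (𝓡 8) M 3 := torsionTensor S.torsionConnection

end Spin7Structure

end Spin7

end

noncomputable section

/-! ### The components of the standard form -/

/-- The components of `standardForm`, encoded by their values plus one in base four. -/
def phiTable : ℕ :=
  0x5555555555555555555555555555555555555555555455655551545555955955555555565555555155455595565545555555554555595555555465555155559555555559556555565555515545555455555556555515455559555555555455595555551554555955655555565555554555555155655555155655555155655555555555555556554555595655551551555555555555555555555555555555555555545555555555155655555155659555556555555595555551551555555655515551555554555955555555569555554554555555555995555554555551555595559555555545555415555955555556555955555515555559556555155455555555555554555555595565551554556555555655555555559554555559554515555555555555555555555555555555555555515515555555556555555695555545554556555555455555559555555455595595555155555554155555556555565556555565555515555556455555555515455595555555556555515455559555555555556555515555555645555955551555455555551555555955955555545559555955955555555545555554155555655555555555555555555555555555555555545155655555555555555155659555655515555556555555595555551551555155555695555555554555955555455555955551554555551555595565555555555555515545555455555955655556555559555556555155555555541555556555655455555565555555155555565551555659554555555555555559554515555555555555555555555555555555555551555556955555515555555556554555455595555554556555555455555559555455554555599555555565555155555555555455559565555155555555565551565555555551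1555555655555955551555155559555555569555555545555455455595555554555555515555559559555955555415555559555555555455655555555555555555555555555555555555555451556555551556555555555595555559559556555155455555551555555555555595565551554555555455555565551555555565555695555155555554555455554555559555555465555555559559555554155555555565551555556555655515555556554555555655555551555556595545555595545555555555155555555555555555555555555555555555554556555515455559559555555555555555595545555595545555595545555551555555955555515545559556555555655515555555554555595655551555555515555955655555955551554555555556555565555115555555455559555555555155155455595565555555955555555565545555956555515515555555555555555555555555555555555555555555

/-- The component `Φ_{ijkl}` of `standardForm`. -/
def phi (i j k l : Fin 8) : ℤ :=
  ((phiTable >>> (2 * (((i.val * 8 + j.val) * 8 + k.val) * 8 + l.val))) % 4 : ℕ) - 1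

/-- The Kronecker symbol. -/
def kron (i j : Fin 8) : ℤ := if i.val = j.val then 1 else 0

theorem kron_eq (i j : Fin 8) : kron i j = if i = j then 1 else 0 := by
  simp [kron, Fin.ext_iff]

/-- The determinant of the `0`-`1` matrix which compares the index lists `i, j` and `a, b`. -/
def altTwo (a b i j : ℕ) : ℤ :=
  (if i = a then if j = b then 1 else 0 else 0) - (if i = b then if j = a then 1 else 0 else 0)

/-- The `3 × 3` analogue of `altTwo`. -/
def altThree (a b c i j k : ℕ) : ℤ :=
  (if i = a then altTwo b c j k else 0) - (if i = b then altTwo a c j k else 0) +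
    (if i = c then altTwo a b j k else 0)

/-- The `4 × 4` analogue of `altTwo`. -/
def altFour (a b c d i j k l : ℕ) : ℤ :=
  (if i = a then altThree b c d j k l else 0) - (if i = b then altThree a c d j k l else 0) +
    (if i = c then altThree a b d j k l else 0) - (if i = d then altThree a b c j k l else 0)

set_option maxRecDepth 100000 in
theorem phi_eq_altFour : ∀ i j k l : Fin 8, phi i j k l =
    - altFour 0 1 2 7 i j k l + altFour 0 2 3 6 i j k l - altFour 0 3 4 7 i j k l
    - altFour 0 5 6 7 i j k l + altFour 0 1 4 6 i j k l + altFour 0 2 4 5 i j k l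
    - altFour 0 1 3 5 i j k l - altFour 3 4 5 6 i j k l - altFour 1 4 5 7 i j k l
    - altFour 1 2 5 6 i j k l - altFour 1 2 3 4 i j k l - altFour 2 3 5 7 i j k l
    - altFour 1 3 6 7 i j k l + altFour 2 4 6 7 i j k l := by decide +kernel

theorem altFour_eq (a b c d i j k l : Fin 8) : altFour a b c d i j k l =
    kron i a * altThree b c d j k l - kron i b * altThree a c d j k l
      + kron i c * altThree a b d j k l - kron i d * altThree a b c j k l := by
  simp [altFour, kron]

theorem altThree_eq (a b c i j k : Fin 8) : altThree a b c i j k =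
    kron i a * altTwo b c j k - kron i b * altTwo a c j k + kron i c * altTwo a b j k := by
  simp [altThree, kron]

theorem altTwo_eq (a b i j : Fin 8) :
    altTwo a b i j = kron i a * kron j b - kron i b * kron j a := by
  simp only [altTwo, kron, ite_mul, one_mul, zero_mul]

theorem wedgeFour_kron (a b c d i j k l : Fin 8) :
    wedgeFour a b c d (fun m n ↦ (kron (![i, j, k, l] m) n : ℝ)) =
      (altFour a b c d i j k l : ℝ) := by
  simp only [wedgeFour, Matrix.det_succ_row_zero (n := 3), Matrix.det_fin_three, Fin.sum_univ_four,
    altFour_eq, altThree_eq, altTwo_eq]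
  simp [Fin.succAbove, Fin.lt_def]
  ring

theorem standardForm_kron (i j k l : Fin 8) :
    standardForm (fun m n ↦ (kron (![i, j, k, l] m) n : ℝ)) = (phi i j k l : ℝ) := by
  rw [phi_eq_altFour]
  push_cast
  simp only [standardForm, wedgeFour_kron]
  rfl

set_option maxRecDepth 100000 in
theorem phi_swap_left : ∀ i j k l, phi i j k l = - phi j i k l := by decide +kernel

set_option maxRecDepth 100000 in
theorem phi_swap_mid : ∀ i j k l, phi i j k l = - phi i k j l := by decide +kernel

set_option maxRecDepth 100000 in
theorem phi_swap_right : ∀ i j k l, phi i j k l = - phi i j l k := by decide +kernel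

/-- A function of three indices which is skew-symmetric and vanishes on increasing triples is
zero. -/
theorem eq_zero_of_skew_three {ι : Type*} [LinearOrder ι] {f : ι → ι → ι → ℤ}
    (h₁ : ∀ i j k, f i j k = - f j i k) (h₂ : ∀ i j k, f i j k = - f i k j)
    (h : ∀ i j, i < j → ∀ k, j < k → f i j k = 0) (i j k : ι) : f i j k = 0 := by
  have e1 : ∀ i k, f i i k = 0 := fun i k ↦ by have := h₁ i i k; omega
  have e2 : ∀ i k, f i k k = 0 := fun i k ↦ by have := h₂ i k k; omega
  have e3 : ∀ i k, f i k i = 0 := fun i k ↦ by rw [h₂, e1, neg_zero]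
  rcases lt_trichotomy i j with hij | rfl | hij
  · rcases lt_trichotomy j k with hjk | rfl | hjk
    · exact h i j hij k hjk
    · exact e2 _ _
    · rcases lt_trichotomy i k with hik | rfl | hik
      · rw [h₂, h i k hik j hjk, neg_zero]
      · exact e3 _ _
      · rw [h₂, h₁, h k i hik j hij]; rfl
  · exact e1 _ _
  · rcases lt_trichotomy i k with hik | rfl | hik
    · rw [h₁, h j i hij k hik, neg_zero]
    · exact e3 _ _
    · rcases lt_trichotomy j k with hjk | rfl | hjk
      · rw [h₁, h₂, h j k hjk i hik]; rfl
      · exact e2 _ _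
      · rw [h₁, h₂, h₁, h k j hjk i hij]; rfl

set_option maxRecDepth 100000 in
theorem sum_phi_mul_phi_of_lt : ∀ i j : Fin 8, i < j → ∀ k, j < k → ∀ p q : Fin 8, p < q → ∀ r,
    q < r → ∑ a, phi a i j k * phi a p q r =
      kron i p * (kron j q * kron k r - kron j r * kron k q)
      - kron i q * (kron j p * kron k r - kron j r * kron k p)
      + kron i r * (kron j p * kron k q - kron j q * kron k p)
      - (kron i p * phi j k q r + kron i q * phi j k r p + kron i r * phi j k p q
        + kron j p * phi k i q r + kron j q * phi k i r p + kron j r * phi k i p q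
        + kron k p * phi i j q r + kron k q * phi i j r p + kron k r * phi i j p q) := by
  decide +kernel

/-- The contraction of two copies of `Φ` in one index. -/
theorem sum_phi_mul_phi (i j k p q r : Fin 8) : ∑ a, phi a i j k * phi a p q r =
      kron i p * (kron j q * kron k r - kron j r * kron k q)
      - kron i q * (kron j p * kron k r - kron j r * kron k p)
      + kron i r * (kron j p * kron k q - kron j q * kron k p)
      - (kron i p * phi j k q r + kron i q * phi j k r p + kron i r * phi j k p q
        + kron j p * phi k i q r + kron j q * phi k i r p + kron j r * phi k i p q
        + kron k p * phi i j q r + kron k q * phi i j r p + kron k r * phi i j p q) := by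
  rw [← sub_eq_zero]
  refine eq_zero_of_skew_three (f := fun i j k ↦ (∑ a, phi a i j k * phi a p q r) -
      (kron i p * (kron j q * kron k r - kron j r * kron k q)
      - kron i q * (kron j p * kron k r - kron j r * kron k p)
      + kron i r * (kron j p * kron k q - kron j q * kron k p)
      - (kron i p * phi j k q r + kron i q * phi j k r p + kron i r * phi j k p q
        + kron j p * phi k i q r + kron j q * phi k i r p + kron j r * phi k i p q
        + kron k p * phi i j q r + kron k q * phi i j r p + kron k r * phi i j p q)))
    (fun i j k ↦ ?_) (fun i j k ↦ ?_) (fun i j hij k hjk ↦ ?_) i j k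
  · simp only [phi_swap_mid _ i j k, phi_swap_left k i, phi_swap_left j k, phi_swap_left i j,
      neg_mul, Finset.sum_neg_distrib]
    ring
  · simp only [phi_swap_right _ i j k, phi_swap_left k i, phi_swap_left j k, phi_swap_left i j,
      neg_mul, Finset.sum_neg_distrib]
    ring
  refine eq_zero_of_skew_three (f := fun p q r ↦ (∑ a, phi a i j k * phi a p q r) -
      (kron i p * (kron j q * kron k r - kron j r * kron k q)
      - kron i q * (kron j p * kron k r - kron j r * kron k p)
      + kron i r * (kron j p * kron k q - kron j q * kron k p)
      - (kron i p * phi j k q r + kron i q * phi j k r p + kron i r * phi j k p q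
        + kron j p * phi k i q r + kron j q * phi k i r p + kron j r * phi k i p q
        + kron k p * phi i j q r + kron k q * phi i j r p + kron k r * phi i j p q)))
    (fun p q r ↦ ?_) (fun p q r ↦ ?_) (fun p q hpq r hqr ↦ ?_) p q r
  · simp only [phi_swap_mid _ p q r, phi_swap_right _ _ r p, phi_swap_right _ _ q r,
      phi_swap_right _ _ p q, mul_neg, Finset.sum_neg_distrib]
    ring
  · simp only [phi_swap_right _ p q r, phi_swap_right _ _ r p, phi_swap_right _ _ q r,
      phi_swap_right _ _ p q, mul_neg, Finset.sum_neg_distrib]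
    ring
  · exact sub_eq_zero.2 (sum_phi_mul_phi_of_lt i j hij k hjk p q hpq r hqr)

set_option maxRecDepth 100000 in
theorem sum_sum_phi_mul_phi_of_lt : ∀ i j : Fin 8, i < j → ∀ k l : Fin 8, k < l →
    ∑ p, ∑ q, phi i j p q * phi k l p q =
      6 * (kron i k * kron j l - kron i l * kron j k) - 4 * phi i j k l := by
  decide +kernel

/-- The contraction of two copies of `Φ` in two indices. -/
theorem sum_sum_phi_mul_phi (i j k l : Fin 8) : ∑ p, ∑ q, phi i j p q * phi k l p q =
    6 * (kron i k * kron j l - kron i l * kron j k) - 4 * phi i j k l := by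
  have h0 : ∀ i k l, phi i i k l = 0 := fun i k l ↦ by have := phi_swap_left i i k l; omega
  have h1 : ∀ i k l, phi k l i i = 0 := fun i k l ↦ by have := phi_swap_right k l i i; omega
  rcases lt_trichotomy i j with hij | rfl | hij
  · rcases lt_trichotomy k l with hkl | rfl | hkl
    · exact sum_sum_phi_mul_phi_of_lt i j hij k l hkl
    · simp [h0, h1]
    · simp only [phi_swap_left k l, phi_swap_right _ _ k l, mul_neg, Finset.sum_neg_distrib]
      rw [sum_sum_phi_mul_phi_of_lt i j hij l k hkl]; ring
  · simp [h0]; ring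
  · rcases lt_trichotomy k l with hkl | rfl | hkl
    · simp only [phi_swap_left i j, neg_mul, Finset.sum_neg_distrib]
      rw [sum_sum_phi_mul_phi_of_lt j i hij k l hkl]; ring
    · simp [h0, h1]
    · simp only [phi_swap_left i j, phi_swap_left k l, phi_swap_right _ _ k l, neg_mul,
        mul_neg, neg_neg]
      rw [sum_sum_phi_mul_phi_of_lt j i hij l k hkl]; ring

end


noncomputable section

/-! ### Calculus in an orthonormal frame

The algebraic part of the theory of a metric connection with skew-symmetric torsion: `A` is the ring
of functions, `D i` is the derivative along the `i`-th vector of an orthonormal frame, and `conn`,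
`struc` and `tor` are the components of the connection, of the Lie brackets of the frame and of the
torsion. -/

structure FrameCalculus (ι A : Type*) [Fintype ι] [CommRing A] [Algebra ℝ A] where
  D : ι → Derivation ℝ A A
  conn : ι → ι → ι → A
  struc : ι → ι → ι → A
  tor : ι → ι → ι → A
  conn_skew : ∀ i j k, conn i j k = - conn i k j
  tor_eq : ∀ i j k, tor i j k = conn i j k - conn j i k - struc i j k
  tor_swap_left : ∀ i j k, tor i j k = - tor j i k
  tor_swap_right : ∀ i j k, tor i j k = - tor i k j
  comm : ∀ f i j, D i (D j f) - D j (D i f) = ∑ p, struc i j p * D p f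
  jacobi : ∀ i j k l, D i (struc j k l) + D j (struc k i l) + D k (struc i j l) +
    ∑ p, (struc j k p * struc i p l + struc k i p * struc j p l + struc i j p * struc k p l) = 0

namespace FrameCalculus

set_option linter.unusedSectionVars false

variable {ι A : Type*} [Fintype ι] [CommRing A] [Algebra ℝ A] (F : FrameCalculus ι A)

theorem struc_eq (i j k : ι) : F.struc i j k = F.conn i j k - F.conn j i k - F.tor i j k := by
  rw [F.tor_eq]; ring

theorem tor_cycle (i j k : ι) : F.tor i j k = F.tor j k i := by
  rw [F.tor_swap_left, F.tor_swap_right, neg_neg]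

/-- The covariant derivative of a 1-form. -/
def nablaOne (θ : ι → A) (i j : ι) : A := F.D i (θ j) - ∑ p, F.conn i j p * θ p

/-- The covariant derivative of a 2-tensor. -/
def nablaTwo (w : ι → ι → A) (i j k : ι) : A :=
  F.D i (w j k) - ∑ p, (F.conn i j p * w p k + F.conn i k p * w j p)

/-- The covariant derivative of a 3-tensor. -/
def nablaThree (α : ι → ι → ι → A) (i j k l : ι) : A :=
  F.D i (α j k l)
    - ∑ p, (F.conn i j p * α p k l + F.conn i k p * α j p l + F.conn i l p * α j k p)

/-- The curvature `g(R(e_i, e_j)e_k, e_l)`. -/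
def curv (i j k l : ι) : A :=
  F.D i (F.conn j k l) - F.D j (F.conn i k l)
    + ∑ p, (F.conn j k p * F.conn i p l - F.conn i k p * F.conn j p l
      - F.struc i j p * F.conn p k l)

/-- The Ricci tensor. -/
def ric (j k : ι) : A := ∑ i, F.curv i j k i

/-- The 4-form `σ^T`. -/
def sig (i j k l : ι) : A :=
  ∑ p, (F.tor i j p * F.tor k l p + F.tor j k p * F.tor i l p + F.tor k i p * F.tor j l p)

theorem curv_swap_left (i j k l : ι) : F.curv i j k l = - F.curv j i k l := by
  have h : ∑ p, (F.conn j k p * F.conn i p l - F.conn i k p * F.conn j p l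
      - F.struc i j p * F.conn p k l) = - ∑ p, (F.conn i k p * F.conn j p l
      - F.conn j k p * F.conn i p l - F.struc j i p * F.conn p k l) := by
    rw [← Finset.sum_neg_distrib]
    refine Finset.sum_congr rfl fun p _ ↦ ?_
    rw [F.struc_eq i j, F.struc_eq j i, F.tor_swap_left i j]
    ring
  simp only [curv, h]
  ring

theorem curv_swap_right (i j k l : ι) : F.curv i j k l = - F.curv i j l k := by
  have h : ∑ p, (F.conn j k p * F.conn i p l - F.conn i k p * F.conn j p l
      - F.struc i j p * F.conn p k l) = - ∑ p, (F.conn j l p * F.conn i p k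
      - F.conn i l p * F.conn j p k - F.struc i j p * F.conn p l k) := by
    rw [← Finset.sum_neg_distrib]
    refine Finset.sum_congr rfl fun p _ ↦ ?_
    rw [F.conn_skew j k p, F.conn_skew i p l, F.conn_skew i k p, F.conn_skew j p l,
      F.conn_skew p k l]
    ring
  simp only [curv, h, F.conn_skew j k l, F.conn_skew i k l, map_neg]
  ring

/-- The first Bianchi identity. -/
theorem bianchi (i j k l : ι) : F.curv i j k l + F.curv j k i l + F.curv k i j l =
    F.nablaThree F.tor i j k l + F.nablaThree F.tor j k i l + F.nablaThree F.tor k i j l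
      + F.sig i j k l := by
  have key : ∑ p, ((F.conn j k p * F.conn i p l - F.conn i k p * F.conn j p l
        - F.struc i j p * F.conn p k l) + (F.conn k i p * F.conn j p l - F.conn j i p * F.conn k p l
        - F.struc j k p * F.conn p i l) + (F.conn i j p * F.conn k p l - F.conn k j p * F.conn i p l
        - F.struc k i p * F.conn p j l)
      + (F.conn i j p * F.tor p k l + F.conn i k p * F.tor j p l + F.conn i l p * F.tor j k p)
      + (F.conn j k p * F.tor p i l + F.conn j i p * F.tor k p l + F.conn j l p * F.tor k i p)
      + (F.conn k i p * F.tor p j l + F.conn k j p * F.tor i p l + F.conn k l p * F.tor i j p)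
      - (F.tor i j p * F.tor k l p + F.tor j k p * F.tor i l p + F.tor k i p * F.tor j l p)
      - (F.struc j k p * F.struc i p l + F.struc k i p * F.struc j p l
        + F.struc i j p * F.struc k p l)) = 0 := by
    refine Finset.sum_eq_zero fun p _ ↦ ?_
    rw [F.struc_eq i p, F.struc_eq j p, F.struc_eq k p, F.tor_swap_left p k, F.tor_swap_left p i,
      F.tor_swap_left p j, F.tor_swap_right k l p, F.tor_swap_right i l p, F.tor_swap_right j l p,
      F.struc_eq i j, F.struc_eq j k, F.struc_eq k i, F.conn_skew i l p, F.conn_skew j l p,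
      F.conn_skew k l p]
    ring
  have hD : ∀ m i j, F.D m (F.tor i j l) =
      F.D m (F.conn i j l) - F.D m (F.conn j i l) - F.D m (F.struc i j l) := by
    intro m i j; rw [F.tor_eq, map_sub, map_sub]
  have hj := F.jacobi i j k l
  simp only [Finset.sum_add_distrib, Finset.sum_sub_distrib] at key hj
  simp only [curv, nablaThree, sig, hD, Finset.sum_add_distrib, Finset.sum_sub_distrib]
  linear_combination key + hj

theorem nablaThree_swap_left {α : ι → ι → ι → A} (hα : ∀ i j k, α i j k = - α j i k)
    (i j k l : ι) : F.nablaThree α i j k l = - F.nablaThree α i k j l := by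
  have h : ∑ p, (F.conn i j p * α p k l + F.conn i k p * α j p l + F.conn i l p * α j k p)
      = - ∑ p, (F.conn i k p * α p j l + F.conn i j p * α k p l + F.conn i l p * α k j p) := by
    rw [← Finset.sum_neg_distrib]
    refine Finset.sum_congr rfl fun p _ ↦ ?_
    rw [hα p k, hα p j, hα k j]
    ring
  simp only [nablaThree, h, hα j k l, map_neg]
  ring

theorem nablaThree_tor_swap_left (i j k l : ι) :
    F.nablaThree F.tor i j k l = - F.nablaThree F.tor i k j l :=
  F.nablaThree_swap_left F.tor_swap_left i j k l

theorem nablaThree_tor_swap_right (i j k l : ι) :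
    F.nablaThree F.tor i j k l = - F.nablaThree F.tor i j l k := by
  have h : ∑ p, (F.conn i j p * F.tor p k l + F.conn i k p * F.tor j p l + F.conn i l p * F.tor j k p)
      = - ∑ p, (F.conn i j p * F.tor p l k + F.conn i l p * F.tor j p k
        + F.conn i k p * F.tor j l p) := by
    rw [← Finset.sum_neg_distrib]
    refine Finset.sum_congr rfl fun p _ ↦ ?_
    rw [F.tor_swap_right p k, F.tor_swap_right j p l, F.tor_swap_right j p k]
    ring
  simp only [nablaThree, h, F.tor_swap_right j k l, map_neg]
  ring

/-- `dT = 0`, in terms of the connection with torsion `T`. -/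
def Closed : Prop := ∀ i j k l, F.nablaThree F.tor i j k l - F.nablaThree F.tor j i k l
  + F.nablaThree F.tor k i j l - F.nablaThree F.tor l i j k + 2 * F.sig i j k l = 0

variable {F}

theorem Closed.bianchi (h : F.Closed) (i j k l : ι) :
    F.curv i j k l + F.curv j k i l + F.curv k i j l =
      F.nablaThree F.tor l i j k - F.sig i j k l := by
  rw [F.bianchi, F.nablaThree_tor_swap_left j k]
  linear_combination h i j k l

variable (F) in
theorem sig_cycle (i j k l : ι) : F.sig i k l j = F.sig i j k l := by
  refine Finset.sum_congr rfl fun p _ ↦ ?_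
  rw [F.tor_swap_left l j, F.tor_swap_left l i, F.tor_swap_left k j, F.tor_swap_left k i]
  ring

variable (F) in
theorem sig_shift (i j k l : ι) : F.sig j k l i = - F.sig i j k l := by
  simp only [sig, ← Finset.sum_neg_distrib]
  refine Finset.sum_congr rfl fun p _ ↦ ?_
  rw [F.tor_swap_left l i, F.tor_swap_left k i, F.tor_swap_left l j, F.tor_swap_left j i]
  ring

theorem two_mul_cancel {a b : A} (h : 2 * a = 2 * b) : a = b := by
  have := congrArg (fun x ↦ (1 / 2 : ℝ) • x) h
  simpa only [two_mul, ← two_smul ℝ, smul_smul, one_div, inv_mul_cancel₀ (two_ne_zero' ℝ),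
    one_smul] using this

/-- If `dT = 0`, then the cyclic sum of `R` over its last three arguments is `∇T`. -/
theorem Closed.curv_cycle (h : F.Closed) (i j k l : ι) :
    F.curv i j k l + F.curv i k l j + F.curv i l j k = F.nablaThree F.tor i j k l := by
  apply two_mul_cancel
  have h1 := h.bianchi i j k l
  have h2 := h.bianchi i k l j
  have h3 := h.bianchi i l j k
  have h4 := h.bianchi j k l i
  rw [F.sig_cycle] at h2
  rw [← F.sig_cycle i l j k, ] at h3
  rw [F.sig_shift] at h4
  have h5 := h i j k l
  rw [F.curv_swap_left k i j l, F.curv_swap_right i k j l, F.curv_swap_right j k i l] at h1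
  rw [F.curv_swap_left l i k j, F.curv_swap_right i l k j, F.curv_swap_right k l i j] at h2
  rw [F.curv_swap_left j i l k, F.curv_swap_right i j l k, F.curv_swap_right l j i k,
    F.nablaThree_tor_swap_right k i l j] at h3
  linear_combination h1 + h2 + h3 + h4 - h5

theorem ric_sub_ric (h : F.Closed) (j k : ι) :
    F.ric j k - F.ric k j = ∑ i, F.nablaThree F.tor i i j k := by
  have h0 : ∀ i, F.sig i j k i = 0 := fun i ↦ by
    refine Finset.sum_eq_zero fun p _ ↦ ?_
    have h' : F.tor i i p = 0 := two_mul_cancel (by linear_combination F.tor_swap_left i i p)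
    rw [h', F.tor_swap_left k i, F.tor_swap_left j i]
    ring
  have h1 : ∀ i, F.curv j k i i = 0 := fun i ↦
    two_mul_cancel (by linear_combination F.curv_swap_right j k i i)
  rw [ric, ric, ← Finset.sum_sub_distrib]
  refine Finset.sum_congr rfl fun i _ ↦ ?_
  have := h.bianchi i j k i
  rw [h0, h1, F.curv_swap_left k i] at this
  linear_combination this

/-! #### Commutation of covariant derivatives -/

/-- The action of a matrix on 3-tensors. -/
def actThree (m : ι → ι → A) (α : ι → ι → ι → A) (j k l : ι) : A :=
  ∑ p, (m j p * α p k l + m k p * α j p l + m l p * α j k p)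

theorem actThree_comm (m n : ι → ι → A) (α : ι → ι → ι → A) (j k l : ι) :
    actThree m (actThree n α) j k l - actThree n (actThree m α) j k l =
      actThree (fun a b ↦ ∑ p, (m a p * n p b - n a p * m p b)) α j k l := by
  simp only [actThree, Finset.mul_sum, Finset.sum_mul, mul_add, sub_mul, Finset.sum_add_distrib,
    Finset.sum_sub_distrib]
  have e : ∀ f : ι → ι → A, ∑ x, ∑ y, f x y = ∑ x, ∑ y, f y x := fun f ↦ Finset.sum_comm
  rw [e fun x y ↦ m j y * n y x * α x k l, e fun x y ↦ n j y * m y x * α x k l,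
    e fun x y ↦ m k y * n y x * α j x l, e fun x y ↦ n k y * m y x * α j x l,
    e fun x y ↦ m l y * n y x * α j k x, e fun x y ↦ n l y * m y x * α j k x,
    e fun x y ↦ n j x * (m k y * α x y l), e fun x y ↦ n j x * (m l y * α x k y),
    e fun x y ↦ n k x * (m j y * α y x l), e fun x y ↦ n k x * (m l y * α j x y),
    e fun x y ↦ n l x * (m j y * α y k x), e fun x y ↦ n l x * (m k y * α j y x)]
  simp only [mul_assoc, mul_left_comm (n _ _) (m _ _)]
  ring

theorem D_actThree (d : Derivation ℝ A A) (m : ι → ι → A) (α : ι → ι → ι → A) (j k l : ι) :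
    d (actThree m α j k l) =
      actThree (fun a b ↦ d (m a b)) α j k l + actThree m (fun a b c ↦ d (α a b c)) j k l := by
  simp only [actThree, map_sum, map_add, Derivation.leibniz, smul_eq_mul,
    ← Finset.sum_add_distrib]
  exact Finset.sum_congr rfl fun p _ ↦ by ring

variable (F) in
theorem nablaThree_eq (α : ι → ι → ι → A) (i j k l : ι) :
    F.nablaThree α i j k l = F.D i (α j k l) - actThree (F.conn i) α j k l := rfl

variable (F) in
/-- The second covariant derivative of a 3-tensor. -/
def nablaSqThree (α : ι → ι → ι → A) (a b j k l : ι) : A :=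
  F.nablaThree (F.nablaThree α b) a j k l - ∑ p, F.conn a b p * F.nablaThree α p j k l

variable (F) in
theorem nablaSqThree_sub (α : ι → ι → ι → A) (a b j k l : ι) :
    F.nablaSqThree α a b j k l - F.nablaSqThree α b a j k l =
      - ∑ p, F.tor a b p * F.nablaThree α p j k l - actThree (F.curv a b) α j k l := by
  have key : F.nablaThree (F.nablaThree α b) a j k l - F.nablaThree (F.nablaThree α a) b j k l =
      ∑ p, F.struc a b p * F.nablaThree α p j k l - actThree (F.curv a b) α j k l := by
    have hlin : ∀ (m : ι → ι → A) (β : ι → ι → ι → A) (c : ι),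
        actThree m (F.nablaThree β c) j k l = actThree m (fun j k l ↦ F.D c (β j k l)) j k l -
          actThree m (actThree (F.conn c) β) j k l := by
      intro m β c
      simp only [actThree, nablaThree_eq, ← Finset.sum_sub_distrib]
      exact Finset.sum_congr rfl fun p _ ↦ by ring
    have hD : ∀ c d, F.D c (F.nablaThree α d j k l) = F.D c (F.D d (α j k l)) -
        (actThree (fun x y ↦ F.D c (F.conn d x y)) α j k l +
          actThree (F.conn d) (fun x y z ↦ F.D c (α x y z)) j k l) := by
      intro c d
      rw [nablaThree_eq, map_sub, D_actThree]
    have hR : actThree (F.curv a b) α j k l =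
        actThree (fun x y ↦ F.D a (F.conn b x y)) α j k l
        - actThree (fun x y ↦ F.D b (F.conn a x y)) α j k l
        + actThree (fun x y ↦ ∑ p, (F.conn b x p * F.conn a p y - F.conn a x p * F.conn b p y)) α
            j k l
        - ∑ p, F.struc a b p * actThree (F.conn p) α j k l := by
      have : ∑ p, F.struc a b p * actThree (F.conn p) α j k l =
          actThree (fun x y ↦ ∑ p, F.struc a b p * F.conn p x y) α j k l := by
        simp only [actThree, Finset.mul_sum, Finset.sum_mul]
        rw [Finset.sum_comm]
        refine Finset.sum_congr rfl fun p _ ↦ ?_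
        simp only [← Finset.sum_add_distrib]
        exact Finset.sum_congr rfl fun q _ ↦ by ring
      rw [this]
      simp only [actThree, ← Finset.sum_sub_distrib, ← Finset.sum_add_distrib]
      refine Finset.sum_congr rfl fun p _ ↦ ?_
      simp only [curv, Finset.sum_sub_distrib]
      ring
    have hc := F.comm (α j k l) a b
    have hS : ∑ p, F.struc a b p * F.nablaThree α p j k l =
        ∑ p, F.struc a b p * F.D p (α j k l) - ∑ p, F.struc a b p * actThree (F.conn p) α j k l := by
      simp only [nablaThree_eq, mul_sub, Finset.sum_sub_distrib]
    rw [F.nablaThree_eq (F.nablaThree α b), F.nablaThree_eq (F.nablaThree α a), hlin, hlin, hD, hD,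
      hS, hR]
    linear_combination hc - actThree_comm (F.conn b) (F.conn a) α j k l
  have hT : ∑ p, F.tor a b p * F.nablaThree α p j k l =
      ∑ p, F.conn a b p * F.nablaThree α p j k l - ∑ p, F.conn b a p * F.nablaThree α p j k l
        - ∑ p, F.struc a b p * F.nablaThree α p j k l := by
    simp only [F.tor_eq, sub_mul, Finset.sum_sub_distrib]
  rw [nablaSqThree, nablaSqThree, hT]
  linear_combination key

variable (F) in
theorem nablaTwo_nablaOne_sub (θ : ι → A) (a b j : ι) :
    F.nablaTwo (F.nablaOne θ) a b j - F.nablaTwo (F.nablaOne θ) b a j =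
      - ∑ p, F.tor a b p * F.nablaOne θ p j - ∑ p, F.curv a b j p * θ p := by
  have h1 : ∀ a b, F.nablaTwo (F.nablaOne θ) a b j = F.D a (F.D b (θ j))
      - ∑ p, F.D a (F.conn b j p) * θ p - ∑ p, F.conn b j p * F.D a (θ p)
      - ∑ p, F.conn a b p * F.nablaOne θ p j - ∑ p, F.conn a j p * F.D b (θ p)
      + ∑ q, ∑ p, F.conn a j p * F.conn b p q * θ q := by
    intro a b
    have : ∑ q, ∑ p, F.conn a j p * F.conn b p q * θ q =
        ∑ p, F.conn a j p * ∑ q, F.conn b p q * θ q := by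
      rw [Finset.sum_comm]
      simp only [Finset.mul_sum, mul_assoc]
    rw [this, nablaTwo, nablaOne, map_sub, map_sum]
    simp only [Derivation.leibniz, smul_eq_mul, Finset.sum_add_distrib, nablaOne, mul_sub,
      Finset.sum_sub_distrib]
    simp only [mul_comm (θ _)]
    ring
  have h2 : ∑ p, F.curv a b j p * θ p = ∑ p, F.D a (F.conn b j p) * θ p
      - ∑ p, F.D b (F.conn a j p) * θ p + ∑ q, ∑ p, F.conn b j p * F.conn a p q * θ q
      - ∑ q, ∑ p, F.conn a j p * F.conn b p q * θ q
      - ∑ p, F.struc a b p * ∑ q, F.conn p j q * θ q := by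
    have : ∑ p, F.struc a b p * ∑ q, F.conn p j q * θ q =
        ∑ q, ∑ p, F.struc a b p * F.conn p j q * θ q := by
      rw [Finset.sum_comm]
      simp only [Finset.mul_sum, mul_assoc]
    rw [this]
    simp only [curv, ← Finset.sum_sub_distrib, ← Finset.sum_add_distrib]
    refine Finset.sum_congr rfl fun p _ ↦ ?_
    rw [add_mul, Finset.sum_mul, sub_mul, add_sub_assoc, add_sub_assoc,
      ← Finset.sum_sub_distrib, ← Finset.sum_sub_distrib]
    congr 1
    exact Finset.sum_congr rfl fun q _ ↦ by ring
  have h3 : ∑ p, F.tor a b p * F.nablaOne θ p j =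
      ∑ p, F.conn a b p * F.nablaOne θ p j - ∑ p, F.conn b a p * F.nablaOne θ p j
        - (∑ p, F.struc a b p * F.D p (θ j) - ∑ p, F.struc a b p * ∑ q, F.conn p j q * θ q) := by
    simp only [F.tor_eq, sub_mul, Finset.sum_sub_distrib, nablaOne, mul_sub]
    ring
  rw [h1, h1, h2, h3, ← F.comm]
  ring

/-! #### The divergence of the torsion -/

variable (F) in
/-- The divergence `∑ᵢ ∇ᵢT_{ijk}` of the torsion. -/
def divTor (j k : ι) : A := ∑ i, F.nablaThree F.tor i i j k

variable (F) in
theorem nablaTwo_divTor (a j k : ι) :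
    F.nablaTwo F.divTor a j k = ∑ i, F.nablaSqThree F.tor a i i j k := by
  have h0 : ∑ i, ∑ p, F.conn a i p * F.nablaThree F.tor p i j k =
      - ∑ i, ∑ p, F.conn a i p * F.nablaThree F.tor i p j k := by
    rw [Finset.sum_comm, ← Finset.sum_neg_distrib]
    refine Finset.sum_congr rfl fun i _ ↦ ?_
    rw [← Finset.sum_neg_distrib]
    exact Finset.sum_congr rfl fun p _ ↦ by rw [F.conn_skew a p i]; ring
  have h1 : ∑ p, (F.conn a j p * F.divTor p k + F.conn a k p * F.divTor j p) =
      ∑ i, ∑ p, (F.conn a j p * F.nablaThree F.tor i i p k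
        + F.conn a k p * F.nablaThree F.tor i i j p) := by
    rw [Finset.sum_comm]
    simp only [divTor, Finset.mul_sum, Finset.sum_add_distrib]
  simp only [nablaSqThree, Finset.sum_sub_distrib, h0]
  rw [nablaTwo, h1, divTor, map_sum]
  simp only [nablaThree_eq F (F.nablaThree F.tor _), Finset.sum_sub_distrib]
  simp only [actThree, Finset.sum_add_distrib]
  ring

theorem tor_self_left (i k : ι) : F.tor i i k = 0 :=
  two_mul_cancel (by linear_combination F.tor_swap_left i i k)

variable (F) in
theorem sum_tor_mul_tor_eq_zero (k : ι) :
    ∑ i, ∑ j, ∑ m, F.tor i j m * ∑ p, F.tor i j p * F.tor m k p = 0 := by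
  refine Finset.sum_eq_zero fun i _ ↦ Finset.sum_eq_zero fun j _ ↦ ?_
  have h : ∑ m, F.tor i j m * ∑ p, F.tor i j p * F.tor m k p =
      - ∑ m, F.tor i j m * ∑ p, F.tor i j p * F.tor m k p := by
    simp only [Finset.mul_sum]
    conv_lhs => rw [Finset.sum_comm]
    simp only [← Finset.sum_neg_distrib]
    refine Finset.sum_congr rfl fun m _ ↦ Finset.sum_congr rfl fun p _ ↦ ?_
    rw [F.tor_cycle p k m, F.tor_swap_left k m p]
    ring
  exact two_mul_cancel (by linear_combination h)

theorem sum_cycle (f : ι → ι → ι → A) : ∑ i, ∑ j, ∑ k, f j k i = ∑ i, ∑ j, ∑ k, f i j k := by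
  rw [Finset.sum_comm]
  exact Finset.sum_congr rfl fun i _ ↦ Finset.sum_comm

variable (F) in
theorem sum_tor_mul_sig (k : ι) : ∑ i, ∑ j, ∑ m, F.tor i j m * F.sig i j m k = 0 := by
  have h : ∑ i, ∑ j, ∑ m, F.tor i j m * F.sig i j m k =
      (∑ i, ∑ j, ∑ m, F.tor i j m * ∑ p, F.tor i j p * F.tor m k p)
      + (∑ i, ∑ j, ∑ m, F.tor j m i * ∑ p, F.tor j m p * F.tor i k p)
      + ∑ i, ∑ j, ∑ m, F.tor m i j * ∑ p, F.tor m i p * F.tor j k p := by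
    simp only [← Finset.sum_add_distrib, sig]
    refine Finset.sum_congr rfl fun i _ ↦ Finset.sum_congr rfl fun j _ ↦
      Finset.sum_congr rfl fun m _ ↦ ?_
    rw [← F.tor_cycle i j m, F.tor_cycle m i j]
    simp only [Finset.sum_add_distrib]
    ring
  rw [h, sum_cycle fun i j m ↦ F.tor i j m * ∑ p, F.tor i j p * F.tor m k p,
    ← sum_cycle fun i j m ↦ F.tor m i j * ∑ p, F.tor m i p * F.tor j k p,
    F.sum_tor_mul_tor_eq_zero]
  simp

theorem Closed.three_mul_sum_tor_mul_curv (h : F.Closed) (k : ι) :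
    3 * ∑ i, ∑ j, ∑ m, F.tor i j m * F.curv i j m k =
      ∑ i, ∑ j, ∑ m, F.tor i j m * F.nablaThree F.tor k i j m := by
  have h1 : ∑ i, ∑ j, ∑ m, F.tor i j m * (F.curv i j m k + F.curv j m i k + F.curv m i j k) =
      3 * ∑ i, ∑ j, ∑ m, F.tor i j m * F.curv i j m k := by
    have e2 : ∑ i, ∑ j, ∑ m, F.tor i j m * F.curv j m i k =
        ∑ i, ∑ j, ∑ m, F.tor i j m * F.curv i j m k := by
      rw [← sum_cycle fun i j m ↦ F.tor i j m * F.curv i j m k]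
      refine Finset.sum_congr rfl fun i _ ↦ Finset.sum_congr rfl fun j _ ↦
        Finset.sum_congr rfl fun m _ ↦ ?_
      rw [F.tor_cycle]
    have e3 : ∑ i, ∑ j, ∑ m, F.tor i j m * F.curv m i j k =
        ∑ i, ∑ j, ∑ m, F.tor i j m * F.curv i j m k := by
      rw [← sum_cycle fun i j m ↦ F.tor i j m * F.curv m i j k]
      refine Finset.sum_congr rfl fun i _ ↦ Finset.sum_congr rfl fun j _ ↦
        Finset.sum_congr rfl fun m _ ↦ ?_
      rw [← F.tor_cycle]
    simp only [mul_add, Finset.sum_add_distrib, e2, e3]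
    ring
  rw [← h1]
  simp only [h.bianchi, mul_sub, Finset.sum_sub_distrib, F.sum_tor_mul_sig, sub_zero]

theorem Closed.three_mul_sum_tor_mul_nabla (h : F.Closed) (k : ι) :
    3 * ∑ i, ∑ j, ∑ p, F.tor i j p * F.nablaThree F.tor p i j k =
      ∑ i, ∑ j, ∑ m, F.tor i j m * F.nablaThree F.tor k i j m := by
  have h0 : ∑ i, ∑ j, ∑ p, F.tor i j p * (F.nablaThree F.tor i j p k
      - F.nablaThree F.tor j i p k + F.nablaThree F.tor p i j k - F.nablaThree F.tor k i j p
        + 2 * F.sig i j p k) = 0 := by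
    simp only [h _ _ _ _, mul_zero, Finset.sum_const_zero]
  have e1 : ∑ i, ∑ j, ∑ p, F.tor i j p * F.nablaThree F.tor i j p k =
      ∑ i, ∑ j, ∑ p, F.tor i j p * F.nablaThree F.tor p i j k := by
    rw [← sum_cycle fun i j p ↦ F.tor i j p * F.nablaThree F.tor p i j k]
    refine Finset.sum_congr rfl fun i _ ↦ Finset.sum_congr rfl fun j _ ↦
        Finset.sum_congr rfl fun m _ ↦ ?_
    rw [F.tor_cycle]
  have e2 : ∑ i, ∑ j, ∑ p, F.tor i j p * F.nablaThree F.tor j i p k =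
      - ∑ i, ∑ j, ∑ p, F.tor i j p * F.nablaThree F.tor i j p k := by
    rw [Finset.sum_comm]
    simp only [← Finset.sum_neg_distrib]
    refine Finset.sum_congr rfl fun i _ ↦ Finset.sum_congr rfl fun j _ ↦
        Finset.sum_congr rfl fun m _ ↦ ?_
    rw [F.tor_swap_left j i]
    ring
  have e3 : ∑ i, ∑ j, ∑ p, F.tor i j p * (2 * F.sig i j p k) = 0 := by
    simp only [mul_left_comm _ (2 : A), ← Finset.mul_sum, F.sum_tor_mul_sig, mul_zero]
  simp only [mul_add, mul_sub, Finset.sum_add_distrib, Finset.sum_sub_distrib, e1, e2, e3] at h0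
  linear_combination h0

/-- The codifferential of `δT` vanishes, in terms of the connection with torsion `T`. -/
theorem Closed.two_mul_div_divTor (h : F.Closed) (k : ι) :
    2 * ∑ j, F.nablaTwo F.divTor j j k = ∑ a, ∑ b, F.tor a b k * F.divTor a b := by
  have h1 : ∑ j, F.nablaTwo F.divTor j j k = ∑ i, ∑ j, F.nablaSqThree F.tor j i i j k := by
    rw [Finset.sum_comm]
    exact Finset.sum_congr rfl fun j _ ↦ F.nablaTwo_divTor j j k
  have hsk : ∀ a b i j, F.nablaSqThree F.tor a b i j k = - F.nablaSqThree F.tor a b j i k := by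
    intro a b i j
    simp only [nablaSqThree, F.nablaThree_swap_left (F.nablaThree_tor_swap_left b) a i j k,
      F.nablaThree_tor_swap_left _ i j, mul_neg, Finset.sum_neg_distrib]
    ring
  have h2 : ∑ j, F.nablaTwo F.divTor j j k = - ∑ i, ∑ j, F.nablaSqThree F.tor i j i j k := by
    rw [h1, Finset.sum_comm]
    simp only [← Finset.sum_neg_distrib]
    exact Finset.sum_congr rfl fun i _ ↦ Finset.sum_congr rfl fun j _ ↦ hsk ..
  have h3 : 2 * ∑ j, F.nablaTwo F.divTor j j k = ∑ i, ∑ j,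
      (∑ p, F.tor i j p * F.nablaThree F.tor p i j k + actThree (F.curv i j) F.tor i j k) := by
    rw [two_mul]
    nth_rw 1 [h1]
    rw [h2, ← sub_eq_add_neg, ← Finset.sum_sub_distrib]
    refine Finset.sum_congr rfl fun i _ ↦ ?_
    rw [← Finset.sum_sub_distrib]
    refine Finset.sum_congr rfl fun j _ ↦ ?_
    linear_combination - F.nablaSqThree_sub F.tor i j i j k
  have h4 : ∑ i, ∑ j, actThree (F.curv i j) F.tor i j k =
      ∑ a, ∑ b, F.tor a b k * F.divTor a b - ∑ i, ∑ j, ∑ m, F.tor i j m * F.curv i j m k := by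
    have e1 : ∑ i, ∑ j, ∑ p, F.curv i j i p * F.tor p j k =
        - ∑ a, ∑ b, F.tor a b k * F.ric b a := by
      have : ∀ j, ∑ i, ∑ p, F.curv i j i p * F.tor p j k = - ∑ p, F.tor p j k * F.ric j p := by
        intro j
        rw [Finset.sum_comm, ← Finset.sum_neg_distrib]
        refine Finset.sum_congr rfl fun p _ ↦ ?_
        simp only [ric, Finset.mul_sum, ← Finset.sum_neg_distrib]
        exact Finset.sum_congr rfl fun i _ ↦ by rw [F.curv_swap_right i j i p]; ring
      rw [Finset.sum_comm]
      simp only [this, Finset.sum_neg_distrib]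
      rw [Finset.sum_comm]
    have e2 : ∑ i, ∑ j, ∑ p, F.curv i j j p * F.tor i p k =
        ∑ a, ∑ b, F.tor a b k * F.ric a b := by
      refine Finset.sum_congr rfl fun i _ ↦ ?_
      rw [Finset.sum_comm]
      refine Finset.sum_congr rfl fun p _ ↦ ?_
      simp only [ric, Finset.mul_sum]
      refine Finset.sum_congr rfl fun j _ ↦ ?_
      rw [F.curv_swap_left i j, F.curv_swap_right j i]
      ring
    have e3 : ∑ i, ∑ j, ∑ p, F.curv i j k p * F.tor i j p =
        - ∑ i, ∑ j, ∑ m, F.tor i j m * F.curv i j m k := by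
      simp only [← Finset.sum_neg_distrib]
      refine Finset.sum_congr rfl fun i _ ↦ Finset.sum_congr rfl fun j _ ↦
        Finset.sum_congr rfl fun p _ ↦ ?_
      rw [F.curv_swap_right i j k p]
      ring
    simp only [actThree, Finset.sum_add_distrib, e1, e2, e3, divTor, ← ric_sub_ric h, mul_sub,
      Finset.sum_sub_distrib]
    ring
  rw [h3]
  simp only [Finset.sum_add_distrib, h4]
  have h5 := h.three_mul_sum_tor_mul_curv k
  have h6 := h.three_mul_sum_tor_mul_nabla k
  have h7 : ∑ i, ∑ j, ∑ p, F.tor i j p * F.nablaThree F.tor p i j k =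
      ∑ i, ∑ j, ∑ m, F.tor i j m * F.curv i j m k := by
    have h8 := congrArg (fun x ↦ (1 / 3 : ℝ) • x) (h6.trans h5.symm)
    have e3 : ∀ a : A, (3 : A) * a = (3 : ℝ) • a := fun a ↦ by
      rw [Algebra.smul_def, map_ofNat]
    simpa only [e3, smul_smul, one_div, inv_mul_cancel₀ (three_ne_zero' ℝ), one_smul] using h8
  rw [h7]
  ring

/-! #### The Bochner formula -/

variable (F) in
/-- The divergence of a 1-form. -/
def divOne (θ : ι → A) : A := ∑ i, F.nablaOne θ i i

variable (F) in
theorem D_sum_sq (θ : ι → A) (i : ι) :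
    F.D i (∑ p, θ p * θ p) = 2 * ∑ p, θ p * F.nablaOne θ i p := by
  have h0 : ∑ p, θ p * ∑ q, F.conn i p q * θ q = 0 := by
    have : ∑ p, θ p * ∑ q, F.conn i p q * θ q = - ∑ p, θ p * ∑ q, F.conn i p q * θ q := by
      simp only [Finset.mul_sum]
      conv_lhs => rw [Finset.sum_comm]
      simp only [← Finset.sum_neg_distrib]
      refine Finset.sum_congr rfl fun p _ ↦ Finset.sum_congr rfl fun q _ ↦ ?_
      rw [F.conn_skew i q p]
      ring
    exact two_mul_cancel (by linear_combination this)
  simp only [nablaOne, mul_sub, Finset.sum_sub_distrib, h0, map_sum, Derivation.leibniz,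
    smul_eq_mul, sub_zero]
  rw [Finset.mul_sum]
  exact Finset.sum_congr rfl fun p _ ↦ by ring

variable (F) in
theorem D_divOne (θ : ι → A) (j : ι) :
    F.D j (F.divOne θ) = ∑ i, F.nablaTwo (F.nablaOne θ) j i i := by
  have h0 : ∑ i, ∑ p, F.conn j i p * F.nablaOne θ p i =
      - ∑ i, ∑ p, F.conn j i p * F.nablaOne θ i p := by
    rw [Finset.sum_comm]
    simp only [← Finset.sum_neg_distrib]
    refine Finset.sum_congr rfl fun p _ ↦ Finset.sum_congr rfl fun q _ ↦ ?_
    rw [F.conn_skew j q p]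
    ring
  simp only [divOne, nablaTwo, map_sum, Finset.sum_sub_distrib, Finset.sum_add_distrib, h0]
  ring

/-- If `6 Ric = - ∇θ`, then `∑ᵢ ∇ᵢ∇ᵢθ_j = ∇_j(div θ) + Ric(e_j, θ)`. -/
theorem Closed.sum_nablaTwo_nablaOne (h : F.Closed) {θ : ι → A}
    (hθ : ∀ j k, 6 * F.ric j k = - F.nablaOne θ j k) (j : ι) :
    ∑ i, F.nablaTwo (F.nablaOne θ) i i j = F.D j (F.divOne θ) + ∑ p, F.ric j p * θ p := by
  have hw : ∀ a b, F.nablaOne θ a b - F.nablaOne θ b a = - 6 * F.divTor a b := by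
    intro a b
    rw [divTor, ← ric_sub_ric h]
    linear_combination hθ a b - hθ b a
  have h1 : ∑ i, F.nablaTwo (F.nablaOne θ) i i j - ∑ i, F.nablaTwo (F.nablaOne θ) i j i =
      - 6 * ∑ i, F.nablaTwo F.divTor i i j := by
    rw [Finset.mul_sum, ← Finset.sum_sub_distrib]
    refine Finset.sum_congr rfl fun i _ ↦ ?_
    have h0 : F.D i (F.nablaOne θ i j) - F.D i (F.nablaOne θ j i) =
        - 6 * F.D i (F.divTor i j) := by
      rw [← map_sub, hw]
      have : (-6 : A) * F.divTor i j = (-6 : ℝ) • F.divTor i j := by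
        rw [Algebra.smul_def, map_neg, map_ofNat]
      rw [this, Derivation.map_smul, Algebra.smul_def, map_neg, map_ofNat]
    have h00 : ∑ p, (F.conn i i p * F.nablaOne θ p j + F.conn i j p * F.nablaOne θ i p) -
        ∑ p, (F.conn i j p * F.nablaOne θ p i + F.conn i i p * F.nablaOne θ j p) =
        - 6 * ∑ p, (F.conn i i p * F.divTor p j + F.conn i j p * F.divTor i p) := by
      rw [Finset.mul_sum, ← Finset.sum_sub_distrib]
      refine Finset.sum_congr rfl fun p _ ↦ ?_
      linear_combination F.conn i i p * hw p j + F.conn i j p * hw i p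
    simp only [nablaTwo]
    linear_combination h0 - h00
  have h2 : ∑ i, F.nablaTwo (F.nablaOne θ) i j i = F.D j (F.divOne θ)
      - ∑ i, ∑ p, F.tor i j p * F.nablaOne θ p i + ∑ p, F.ric j p * θ p := by
    have : ∑ p, F.ric j p * θ p = - ∑ i, ∑ p, F.curv i j i p * θ p := by
      rw [Finset.sum_comm, ← Finset.sum_neg_distrib]
      refine Finset.sum_congr rfl fun p _ ↦ ?_
      rw [ric, Finset.sum_mul, ← Finset.sum_neg_distrib]
      exact Finset.sum_congr rfl fun i _ ↦ by rw [F.curv_swap_right i j i p]; ring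
    rw [this, D_divOne, ← Finset.sum_neg_distrib, ← Finset.sum_sub_distrib,
      ← Finset.sum_add_distrib]
    refine Finset.sum_congr rfl fun i _ ↦ ?_
    linear_combination F.nablaTwo_nablaOne_sub θ i j i
  have h3 : 2 * ∑ i, ∑ p, F.tor i j p * F.nablaOne θ p i =
      - 6 * ∑ a, ∑ b, F.tor a b j * F.divTor a b := by
    have e1 : ∑ i, ∑ p, F.tor i j p * F.nablaOne θ p i =
        ∑ a, ∑ b, F.tor a b j * F.nablaOne θ a b := by
      rw [Finset.sum_comm]
      refine Finset.sum_congr rfl fun p _ ↦ Finset.sum_congr rfl fun q _ ↦ ?_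
      rw [F.tor_cycle p q j]
    have e2 : ∑ i, ∑ p, F.tor i j p * F.nablaOne θ p i =
        - ∑ a, ∑ b, F.tor a b j * F.nablaOne θ b a := by
      simp only [← Finset.sum_neg_distrib]
      refine Finset.sum_congr rfl fun p _ ↦ Finset.sum_congr rfl fun q _ ↦ ?_
      rw [F.tor_swap_right p j q]
      ring
    rw [two_mul]
    nth_rw 1 [e1]
    rw [e2, ← sub_eq_add_neg, ← Finset.sum_sub_distrib, Finset.mul_sum]
    refine Finset.sum_congr rfl fun p _ ↦ ?_
    rw [← Finset.sum_sub_distrib, Finset.mul_sum]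
    refine Finset.sum_congr rfl fun q _ ↦ ?_
    linear_combination F.tor p q j * hw p q
  have h4 := h.two_mul_div_divTor j
  apply two_mul_cancel
  linear_combination 2 * h1 + 2 * h2 - h3 - 6 * h4

/-- The Bochner formula for a 1-form `θ` with `6 Ric = - ∇θ`. -/
theorem Closed.bochner (h : F.Closed) {θ : ι → A}
    (hθ : ∀ j k, 6 * F.ric j k = - F.nablaOne θ j k) :
    6 * (∑ i, F.D i (F.D i (∑ p, θ p * θ p))
        - ∑ i, ∑ p, F.conn i i p * F.D p (∑ p, θ p * θ p)) =
      12 * (∑ i, ∑ p, F.nablaOne θ i p * F.nablaOne θ i p)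
        + 12 * (∑ p, θ p * F.D p (F.divOne θ)) - ∑ p, θ p * F.D p (∑ p, θ p * θ p) := by
  have h1 : ∀ i, F.D i (F.D i (∑ p, θ p * θ p)) - ∑ q, F.conn i i q * F.D q (∑ p, θ p * θ p) =
      2 * ∑ p, (F.nablaOne θ i p * F.nablaOne θ i p
        + θ p * F.nablaTwo (F.nablaOne θ) i i p) := by
    intro i
    have e0 : F.D i (2 * ∑ p, θ p * F.nablaOne θ i p) =
        2 * ∑ p, (F.D i (θ p) * F.nablaOne θ i p + θ p * F.D i (F.nablaOne θ i p)) := by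
      rw [two_mul, map_add, ← two_mul, map_sum]
      congr 1
      refine Finset.sum_congr rfl fun p _ ↦ ?_
      simp only [Derivation.leibniz, smul_eq_mul]
      ring
    have e1 : ∑ p, (∑ q, F.conn i p q * θ q) * F.nablaOne θ i p =
        - ∑ p, θ p * ∑ q, F.conn i p q * F.nablaOne θ i q := by
      simp only [Finset.sum_mul, Finset.mul_sum]
      rw [Finset.sum_comm]
      simp only [← Finset.sum_neg_distrib]
      refine Finset.sum_congr rfl fun p _ ↦ Finset.sum_congr rfl fun q _ ↦ ?_
      rw [F.conn_skew i q p]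
      ring
    have e2 : ∀ p, F.D i (θ p) = F.nablaOne θ i p + ∑ q, F.conn i p q * θ q := by
      intro p; rw [nablaOne]; ring
    have e3 : ∀ p, F.D i (F.nablaOne θ i p) = F.nablaTwo (F.nablaOne θ) i i p
        + ∑ q, F.conn i i q * F.nablaOne θ q p + ∑ q, F.conn i p q * F.nablaOne θ i q := by
      intro p; rw [nablaTwo, Finset.sum_add_distrib]; ring
    have e4 : ∑ q, F.conn i i q * (2 * ∑ p, θ p * F.nablaOne θ q p) =
        2 * ∑ p, θ p * ∑ q, F.conn i i q * F.nablaOne θ q p := by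
      simp only [Finset.mul_sum]
      rw [Finset.sum_comm]
      refine Finset.sum_congr rfl fun p _ ↦ Finset.sum_congr rfl fun q _ ↦ by ring
    simp only [D_sum_sq, e0, e4]
    simp only [e2, e3, add_mul, mul_add, Finset.sum_add_distrib, e1]
    ring
  have h2 : ∑ i, ∑ p, θ p * F.nablaTwo (F.nablaOne θ) i i p =
      ∑ p, θ p * F.D p (F.divOne θ) + ∑ p, θ p * ∑ q, F.ric p q * θ q := by
    rw [Finset.sum_comm, ← Finset.sum_add_distrib]
    refine Finset.sum_congr rfl fun p _ ↦ ?_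
    rw [← Finset.mul_sum, h.sum_nablaTwo_nablaOne hθ, mul_add]
  have h3 : 12 * ∑ p, θ p * ∑ q, F.ric p q * θ q = - ∑ p, θ p * F.D p (∑ p, θ p * θ p) := by
    simp only [D_sum_sq, Finset.mul_sum, ← Finset.sum_neg_distrib]
    refine Finset.sum_congr rfl fun p _ ↦ Finset.sum_congr rfl fun q _ ↦ ?_
    linear_combination 2 * θ p * θ q * hθ p q
  rw [← Finset.sum_sub_distrib]
  simp only [h1, ← Finset.mul_sum, Finset.sum_add_distrib, h2]
  linear_combination h3

end FrameCalculus

end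


noncomputable section

/-! ### Algebra of the standard form -/

section PhiAlgebra

set_option linter.unusedSectionVars false

variable {A : Type*} [CommRing A] [Algebra ℝ A]

theorem natCast_mul_cancel {n : ℕ} (hn : n ≠ 0) {a b : A} (h : (n : A) * a = n * b) : a = b := by
  have := congrArg (fun x ↦ (n : ℝ)⁻¹ • x) h
  have e : ∀ a : A, (n : A) * a = (n : ℝ) • a := fun a ↦ by
    rw [Algebra.smul_def, map_natCast]
  simpa only [e, smul_smul, inv_mul_cancel₀ (Nat.cast_ne_zero.2 hn : (n : ℝ) ≠ 0), one_smul]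
    using this

theorem sum_kron_cast_mul (i : Fin 8) (f : Fin 8 → A) : ∑ p, (kron i p : A) * f p = f i := by
  simp [kron_eq]

theorem sum_kron_cast_mul' (i : Fin 8) (f : Fin 8 → A) : ∑ p, (kron p i : A) * f p = f i := by
  simp [kron_eq]

theorem phi_cast_swap_left (i j k l : Fin 8) : (phi i j k l : A) = - phi j i k l := by
  rw [phi_swap_left, Int.cast_neg]

theorem phi_cast_swap_mid (i j k l : Fin 8) : (phi i j k l : A) = - phi i k j l := by
  rw [phi_swap_mid, Int.cast_neg]

theorem phi_cast_swap_right (i j k l : Fin 8) : (phi i j k l : A) = - phi i j l k := by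
  rw [phi_swap_right, Int.cast_neg]

theorem phi_cast_cycle (i j k l : Fin 8) : (phi i j k l : A) = phi i k l j := by
  rw [phi_cast_swap_mid, phi_cast_swap_right, neg_neg]

/-- The action of a matrix on 4-tensors. -/
def actFour (m : Fin 8 → Fin 8 → A) (α : Fin 8 → Fin 8 → Fin 8 → Fin 8 → A) (i j k l : Fin 8) : A :=
  ∑ p, (m i p * α p j k l + m j p * α i p k l + m k p * α i j p l + m l p * α i j k p)

variable (A) in
/-- The components of `Φ` as elements of the ring `A`. -/
def phiCast (i j k l : Fin 8) : A := (phi i j k l : A)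

theorem actFour_comm (m n : Fin 8 → Fin 8 → A) (α : Fin 8 → Fin 8 → Fin 8 → Fin 8 → A)
    (i j k l : Fin 8) :
    actFour m (actFour n α) i j k l - actFour n (actFour m α) i j k l =
      actFour (fun a b ↦ ∑ p, (m a p * n p b - n a p * m p b)) α i j k l := by
  simp only [actFour, Finset.mul_sum, Finset.sum_mul, mul_add, sub_mul, Finset.sum_add_distrib,
    Finset.sum_sub_distrib]
  have e : ∀ f : Fin 8 → Fin 8 → A, ∑ x, ∑ y, f x y = ∑ x, ∑ y, f y x := fun f ↦ Finset.sum_comm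
  rw [e fun x y ↦ m i y * n y x * α x j k l, e fun x y ↦ n i y * m y x * α x j k l,
    e fun x y ↦ m j y * n y x * α i x k l, e fun x y ↦ n j y * m y x * α i x k l,
    e fun x y ↦ m k y * n y x * α i j x l, e fun x y ↦ n k y * m y x * α i j x l,
    e fun x y ↦ m l y * n y x * α i j k x, e fun x y ↦ n l y * m y x * α i j k x,
    e fun x y ↦ n i x * (m j y * α x y k l), e fun x y ↦ n i x * (m k y * α x j y l),
    e fun x y ↦ n i x * (m l y * α x j k y),
    e fun x y ↦ n j x * (m i y * α y x k l), e fun x y ↦ n j x * (m k y * α i x y l),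
    e fun x y ↦ n j x * (m l y * α i x k y),
    e fun x y ↦ n k x * (m i y * α y j x l), e fun x y ↦ n k x * (m j y * α i y x l),
    e fun x y ↦ n k x * (m l y * α i j x y),
    e fun x y ↦ n l x * (m i y * α y j k x), e fun x y ↦ n l x * (m j y * α i y k x),
    e fun x y ↦ n l x * (m k y * α i j y x)]
  simp only [mul_assoc, mul_left_comm (n _ _) (m _ _)]
  ring

theorem sum_sum_phi_cast (i j k l : Fin 8) :
    ∑ p, ∑ q, (phi i j p q : A) * phi k l p q =
      6 * (kron i k * kron j l - kron i l * kron j k) - 4 * phi i j k l := by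
  have := congrArg (Int.cast : ℤ → A) (sum_sum_phi_mul_phi i j k l)
  push_cast at this
  exact this

theorem sum_sum_sum_phi_cast (i j : Fin 8) :
    ∑ p, ∑ q, ∑ r, (phi i p q r : A) * phi j p q r = 42 * kron i j := by
  have h : ∀ p, phi i p j p = 0 := fun p ↦ by
    have h1 := phi_swap_mid i p j p
    have h2 := phi_swap_right i j p p
    omega
  simp only [sum_sum_phi_cast]
  have e : ∀ p : Fin 8, (kron p p : A) = 1 := fun p ↦ by simp [kron_eq]
  simp only [Finset.sum_sub_distrib, ← Finset.mul_sum, h, e, sum_kron_cast_mul]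
  simp
  ring

theorem sum_rot_three {ι : Type*} [Fintype ι] (f : ι → ι → ι → A) :
    ∑ a, ∑ b, ∑ c, f a b c = ∑ c, ∑ a, ∑ b, f a b c := by
  rw [Finset.sum_comm' (s' := fun _ ↦ Finset.univ) (t' := Finset.univ) (by simp)]
  conv_rhs => rw [Finset.sum_comm]
  rw [Finset.sum_comm]
  exact Finset.sum_congr rfl fun a _ ↦ Finset.sum_comm

theorem sum_rot_four {ι : Type*} [Fintype ι] (f : ι → ι → ι → ι → A) :
    ∑ a, ∑ b, ∑ c, ∑ d, f a b c d = ∑ d, ∑ a, ∑ b, ∑ c, f a b c d := by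
  rw [Finset.sum_comm (s := Finset.univ) (t := Finset.univ) (f := fun d a ↦ ∑ b, ∑ c, f a b c d)]
  exact Finset.sum_congr rfl fun a _ ↦ sum_rot_three _

theorem sum_phi_mul_actFour {m : Fin 8 → Fin 8 → A} (hm : ∀ i j, m i j = - m j i)
    (k l : Fin 8) : ∑ b, ∑ c, ∑ d, (phi l b c d : A) * actFour m (phiCast A) k b c d =
      24 * m k l - 12 * ∑ a, ∑ b, (phi k l a b : A) * m a b := by
  have hk : ∀ i : Fin 8, m i i = 0 := fun i ↦
    natCast_mul_cancel two_ne_zero (by push_cast; linear_combination hm i i)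
  have e1 : ∑ b, ∑ c, ∑ d, ∑ p, (phi l b c d : A) * (m k p * phi p b c d) = 42 * m k l := by
    have h : ∀ p, ∑ b, ∑ c, ∑ d, (phi l b c d : A) * (m k p * phi p b c d) =
        kron l p * (42 * m k p) := by
      intro p
      have := sum_sum_sum_phi_cast (A := A) l p
      calc _ = m k p * ∑ b, ∑ c, ∑ d, (phi l b c d : A) * phi p b c d := by
            simp only [Finset.mul_sum, mul_left_comm]
        _ = _ := by rw [this]; ring
    rw [sum_rot_four]
    simp only [h, sum_kron_cast_mul]
  have e2 : ∑ b, ∑ c, ∑ d, ∑ p, (phi l b c d : A) * (m b p * phi k p c d) =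
      - 6 * m k l - 4 * ∑ a, ∑ b, (phi k l a b : A) * m a b := by
    have h : ∀ b p, ∑ c, ∑ d, (phi l b c d : A) * (m b p * phi k p c d) =
        6 * kron l k * (kron b p * m b p) - 6 * (kron b k * (kron l p * m b p))
          - 4 * (phi k l b p * m b p) := by
      intro b p
      have := sum_sum_phi_cast (A := A) l b k p
      calc _ = m b p * ∑ c, ∑ d, (phi l b c d : A) * phi k p c d := by
            simp only [Finset.mul_sum, mul_left_comm]
        _ = _ := by
          rw [this, phi_cast_swap_mid l b k p, phi_cast_swap_left l k b p]
          ring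
    have h' : ∀ b, ∑ c, ∑ d, ∑ p, (phi l b c d : A) * (m b p * phi k p c d) =
        - 6 * (kron b k * m b l) - 4 * ∑ p, phi k l b p * m b p := by
      intro b
      rw [sum_rot_three]
      simp only [h, Finset.sum_sub_distrib, ← Finset.mul_sum, sum_kron_cast_mul, hk]
      ring
    rw [Finset.sum_congr rfl fun b _ ↦ h' b]
    simp only [Finset.sum_sub_distrib, ← Finset.mul_sum, sum_kron_cast_mul']
  have e3 : ∑ b, ∑ c, ∑ d, ∑ p, (phi l b c d : A) * (m c p * phi k b p d) =
      - 6 * m k l - 4 * ∑ a, ∑ b, (phi k l a b : A) * m a b := by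
    rw [← e2, Finset.sum_comm]
    refine Finset.sum_congr rfl fun b _ ↦ Finset.sum_congr rfl fun c _ ↦
      Finset.sum_congr rfl fun d _ ↦ Finset.sum_congr rfl fun p _ ↦ ?_
    rw [phi_cast_swap_mid l c b, phi_cast_swap_mid k c p]
    ring
  have e4 : ∑ b, ∑ c, ∑ d, ∑ p, (phi l b c d : A) * (m d p * phi k b c p) =
      - 6 * m k l - 4 * ∑ a, ∑ b, (phi k l a b : A) * m a b := by
    rw [← e2, sum_rot_three]
    refine Finset.sum_congr rfl fun b _ ↦ Finset.sum_congr rfl fun c _ ↦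
      Finset.sum_congr rfl fun d _ ↦ Finset.sum_congr rfl fun p _ ↦ ?_
    rw [← phi_cast_cycle l b c d, ← phi_cast_cycle k p c d]
  generalize ∑ a, ∑ b, (phi k l a b : A) * m a b = S at e2 e3 e4 ⊢
  simp only [actFour, phiCast, Finset.mul_sum, mul_add, Finset.sum_add_distrib]
  rw [e1, e2, e3, e4]
  ring

/-- If a skew-symmetric matrix annihilates `Φ`, then it is an eigenvector of `Φ`. -/
theorem sum_phi_mul_of_actFour_eq_zero {m : Fin 8 → Fin 8 → A} (hm : ∀ i j, m i j = - m j i)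
    (h : ∀ i j k l, actFour m (phiCast A) i j k l = 0) (k l : Fin 8) :
    ∑ a, ∑ b, (phi k l a b : A) * m a b = 2 * m k l := by
  have h0 := sum_phi_mul_actFour hm k l
  simp only [h, mul_zero, Finset.sum_const_zero] at h0
  exact natCast_mul_cancel (n := 12) (by norm_num) (by push_cast; linear_combination h0)

/-- A skew-symmetric eigenvector of `Φ` for the eigenvalue 2 annihilates `Φ`. -/
theorem actFour_eq_zero_of_sum_phi_mul {m : Fin 8 → Fin 8 → ℝ} (hm : ∀ i j, m i j = - m j i)
    (h : ∀ k l, ∑ a, ∑ b, (phi k l a b : ℝ) * m a b = 2 * m k l) (i j k l : Fin 8) :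
    actFour m (phiCast ℝ) i j k l = 0 := by
  set W := actFour m (phiCast ℝ) with hW
  have h0 : ∀ k l, ∑ b, ∑ c, ∑ d, (phi l b c d : ℝ) * W k b c d = 0 := by
    intro k l
    rw [sum_phi_mul_actFour hm, h]
    ring
  have s1 : ∀ i j k l, W i j k l = - W j i k l := by
    intro i j k l
    simp only [hW, actFour, phiCast, ← Finset.sum_neg_distrib]
    refine Finset.sum_congr rfl fun p _ ↦ ?_
    rw [phi_cast_swap_left p j, phi_cast_swap_left i p, phi_cast_swap_left i j p,
      phi_cast_swap_left i j k]
    ring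
  have s2 : ∀ i j k l, W i j k l = - W i k j l := by
    intro i j k l
    simp only [hW, actFour, phiCast, ← Finset.sum_neg_distrib]
    refine Finset.sum_congr rfl fun p _ ↦ ?_
    rw [phi_cast_swap_mid p j, phi_cast_swap_mid i p, phi_cast_swap_mid i j p,
      phi_cast_swap_mid i j k]
    ring
  have s3 : ∀ i j k l, W i j k l = - W i j l k := by
    intro i j k l
    simp only [hW, actFour, phiCast, ← Finset.sum_neg_distrib]
    refine Finset.sum_congr rfl fun p _ ↦ ?_
    rw [phi_cast_swap_right p j k, phi_cast_swap_right i p, phi_cast_swap_right i j p,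
      phi_cast_swap_right i j k]
    ring
  have t1 : ∑ i, ∑ j, ∑ k, ∑ l, W i j k l * ∑ p, m i p * phi p j k l = 0 := by
    refine Finset.sum_eq_zero fun i _ ↦ ?_
    calc _ = ∑ j, ∑ k, ∑ l, ∑ p, m i p * (phi p j k l * W i j k l) := by
          simp only [Finset.mul_sum]
          refine Finset.sum_congr rfl fun b _ ↦ Finset.sum_congr rfl fun c _ ↦
            Finset.sum_congr rfl fun d _ ↦ Finset.sum_congr rfl fun p _ ↦ ?_
          ring
      _ = ∑ p, m i p * ∑ j, ∑ k, ∑ l, (phi p j k l : ℝ) * W i j k l := by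
          rw [sum_rot_four]
          simp only [Finset.mul_sum]
      _ = 0 := by simp only [h0, mul_zero, Finset.sum_const_zero]
  have t2 : ∑ i, ∑ j, ∑ k, ∑ l, W i j k l * ∑ p, m j p * phi i p k l = 0 := by
    rw [← t1, Finset.sum_comm]
    refine Finset.sum_congr rfl fun b _ ↦ Finset.sum_congr rfl fun c _ ↦
            Finset.sum_congr rfl fun d _ ↦ Finset.sum_congr rfl fun p _ ↦ ?_
    rw [s1 c b]
    simp only [phi_cast_swap_left c, mul_neg, Finset.sum_neg_distrib, neg_mul, neg_neg]
  have t3 : ∑ i, ∑ j, ∑ k, ∑ l, W i j k l * ∑ p, m k p * phi i j p l = 0 := by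
    rw [← t2]
    refine Finset.sum_congr rfl fun i _ ↦ ?_
    rw [Finset.sum_comm]
    refine Finset.sum_congr rfl fun c _ ↦
            Finset.sum_congr rfl fun d _ ↦ Finset.sum_congr rfl fun p _ ↦ ?_
    rw [s2 i d c]
    simp only [phi_cast_swap_mid i d, mul_neg, Finset.sum_neg_distrib, neg_mul, neg_neg]
  have t4 : ∑ i, ∑ j, ∑ k, ∑ l, W i j k l * ∑ p, m l p * phi i j k p = 0 := by
    rw [← t3]
    refine Finset.sum_congr rfl fun i _ ↦ Finset.sum_congr rfl fun j _ ↦ ?_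
    rw [Finset.sum_comm]
    refine Finset.sum_congr rfl fun d _ ↦ Finset.sum_congr rfl fun p _ ↦ ?_
    rw [s3 i j p d]
    simp only [phi_cast_swap_right i j p, mul_neg, Finset.sum_neg_distrib, neg_mul, neg_neg]
  have hsq : ∑ i, ∑ j, ∑ k, ∑ l, W i j k l ^ 2 = 0 := by
    have : ∀ i j k l, W i j k l ^ 2 = W i j k l * (∑ p, m i p * phi p j k l)
        + W i j k l * (∑ p, m j p * phi i p k l) + W i j k l * (∑ p, m k p * phi i j p l)
        + W i j k l * (∑ p, m l p * phi i j k p) := by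
      intro i j k l
      rw [sq]
      nth_rw 2 [hW]
      simp only [actFour, phiCast, Finset.sum_add_distrib]
      ring
    simp only [this, Finset.sum_add_distrib, t1, t2, t3, t4, add_zero]
  have h1 := (Finset.sum_eq_zero_iff_of_nonneg fun i _ ↦ by positivity).1 hsq i (Finset.mem_univ _)
  have h2 := (Finset.sum_eq_zero_iff_of_nonneg fun i _ ↦ by positivity).1 h1 j (Finset.mem_univ _)
  have h3 := (Finset.sum_eq_zero_iff_of_nonneg fun i _ ↦ by positivity).1 h2 k (Finset.mem_univ _)
  have h4 := (Finset.sum_eq_zero_iff_of_nonneg fun i _ ↦ by positivity).1 h3 l (Finset.mem_univ _)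
  exact pow_eq_zero_iff (two_ne_zero) |>.1 h4

/-! #### 3-forms -/

/-- The 1-form `τ_a = ∑ Φ_{aijk} T_{ijk}`. -/
def phiTrace (T : Fin 8 → Fin 8 → Fin 8 → A) (a : Fin 8) : A :=
  ∑ i, ∑ j, ∑ k, (phi a i j k : A) * T i j k

/-- The 3-form `∑ (T_{pab} Φ_{abqr} + T_{qab} Φ_{abrp} + T_{rab} Φ_{abpq})`. -/
def phiTwist (T : Fin 8 → Fin 8 → Fin 8 → A) (p q r : Fin 8) : A :=
  ∑ a, ∑ b, (T p a b * phi a b q r + T q a b * phi a b r p + T r a b * phi a b p q)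

theorem sum_phiTrace_mul_phi {T : Fin 8 → Fin 8 → Fin 8 → A} (h₁ : ∀ i j k, T i j k = - T j i k)
    (h₂ : ∀ i j k, T i j k = - T i k j) (p q r : Fin 8) :
    ∑ a, phiTrace T a * phi a p q r = 6 * T p q r - 3 * phiTwist T p q r := by
  have h0 : ∑ a, phiTrace T a * phi a p q r =
      ∑ i, ∑ j, ∑ k, T i j k * ∑ a, (phi a i j k : A) * phi a p q r := by
    simp only [phiTrace, Finset.sum_mul, Finset.mul_sum]
    rw [← sum_rot_four fun i j k a ↦ (phi a i j k : A) * T i j k * phi a p q r]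
    refine Finset.sum_congr rfl fun b _ ↦ Finset.sum_congr rfl fun c _ ↦
            Finset.sum_congr rfl fun d _ ↦ Finset.sum_congr rfl fun p _ ↦ by ring
  have hc : ∀ i j k, ∑ a, (phi a i j k : A) * phi a p q r =
      kron i p * (kron j q * kron k r - kron j r * kron k q)
      - kron i q * (kron j p * kron k r - kron j r * kron k p)
      + kron i r * (kron j p * kron k q - kron j q * kron k p)
      - (kron i p * phi j k q r + kron i q * phi j k r p + kron i r * phi j k p q
        + kron j p * phi k i q r + kron j q * phi k i r p + kron j r * phi k i p q
        + kron k p * phi i j q r + kron k q * phi i j r p + kron k r * phi i j p q) := by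
    intro i j k
    have := congrArg (Int.cast : ℤ → A) (sum_phi_mul_phi i j k p q r)
    push_cast at this
    exact this
  have k3 : ∀ a b c, ∑ i, ∑ j, ∑ k, T i j k * ((kron i a : A) * (kron j b * kron k c)) =
      T a b c := by
    intro a b c
    simp only [mul_left_comm (T _ _ _), ← Finset.mul_sum, sum_kron_cast_mul', mul_comm (T _ _ _)]
  have k1 : ∀ a (f : Fin 8 → Fin 8 → A), ∑ i, ∑ j, ∑ k, T i j k * ((kron i a : A) * f j k) =
      ∑ j, ∑ k, T a j k * f j k := by
    intro a f
    simp only [mul_left_comm (T _ _ _), ← Finset.mul_sum, sum_kron_cast_mul']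
  have hcyc : ∀ i j k, T j k i = T i j k := fun i j k ↦ by rw [h₂ j k i, h₁ j i k, neg_neg]
  have k2 : ∀ a (f : Fin 8 → Fin 8 → A), ∑ i, ∑ j, ∑ k, T i j k * ((kron j a : A) * f k i) =
      ∑ j, ∑ k, T a j k * f j k := by
    intro a f
    rw [← k1, ← FrameCalculus.sum_cycle fun i j k ↦ T i j k * ((kron i a : A) * f j k)]
    simp only [hcyc]
  have k4 : ∀ a (f : Fin 8 → Fin 8 → A), ∑ i, ∑ j, ∑ k, T i j k * ((kron k a : A) * f i j) =
      ∑ j, ∑ k, T a j k * f j k := by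
    intro a f
    rw [← k1, ← FrameCalculus.sum_cycle fun i j k ↦ T i j k * ((kron k a : A) * f i j)]
    simp only [hcyc]
  rw [h0]
  simp only [hc, mul_sub, mul_add, Finset.sum_sub_distrib, Finset.sum_add_distrib, k3, k1, k2, k4,
    phiTwist]
  have t1 := hcyc p q r
  have t2 := hcyc q r p
  have t3 := h₂ p r q
  have t4 := h₁ q p r
  have t5 := h₁ r q p
  linear_combination 3 * t1 + t2 - t3 - t4 - t5

/-- The quadratic form `q = ∑ Φ_{ijkl} T_{mij} T_{mkl}`. -/
def phiQuad (T : Fin 8 → Fin 8 → Fin 8 → A) : A :=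
  ∑ m, ∑ i, ∑ j, ∑ k, ∑ l, (phi i j k l : A) * (T m i j * T m k l)

theorem sum_phiTrace_sq {T : Fin 8 → Fin 8 → Fin 8 → A} (h₁ : ∀ i j k, T i j k = - T j i k)
    (h₂ : ∀ i j k, T i j k = - T i k j) :
    ∑ a, phiTrace T a * phiTrace T a =
      6 * (∑ i, ∑ j, ∑ k, T i j k * T i j k) - 9 * phiQuad T := by
  have hcyc : ∀ i j k, T j k i = T i j k := fun i j k ↦ by rw [h₂ j k i, h₁ j i k, neg_neg]
  have h0 : ∑ a, phiTrace T a * phiTrace T a =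
      ∑ i, ∑ j, ∑ k, T i j k * ∑ a, phiTrace T a * phi a i j k := by
    simp only [Finset.mul_sum]
    rw [sum_rot_four]
    refine Finset.sum_congr rfl fun a _ ↦ ?_
    conv_lhs => enter [2]; rw [phiTrace]
    simp only [Finset.mul_sum]
    refine Finset.sum_congr rfl fun b _ ↦ Finset.sum_congr rfl fun c _ ↦
      Finset.sum_congr rfl fun d _ ↦ by ring
  have q1 : ∑ p, ∑ q, ∑ r, T p q r * ∑ a, ∑ b, T p a b * (phi a b q r : A) = phiQuad T := by
    refine Finset.sum_congr rfl fun p _ ↦ ?_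
    simp only [Finset.mul_sum]
    have : ∑ q, ∑ r, ∑ a, ∑ b, T p q r * (T p a b * (phi a b q r : A)) =
        ∑ a, ∑ b, ∑ q, ∑ r, T p q r * (T p a b * (phi a b q r : A)) := by
      rw [sum_rot_four, Finset.sum_congr rfl fun b _ ↦ sum_rot_three _, Finset.sum_comm]
    rw [this]
    refine Finset.sum_congr rfl fun b _ ↦ Finset.sum_congr rfl fun c _ ↦
      Finset.sum_congr rfl fun d _ ↦ Finset.sum_congr rfl fun p _ ↦ by ring
  have q2 : ∑ p, ∑ q, ∑ r, T p q r * ∑ a, ∑ b, T q a b * (phi a b r p : A) = phiQuad T := by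
    rw [← q1, ← FrameCalculus.sum_cycle fun p q r ↦
      T p q r * ∑ a, ∑ b, T p a b * (phi a b q r : A)]
    simp only [hcyc]
  have q3 : ∑ p, ∑ q, ∑ r, T p q r * ∑ a, ∑ b, T r a b * (phi a b p q : A) = phiQuad T := by
    rw [← q1, ← FrameCalculus.sum_cycle fun p q r ↦
      T p q r * ∑ a, ∑ b, T r a b * (phi a b p q : A)]
    simp only [hcyc]
  have h3 : ∑ p, ∑ q, ∑ r, T p q r * phiTwist T p q r = 3 * phiQuad T := by
    simp only [phiTwist, Finset.sum_add_distrib, mul_add, q1, q2, q3]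
    ring
  rw [h0]
  simp only [sum_phiTrace_mul_phi h₁ h₂, mul_sub, Finset.sum_sub_distrib,
    mul_left_comm _ (6 : A), mul_left_comm _ (3 : A), ← Finset.mul_sum, h3]
  ring

/-- The codifferential of `Φ` in terms of the torsion. -/
theorem sum_actFour_tor {T : Fin 8 → Fin 8 → Fin 8 → A} (h₁ : ∀ i j k, T i j k = - T j i k)
    (h₂ : ∀ i j k, T i j k = - T i k j) (j k l : Fin 8) :
    ∑ i, actFour (T i) (phiCast A) i j k l = - phiTwist T j k l := by
  have hcyc : ∀ i j k, T j k i = T i j k := fun i j k ↦ by rw [h₂ j k i, h₁ j i k, neg_neg]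
  have h0 : ∀ i k, T i i k = 0 := fun i k ↦
    natCast_mul_cancel two_ne_zero (by push_cast; linear_combination h₁ i i k)
  simp only [actFour, phiCast, phiTwist, ← Finset.sum_neg_distrib]
  rw [Finset.sum_comm]
  refine Finset.sum_congr rfl fun p _ ↦ Finset.sum_congr rfl fun i _ ↦ ?_
  rw [h0, ← hcyc i j p, ← hcyc i k p, ← hcyc i l p, phi_cast_swap_left i p,
    phi_cast_swap_mid i j p, phi_cast_swap_left i p, phi_cast_swap_right p i j l,
    ← phi_cast_cycle i p j k, phi_cast_swap_left i p]
  ring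

set_option maxRecDepth 100000 in
theorem eigen_phi_eq : ∀ k l a b : Fin 8,
    kron k a * kron l b - kron k b * kron l a - phi k l a b =
      - (∑ s, phi 0 s k l * (kron 0 a * kron s b - kron 0 b * kron s a - phi 0 s a b))
      + kron k 0 * (kron 0 a * kron l b - kron 0 b * kron l a - phi 0 l a b)
      - kron l 0 * (kron 0 a * kron k b - kron 0 b * kron k a - phi 0 k a b) := by
  decide +kernel

theorem eigen_of_eigen_zero {m : Fin 8 → Fin 8 → ℝ} (hm : ∀ i j, m i j = - m j i)
    (h : ∀ s : Fin 7, ∑ a, ∑ b, (phi 0 s.succ a b : ℝ) * m a b = 2 * m 0 s.succ) (k l : Fin 8) :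
    ∑ a, ∑ b, (phi k l a b : ℝ) * m a b = 2 * m k l := by
  let n : Fin 8 → Fin 8 → ℝ := fun k l ↦ ∑ a, ∑ b,
    ((kron k a * kron l b - kron k b * kron l a - phi k l a b : ℤ) : ℝ) * m a b
  have hn : ∀ k l, n k l = 2 * m k l - ∑ a, ∑ b, (phi k l a b : ℝ) * m a b := by
    intro k l
    have e1 : ∑ a, ∑ b, (kron k a : ℝ) * (kron l b : ℝ) * m a b = m k l := by
      simp only [mul_assoc, ← Finset.mul_sum, sum_kron_cast_mul]
    have e2 : ∑ a, ∑ b, (kron k b : ℝ) * (kron l a : ℝ) * m a b = m l k := by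
      simp only [mul_assoc, mul_left_comm ((kron k _ : ℤ) : ℝ), ← Finset.mul_sum,
        sum_kron_cast_mul]
    simp only [n]
    push_cast
    simp only [sub_mul, Finset.sum_sub_distrib, e1, e2]
    rw [hm l k]
    ring
  have h0 : ∀ s, n 0 s = 0 := by
    intro s
    refine Fin.cases ?_ (fun s ↦ ?_) s
    · have h00 : ∀ a b, phi 0 0 a b = 0 := fun a b ↦ by
        have := phi_swap_left 0 0 a b; omega
      have := hm 0 0
      rw [hn]
      simp only [h00, Int.cast_zero, zero_mul, Finset.sum_const_zero]
      linarith
    · rw [hn, h s, sub_self]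
  have h1 : n k l = - (∑ s, (phi 0 s k l : ℝ) * n 0 s) + kron k 0 * n 0 l - kron l 0 * n 0 k := by
    simp only [n, eigen_phi_eq k l]
    push_cast
    simp only [Finset.mul_sum]
    rw [← sum_rot_three fun a b s ↦ _]
    simp only [← Finset.sum_neg_distrib, ← Finset.sum_add_distrib, ← Finset.sum_sub_distrib]
    refine Finset.sum_congr rfl fun a _ ↦ Finset.sum_congr rfl fun b _ ↦ ?_
    rw [sub_mul, add_mul, Finset.sum_mul]
    simp only [neg_mul, mul_assoc]
  simp only [h0, mul_zero, Finset.sum_const_zero, neg_zero, add_zero, sub_zero] at h1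
  rw [hn] at h1
  linarith

/-- The 3-form with given components at increasing triples of indices. -/
def skewOfTriples (t : {x : Fin 8 × Fin 8 × Fin 8 // x.1 < x.2.1 ∧ x.2.1 < x.2.2} → ℝ)
    (i j k : Fin 8) : ℝ :=
  let u : Fin 8 → Fin 8 → Fin 8 → ℝ := fun i j k ↦
    if h : i < j ∧ j < k then t ⟨(i, j, k), h⟩ else 0
  u i j k - u j i k - u i k j - u k j i + u j k i + u k i j

theorem eq_zero_of_eigen {T : Fin 8 → Fin 8 → Fin 8 → ℝ} (h₁ : ∀ i j k, T i j k = - T j i k)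
    (h₂ : ∀ i j k, T i j k = - T i k j)
    (h : ∀ i k l, ∑ a, ∑ b, (phi k l a b : ℝ) * T i a b = 2 * T i k l) (i j k : Fin 8) :
    T i j k = 0 := by
  have hq : phiQuad T = 2 * ∑ i, ∑ j, ∑ k, T i j k * T i j k := by
    have : phiQuad T = ∑ m, ∑ i, ∑ j, T m i j * ∑ k, ∑ l, (phi i j k l : ℝ) * T m k l := by
      simp only [phiQuad, Finset.mul_sum]
      refine Finset.sum_congr rfl fun b _ ↦ Finset.sum_congr rfl fun c _ ↦
        Finset.sum_congr rfl fun d _ ↦ Finset.sum_congr rfl fun p _ ↦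
        Finset.sum_congr rfl fun p _ ↦ by ring
    rw [this]
    simp only [h, mul_left_comm _ (2 : ℝ), ← Finset.mul_sum]
  have hsq := sum_phiTrace_sq h₁ h₂
  have hpos : 0 ≤ ∑ a, phiTrace T a * phiTrace T a :=
    Finset.sum_nonneg fun a _ ↦ mul_self_nonneg _
  have h0 : ∑ i, ∑ j, ∑ k, T i j k * T i j k = 0 := by
    refine le_antisymm (by linarith) ?_
    exact Finset.sum_nonneg fun i _ ↦ Finset.sum_nonneg fun j _ ↦ Finset.sum_nonneg fun k _ ↦
      mul_self_nonneg _
  have e1 := (Finset.sum_eq_zero_iff_of_nonneg fun i _ ↦ Finset.sum_nonneg fun j _ ↦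
    Finset.sum_nonneg fun k _ ↦ mul_self_nonneg _).1 h0 i (Finset.mem_univ _)
  have e2 := (Finset.sum_eq_zero_iff_of_nonneg fun j _ ↦
    Finset.sum_nonneg fun k _ ↦ mul_self_nonneg _).1 e1 j (Finset.mem_univ _)
  exact mul_self_eq_zero.1
    ((Finset.sum_eq_zero_iff_of_nonneg fun k _ ↦ mul_self_nonneg _).1 e2 k (Finset.mem_univ _))

/-- Every family of eight 2-forms can be corrected by a 3-form to a family of elements of the
Lie algebra of `Spin(7)`. -/
theorem exists_skew_eigen (m : Fin 8 → Fin 8 → Fin 8 → ℝ) (hm : ∀ i j k, m i j k = - m i k j) :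
    ∃ T : Fin 8 → Fin 8 → Fin 8 → ℝ, (∀ i j k, T i j k = - T j i k) ∧
      (∀ i j k, T i j k = - T i k j) ∧
      ∀ i k l, ∑ a, ∑ b, (phi k l a b : ℝ) * (m i a b - T i a b) = 2 * (m i k l - T i k l) := by
  let L : ({x : Fin 8 × Fin 8 × Fin 8 // x.1 < x.2.1 ∧ x.2.1 < x.2.2} → ℝ) →ₗ[ℝ]
      (Fin 8 × Fin 7 → ℝ) :=
    { toFun t x := ∑ a, ∑ b, (phi 0 x.2.succ a b : ℝ) * skewOfTriples t x.1 a b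
        - 2 * skewOfTriples t x.1 0 x.2.succ
      map_add' t t' := by
        have : ∀ i j k, skewOfTriples (t + t') i j k =
            skewOfTriples t i j k + skewOfTriples t' i j k := by
          intro i j k
          simp only [skewOfTriples]
          split_ifs <;> simp <;> ring
        funext x
        simp only [this, mul_add, Finset.sum_add_distrib, Pi.add_apply]
        ring
      map_smul' r t := by
        have : ∀ i j k, skewOfTriples (r • t) i j k = r * skewOfTriples t i j k := by
          intro i j k
          simp only [skewOfTriples]
          split_ifs <;> simp <;> ring
        funext x
        simp only [this, mul_left_comm _ r, ← Finset.mul_sum, Pi.smul_apply, smul_eq_mul,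
          RingHom.id_apply]
        ring }
  have s1 : ∀ t i j k, skewOfTriples t i j k = - skewOfTriples t j i k := by
    intro t i j k; simp only [skewOfTriples]; ring
  have s2 : ∀ t i j k, skewOfTriples t i j k = - skewOfTriples t i k j := by
    intro t i j k; simp only [skewOfTriples]; ring
  have hinj : Function.Injective L := by
    rw [injective_iff_map_eq_zero]
    intro t ht
    have h0 : ∀ i j k, skewOfTriples t i j k = 0 := by
      refine eq_zero_of_eigen (s1 t) (s2 t) fun i ↦ ?_
      refine eigen_of_eigen_zero (s2 t i) fun s ↦ ?_
      have := congrFun ht (i, s)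
      exact sub_eq_zero.1 this
    funext ⟨⟨i, j, k⟩, hij, hjk⟩
    have := h0 i j k
    simp only at hij hjk
    simpa [skewOfTriples, hij, hjk, hij.not_gt, hjk.not_gt, (hij.trans hjk).not_gt] using this
  have hsurj : Function.Surjective L := by
    refine (LinearMap.injective_iff_surjective_of_finrank_eq_finrank ?_).1 hinj
    rw [Module.finrank_fintype_fun_eq_card, Module.finrank_fintype_fun_eq_card]
    decide
  obtain ⟨t, ht⟩ := hsurj fun x ↦ ∑ a, ∑ b, (phi 0 x.2.succ a b : ℝ) * m x.1 a b
    - 2 * m x.1 0 x.2.succ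
  refine ⟨skewOfTriples t, s1 t, s2 t, fun i ↦ ?_⟩
  refine eigen_of_eigen_zero (fun j k ↦ by rw [hm i j k, s2 t i j k]; ring) fun s ↦ ?_
  have := congrFun ht (i, s)
  simp only [L, LinearMap.coe_mk, AddHom.coe_mk] at this
  simp only [mul_sub, Finset.sum_sub_distrib]
  linarith

end PhiAlgebra

end


noncomputable section

section CodiffAlgebra

set_option linter.unusedSectionVars false

variable {A : Type*} [CommRing A] [Algebra ℝ A]

theorem sum_mul_phi_last (T : Fin 8 → Fin 8 → Fin 8 → A) (a : Fin 8) :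
    ∑ i, ∑ j, ∑ k, T i j k * (phi i j k a : A) = - phiTrace T a := by
  simp only [phiTrace, ← Finset.sum_neg_distrib]
  refine Finset.sum_congr rfl fun i _ ↦ Finset.sum_congr rfl fun j _ ↦
    Finset.sum_congr rfl fun k _ ↦ ?_
  rw [phi_cast_swap_right i j k a, phi_cast_swap_mid i j a k, phi_cast_swap_left i a j k]
  ring

/-- If `2 d = phiTwist T`, then `d` is `T` up to the contraction of `phiTrace T` with `Φ`. -/
theorem six_mul_of_two_mul_eq_phiTwist {T d : Fin 8 → Fin 8 → Fin 8 → A}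
    (h₁ : ∀ i j k, T i j k = - T j i k) (h₂ : ∀ i j k, T i j k = - T i k j)
    (h : ∀ i j k, 2 * d i j k = phiTwist T i j k) (i j k : Fin 8) :
    6 * T i j k = 6 * d i j k + ∑ a, phiTrace T a * phi a i j k := by
  rw [sum_phiTrace_mul_phi h₁ h₂, ← h]
  ring

theorem sum_mul_phi_of_two_mul_eq_phiTwist {T d : Fin 8 → Fin 8 → Fin 8 → A}
    (h₁ : ∀ i j k, T i j k = - T j i k) (h₂ : ∀ i j k, T i j k = - T i k j)
    (h : ∀ i j k, 2 * d i j k = phiTwist T i j k) (a : Fin 8) :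
    ∑ i, ∑ j, ∑ k, d i j k * (phi i j k a : A) = 6 * phiTrace T a := by
  apply natCast_mul_cancel (n := 6) (by norm_num)
  have e : ∀ i j k, 6 * d i j k = 6 * T i j k - ∑ b, phiTrace T b * phi b i j k := fun i j k ↦ by
    rw [six_mul_of_two_mul_eq_phiTwist h₁ h₂ h]; ring
  have e1 := sum_mul_phi_last T a
  have e2 : ∑ i, ∑ j, ∑ k, (∑ b, phiTrace T b * phi b i j k) * (phi i j k a : A) =
      - (42 * phiTrace T a) := by
    rw [sum_mul_phi_last]
    congr 1
    rw [phiTrace]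
    simp only [Finset.mul_sum]
    rw [sum_rot_four]
    have : ∀ b, ∑ i, ∑ j, ∑ k, (phi a i j k : A) * (phiTrace T b * phi b i j k) =
        kron a b * (42 * phiTrace T b) := by
      intro b
      simp only [mul_left_comm _ (phiTrace T b), ← Finset.mul_sum, sum_sum_sum_phi_cast]
      ring
    simp only [this, sum_kron_cast_mul]
  have e3 : 6 * ∑ i, ∑ j, ∑ k, d i j k * (phi i j k a : A) =
      ∑ i, ∑ j, ∑ k, (6 * d i j k) * (phi i j k a : A) := by
    simp only [Finset.mul_sum, mul_assoc]
  push_cast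
  rw [e3]
  simp only [e, sub_mul, Finset.sum_sub_distrib, e2]
  simp only [mul_assoc, ← Finset.mul_sum, e1]
  ring

end CodiffAlgebra

namespace FrameCalculus

set_option linter.unusedSectionVars false

variable {A : Type*} [CommRing A] [Algebra ℝ A]

section Levi

variable {ι : Type*} [Fintype ι] (F : FrameCalculus ι A)

/-- The element `1 / 2` of the ring of functions. -/
def half (A : Type*) [CommRing A] [Algebra ℝ A] : A := algebraMap ℝ A (1 / 2)

theorem two_mul_half : 2 * half A = 1 := by
  have h : (2 : A) = algebraMap ℝ A 2 := (map_ofNat (algebraMap ℝ A) 2).symm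
  rw [half, h, ← map_mul]
  norm_num

/-- The Levi-Civita connection of the metric of a frame calculus. -/
def levi : FrameCalculus ι A where
  D := F.D
  conn i j k := F.conn i j k - half A * F.tor i j k
  struc := F.struc
  tor _ _ _ := 0
  conn_skew i j k := by rw [F.conn_skew, F.tor_swap_right]; ring
  tor_eq i j k := by
    have := F.tor_eq i j k
    have h := two_mul_half (A := A)
    have e := F.tor_swap_left j i k
    linear_combination this + F.tor i j k * h - half A * e
  tor_swap_left := by simp
  tor_swap_right := by simp
  comm := F.comm
  jacobi := F.jacobi

theorem four_mul_levi_curv (i j : ι) :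
    4 * F.levi.curv i j j i = 4 * F.curv i j j i + ∑ p, F.tor i j p * F.tor i j p := by
  have h := two_mul_half (A := A)
  have z1 : ∀ i p, F.tor i i p = 0 := fun i p ↦
    two_mul_cancel (by linear_combination F.tor_swap_left i i p)
  have z2 : ∀ i p, F.tor p i i = 0 := fun i p ↦
    two_mul_cancel (by linear_combination F.tor_swap_right p i i)
  have z3 : ∀ i p, F.tor i p i = 0 := fun i p ↦ by rw [F.tor_swap_right, z1, neg_zero]
  simp only [levi, curv, z1, z3, mul_zero, sub_zero, mul_add, Finset.mul_sum]
  rw [add_assoc, ← Finset.sum_add_distrib]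
  congr 1
  refine Finset.sum_congr rfl fun p _ ↦ ?_
  rw [F.tor_swap_right j p i, F.tor_swap_left j i p, F.tor_swap_left p j i, F.tor_swap_right j p i,
    F.tor_swap_left j i p, F.struc_eq, F.conn_skew j p i]
  linear_combination (F.tor i j p * F.tor i j p) * (1 - 2 * half A) * h

theorem four_mul_levi_scal :
    4 * ∑ j, F.levi.ric j j =
      4 * (∑ j, F.ric j j) + ∑ i, ∑ j, ∑ k, F.tor i j k * F.tor i j k := by
  simp only [ric, Finset.mul_sum, four_mul_levi_curv, Finset.sum_add_distrib]
  congr 1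
  rw [Finset.sum_comm]

end Levi

variable {F : FrameCalculus (Fin 8) A}

variable (F) in
/-- The frame is adapted to `Φ` and the connection preserves `Φ`. -/
def PhiParallel : Prop := ∀ i a b c d, actFour (F.conn i) (phiCast A) a b c d = 0

theorem D_actFour_phi (d : Derivation ℝ A A) (m : Fin 8 → Fin 8 → A) (i j k l : Fin 8) :
    d (actFour m (phiCast A) i j k l) = actFour (fun a b ↦ d (m a b)) (phiCast A) i j k l := by
  have h0 : ∀ n : ℤ, d (n : A) = 0 := fun n ↦ d.map_intCast n
  simp only [actFour, phiCast, map_sum, map_add, Derivation.leibniz, smul_eq_mul, h0, mul_zero,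
    zero_add]
  exact Finset.sum_congr rfl fun p _ ↦ by ring

theorem PhiParallel.actFour_curv (h : F.PhiParallel) (i j a b c d : Fin 8) :
    actFour (F.curv i j) (phiCast A) a b c d = 0 := by
  have h1 : actFour (F.conn i) (phiCast A) = 0 := by ext; exact h ..
  have h2 : actFour (F.conn j) (phiCast A) = 0 := by ext; exact h ..
  have h3 : ∀ m : Fin 8 → Fin 8 → A, actFour m 0 = 0 := fun m ↦ by ext; simp [actFour]
  have e1 := actFour_comm (F.conn j) (F.conn i) (phiCast A) a b c d
  rw [h1, h2, h3, h3] at e1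
  have e2 := D_actFour_phi (F.D i) (F.conn j) a b c d
  have e3 := D_actFour_phi (F.D j) (F.conn i) a b c d
  rw [h2] at e2
  rw [h1] at e3
  have e4 : ∑ p, F.struc i j p * actFour (F.conn p) (phiCast A) a b c d = 0 :=
    Finset.sum_eq_zero fun p _ ↦ by rw [h]; ring
  have key : actFour (F.curv i j) (phiCast A) a b c d =
      actFour (fun a b ↦ F.D i (F.conn j a b)) (phiCast A) a b c d
        - actFour (fun a b ↦ F.D j (F.conn i a b)) (phiCast A) a b c d
        + actFour (fun a b ↦ ∑ p, (F.conn j a p * F.conn i p b - F.conn i a p * F.conn j p b))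
          (phiCast A) a b c d
        - ∑ p, F.struc i j p * actFour (F.conn p) (phiCast A) a b c d := by
    have : ∑ p, F.struc i j p * actFour (F.conn p) (phiCast A) a b c d =
        actFour (fun a b ↦ ∑ p, F.struc i j p * F.conn p a b) (phiCast A) a b c d := by
      simp only [actFour, Finset.mul_sum, Finset.sum_mul]
      rw [Finset.sum_comm]
      refine Finset.sum_congr rfl fun p _ ↦ ?_
      simp only [← Finset.sum_add_distrib]
      exact Finset.sum_congr rfl fun q _ ↦ by ring
    have hc : ∀ a b, F.curv i j a b = F.D i (F.conn j a b) - F.D j (F.conn i a b)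
        + (∑ p, (F.conn j a p * F.conn i p b - F.conn i a p * F.conn j p b))
        - ∑ p, F.struc i j p * F.conn p a b := fun a b ↦ by
      rw [curv, Finset.sum_sub_distrib]; ring
    rw [this]
    simp only [actFour, hc]
    rw [← Finset.sum_sub_distrib, ← Finset.sum_add_distrib, ← Finset.sum_sub_distrib]
    exact Finset.sum_congr rfl fun p _ ↦ by ring
  rw [key, e4, ← e1, ← e2, ← e3]
  simp

theorem PhiParallel.sum_phi_mul_curv (h : F.PhiParallel) (i j k l : Fin 8) :
    ∑ a, ∑ b, (phi k l a b : A) * F.curv i j a b = 2 * F.curv i j k l :=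
  sum_phi_mul_of_actFour_eq_zero (F.curv_swap_right i j) (h.actFour_curv i j) k l

/-- The contraction with `Φ` commutes with `∇`. -/
theorem PhiParallel.nablaOne_phiTrace (h : F.PhiParallel) (T : Fin 8 → Fin 8 → Fin 8 → A)
    (j k : Fin 8) : F.nablaOne (phiTrace T) j k =
      ∑ a, ∑ b, ∑ c, (phi k a b c : A) * F.nablaThree T j a b c := by
  have h0 : ∀ n : ℤ, F.D j (n : A) = 0 := fun n ↦ (F.D j).map_intCast n
  have s1 : ∀ a p, F.conn j a p = - F.conn j p a := F.conn_skew j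
  have t1 : ∑ p, F.conn j k p * phiTrace T p =
      - ∑ a, ∑ b, ∑ c, ∑ p, (F.conn j a p * phi k p b c + F.conn j b p * phi k a p c
        + F.conn j c p * phi k a b p) * T a b c := by
    have e : ∀ a b c, ∑ p, F.conn j k p * (phi p a b c : A) * T a b c =
        - ∑ p, (F.conn j a p * phi k p b c + F.conn j b p * phi k a p c
        + F.conn j c p * phi k a b p) * T a b c := by
      intro a b c
      have := h j k a b c
      simp only [actFour, phiCast, add_assoc] at this
      rw [Finset.sum_add_distrib] at this
      simp only [← Finset.sum_mul]
      simp only [← add_assoc] at this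
      linear_combination T a b c * this
    simp only [← Finset.sum_neg_distrib] at e ⊢
    simp only [← e]
    rw [sum_rot_four]
    simp only [phiTrace, Finset.mul_sum, mul_assoc]
  have u1 : ∑ a, ∑ b, ∑ c, ∑ p, (F.conn j a p * phi k p b c) * T a b c =
      - ∑ a, ∑ b, ∑ c, ∑ p, (phi k a b c : A) * (F.conn j a p * T p b c) := by
    simp only [← Finset.sum_neg_distrib]
    rw [Finset.sum_congr rfl fun a _ ↦ sum_rot_three _]
    conv_rhs => rw [Finset.sum_congr rfl fun a _ ↦ sum_rot_three _]
    rw [Finset.sum_comm]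
    refine Finset.sum_congr rfl fun a _ ↦ Finset.sum_congr rfl fun b _ ↦
      Finset.sum_congr rfl fun c _ ↦ Finset.sum_congr rfl fun p _ ↦ ?_
    rw [s1]; ring
  have u2 : ∑ a, ∑ b, ∑ c, ∑ p, (F.conn j b p * phi k a p c) * T a b c =
      - ∑ a, ∑ b, ∑ c, ∑ p, (phi k a b c : A) * (F.conn j b p * T a p c) := by
    simp only [← Finset.sum_neg_distrib]
    refine Finset.sum_congr rfl fun a _ ↦ ?_
    rw [Finset.sum_congr rfl fun b _ ↦ Finset.sum_comm]
    conv_rhs => rw [Finset.sum_congr rfl fun b _ ↦ Finset.sum_comm]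
    rw [Finset.sum_comm]
    refine Finset.sum_congr rfl fun b _ ↦
      Finset.sum_congr rfl fun c _ ↦ Finset.sum_congr rfl fun p _ ↦ ?_
    rw [s1]; ring
  have u3 : ∑ a, ∑ b, ∑ c, ∑ p, (F.conn j c p * phi k a b p) * T a b c =
      - ∑ a, ∑ b, ∑ c, ∑ p, (phi k a b c : A) * (F.conn j c p * T a b p) := by
    simp only [← Finset.sum_neg_distrib]
    refine Finset.sum_congr rfl fun a _ ↦ Finset.sum_congr rfl fun b _ ↦ ?_
    rw [Finset.sum_comm]
    refine Finset.sum_congr rfl fun c _ ↦ Finset.sum_congr rfl fun p _ ↦ ?_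
    rw [s1]; ring
  rw [nablaOne, t1]
  simp only [nablaThree, mul_sub, Finset.mul_sum, mul_add, add_mul, Finset.sum_add_distrib,
    Finset.sum_sub_distrib, u1, u2, u3]
  simp only [phiTrace, map_sum, Derivation.leibniz, h0, smul_eq_mul, mul_zero, add_zero]
  ring

/-- The Ricci tensor in terms of the Lee form. -/
theorem PhiParallel.six_mul_ric (h : F.PhiParallel) (hc : F.Closed) (j k : Fin 8) :
    6 * F.ric j k = - F.nablaOne (phiTrace F.tor) j k := by
  rw [h.nablaOne_phiTrace]
  simp only [← hc.curv_cycle, mul_add, Finset.sum_add_distrib]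
  have e1 : ∑ a, ∑ b, ∑ c, (phi k a b c : A) * F.curv j a b c = - 2 * F.ric j k := by
    simp only [h.sum_phi_mul_curv, ric, Finset.mul_sum]
    refine Finset.sum_congr rfl fun a _ ↦ ?_
    rw [F.curv_swap_left j a]
    ring
  have e2 : ∑ a, ∑ b, ∑ c, (phi k a b c : A) * F.curv j b c a = - 2 * F.ric j k := by
    rw [← e1, ← sum_rot_three fun a b c ↦ (phi k c a b : A) * F.curv j a b c]
    simp only [← phi_cast_cycle]
  have e3 : ∑ a, ∑ b, ∑ c, (phi k a b c : A) * F.curv j c a b = - 2 * F.ric j k := by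
    rw [← e1, sum_rot_three]
    refine Finset.sum_congr rfl fun a _ ↦ Finset.sum_congr rfl fun b _ ↦
      Finset.sum_congr rfl fun c _ ↦ ?_
    rw [← phi_cast_cycle]
  rw [e1, e2, e3]
  ring

theorem PhiParallel.three_mul_phiQuad (h : F.PhiParallel) (hc : F.Closed) :
    3 * phiQuad F.tor = - 2 * F.divOne (phiTrace F.tor) := by
  have hs : ∀ i j k l, (phi i j k l : A) = phi j k i l := fun i j k l ↦ by
    rw [phi_cast_swap_left, phi_cast_swap_mid, neg_neg]
  have hcyc : ∀ i j k, F.tor i j k = F.tor k i j := fun i j k ↦ by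
    rw [F.tor_cycle, F.tor_cycle]
  set R : A := ∑ i, ∑ j, ∑ k, ∑ l, (phi i j k l : A) * F.curv i j k l with hR
  have e1 : 3 * R = F.divOne (phiTrace F.tor) := by
    have : R = - 2 * ∑ j, F.ric j j := by
      simp only [hR, h.sum_phi_mul_curv, ric, Finset.mul_sum]
      rw [Finset.sum_comm]
      refine Finset.sum_congr rfl fun a _ ↦ Finset.sum_congr rfl fun b _ ↦ ?_
      rw [F.curv_swap_right b a b a]
      ring
    have e : - F.divOne (phiTrace F.tor) = 6 * ∑ j, F.ric j j := by
      simp only [divOne, ← Finset.sum_neg_distrib, Finset.mul_sum, h.six_mul_ric hc]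
    linear_combination 3 * this + e
  have e2 : 3 * R = ∑ i, ∑ j, ∑ k, ∑ l, (phi i j k l : A) *
      (F.curv i j k l + F.curv j k i l + F.curv k i j l) := by
    have r1 : ∑ i, ∑ j, ∑ k, ∑ l, (phi i j k l : A) * F.curv j k i l = R := by
      rw [hR, ← sum_rot_three fun i j k ↦ ∑ l, (phi k i j l : A) * F.curv i j k l]
      refine Finset.sum_congr rfl fun a _ ↦ Finset.sum_congr rfl fun b _ ↦
        Finset.sum_congr rfl fun c _ ↦ Finset.sum_congr rfl fun d _ ↦ ?_
      rw [hs c a b d]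
    have r2 : ∑ i, ∑ j, ∑ k, ∑ l, (phi i j k l : A) * F.curv k i j l = R := by
      rw [hR, sum_rot_three]
      refine Finset.sum_congr rfl fun a _ ↦ Finset.sum_congr rfl fun b _ ↦
        Finset.sum_congr rfl fun c _ ↦ Finset.sum_congr rfl fun d _ ↦ ?_
      rw [hs a b c d]
    simp only [mul_add, Finset.sum_add_distrib, r1, r2, ← hR]
    ring
  have e3 : ∑ i, ∑ j, ∑ k, ∑ l, (phi i j k l : A) * F.nablaThree F.tor l i j k =
      - F.divOne (phiTrace F.tor) := by
    simp only [divOne, h.nablaOne_phiTrace, ← Finset.sum_neg_distrib]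
    rw [sum_rot_four]
    refine Finset.sum_congr rfl fun a _ ↦ Finset.sum_congr rfl fun b _ ↦
        Finset.sum_congr rfl fun c _ ↦ Finset.sum_congr rfl fun d _ ↦ ?_
    rw [phi_cast_swap_right b c d a, phi_cast_swap_mid b c a d, phi_cast_swap_left b a c d]
    ring
  have q0 : ∑ i, ∑ j, ∑ k, ∑ l, ∑ p, (phi i j k l : A) * (F.tor i j p * F.tor k l p) =
      phiQuad F.tor := by
    rw [phiQuad, ← sum_rot_four fun i j k m ↦
      ∑ l, (phi i j k l : A) * (F.tor m i j * F.tor m k l)]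
    refine Finset.sum_congr rfl fun a _ ↦ Finset.sum_congr rfl fun b _ ↦
        Finset.sum_congr rfl fun c _ ↦ ?_
    rw [Finset.sum_comm]
    refine Finset.sum_congr rfl fun d _ ↦ Finset.sum_congr rfl fun e _ ↦ ?_
    rw [hcyc a b, hcyc c]
  have q1 : ∑ i, ∑ j, ∑ k, ∑ l, ∑ p, (phi i j k l : A) * (F.tor j k p * F.tor i l p) =
      phiQuad F.tor := by
    rw [← q0, ← sum_rot_three fun i j k ↦
      ∑ l, ∑ p, (phi k i j l : A) * (F.tor i j p * F.tor k l p)]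
    simp only [← hs]
  have q2 : ∑ i, ∑ j, ∑ k, ∑ l, ∑ p, (phi i j k l : A) * (F.tor k i p * F.tor j l p) =
      phiQuad F.tor := by
    rw [← q0, sum_rot_three]
    simp only [← hs]
  simp only [hc.bianchi, mul_sub, Finset.sum_sub_distrib, e3, sig, Finset.mul_sum, mul_add,
    Finset.sum_add_distrib, q0, q1, q2] at e2
  linear_combination e2 - e1

theorem PhiParallel.sum_phiTrace_sq (h : F.PhiParallel) (hc : F.Closed) :
    ∑ a, phiTrace F.tor a * phiTrace F.tor a =
      6 * (∑ i, ∑ j, ∑ k, F.tor i j k * F.tor i j k) + 6 * F.divOne (phiTrace F.tor) := by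
  rw [_root_.sum_phiTrace_sq F.tor_swap_left F.tor_swap_right]
  linear_combination -3 * h.three_mul_phiQuad hc

/-- `24 Scal^g = ‖τ‖² - 10 div τ`. -/
theorem PhiParallel.levi_scal (h : F.PhiParallel) (hc : F.Closed) :
    24 * ∑ j, F.levi.ric j j =
      (∑ a, phiTrace F.tor a * phiTrace F.tor a) - 10 * F.divOne (phiTrace F.tor) := by
  have e := F.four_mul_levi_scal
  have e2 : 6 * ∑ j, F.ric j j = - F.divOne (phiTrace F.tor) := by
    simp only [divOne, ← Finset.sum_neg_distrib, Finset.mul_sum, h.six_mul_ric hc]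
  rw [h.sum_phiTrace_sq hc]
  linear_combination 6 * e + 4 * e2

end FrameCalculus
end


noncomputable section

/-! ### The strong maximum principle -/

section MaximumPrinciple

variable {E : Type*} [NormedAddCommGroup E] [InnerProductSpace ℝ E]

/-- The second derivative test along a vector field. -/
theorem fderiv_fderiv_apply_nonpos_of_isLocalMax {f : E → ℝ} {X : E → E} {w : E}
    (hf : ContDiffAt ℝ 2 f w) (hX : DifferentiableAt ℝ X w) (hmax : IsLocalMax f w) :
    fderiv ℝ (fun y ↦ fderiv ℝ f y (X y)) w (X w) ≤ 0 := by
  have hf1 : ∀ᶠ y in 𝓝 w, DifferentiableAt ℝ f y := by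
    filter_upwards [hf.eventually (by simp)] with y hy
    exact hy.differentiableAt (by norm_num)
  have hf2 : DifferentiableAt ℝ (fderiv ℝ f) w :=
    (hf.fderiv_right (m := 1) (by norm_num)).differentiableAt (by norm_num)
  have h0 : fderiv ℝ f w = 0 := hmax.fderiv_eq_zero
  have e : fderiv ℝ (fun y ↦ fderiv ℝ f y (X y)) w (X w) =
      fderiv ℝ (fderiv ℝ f) w (X w) (X w) := by
    rw [fderiv_clm_apply hf2 hX]
    simp [h0]
  rw [e]
  by_contra! hpos
  set g : ℝ → ℝ := fun t ↦ f (w + t • X w) with hg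
  have hl : ∀ t : ℝ, HasDerivAt (fun t : ℝ ↦ w + t • X w) (X w) t := fun t ↦ by
    simpa using ((hasDerivAt_id t).smul_const (X w)).const_add w
  have hl0 : Filter.Tendsto (fun t : ℝ ↦ w + t • X w) (𝓝 0) (𝓝 w) := by
    have := (hl 0).continuousAt.tendsto
    simpa using this
  have hd : deriv g =ᶠ[𝓝 0] fun t ↦ fderiv ℝ f (w + t • X w) (X w) := by
    filter_upwards [hl0.eventually hf1] with t ht
    exact (ht.hasFDerivAt.comp_hasDerivAt t (hl t)).deriv
  have hdd : deriv (deriv g) 0 = fderiv ℝ (fderiv ℝ f) w (X w) (X w) := by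
    rw [hd.deriv_eq]
    have h1 : HasFDerivAt (fderiv ℝ f) (fderiv ℝ (fderiv ℝ f) w) (w + (0 : ℝ) • X w) := by
      simpa using hf2.hasFDerivAt
    have h2 : HasDerivAt (fun t : ℝ ↦ fderiv ℝ f (w + t • X w)) (fderiv ℝ (fderiv ℝ f) w (X w)) 0 :=
      h1.comp_hasDerivAt (f := fun t : ℝ ↦ w + t • X w) 0 (hl 0)
    have h3 : HasDerivAt (fun t : ℝ ↦ fderiv ℝ f (w + t • X w) (X w))
        (fderiv ℝ (fderiv ℝ f) w (X w) (X w)) 0 := by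
      simpa using h2.clm_apply (hasDerivAt_const (0 : ℝ) (X w))
    exact h3.deriv
  have hd0 : deriv g 0 = 0 := by
    rw [hd.eq_of_nhds]; simp [h0]
  have hgc : ContinuousAt g 0 := by
    have : ContinuousAt f (w + (0 : ℝ) • X w) := by simpa using hf.continuousAt
    exact this.comp (f := fun t : ℝ ↦ w + t • X w) (hl 0).continuousAt
  have hmin : IsLocalMin g 0 := isLocalMin_of_deriv_deriv_pos (by rw [hdd]; exact hpos) hd0 hgc
  have hmax' : ∀ᶠ t in 𝓝 (0 : ℝ), g t ≤ g 0 := by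
    filter_upwards [hl0.eventually hmax] with t ht
    simpa [hg] using ht
  have hconst : g =ᶠ[𝓝 0] fun _ ↦ g 0 := by
    filter_upwards [hmin, hmax'] with t h1 h2
    exact le_antisymm h2 h1
  have : deriv (deriv g) 0 = 0 := by
    have h1 : deriv g =ᶠ[𝓝 0] fun _ ↦ 0 := by
      filter_upwards [hconst.eventuallyEq_nhds] with t ht
      rw [ht.deriv_eq]; simp
    rw [h1.deriv_eq]; simp
  linarith

variable {ι : Type*} [Fintype ι]

/-- The operator `∑ X_i X_i + ∑ b_i X_i`. -/
def hopfOperator (X : ι → E → E) (b : ι → E → ℝ) (v : E → ℝ) (z : E) : ℝ :=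
  ∑ i, (fderiv ℝ (fun y ↦ fderiv ℝ v y (X i y)) z (X i z) + b i z * fderiv ℝ v z (X i z))

theorem hopfOperator_nonpos_of_isLocalMax {X : ι → E → E} {b : ι → E → ℝ} {f : E → ℝ} {w : E}
    (hf : ContDiffAt ℝ 2 f w) (hX : ∀ i, DifferentiableAt ℝ (X i) w) (hmax : IsLocalMax f w) :
    hopfOperator X b f w ≤ 0 := by
  refine Finset.sum_nonpos fun i _ ↦ ?_
  rw [hmax.fderiv_eq_zero]
  simpa using fderiv_fderiv_apply_nonpos_of_isLocalMax hf (hX i) hmax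

theorem hopfOperator_add_const_mul {X : ι → E → E} {b : ι → E → ℝ} {f g : E → ℝ} {w : E} (c : ℝ)
    (hf : ContDiffAt ℝ 2 f w) (hg : ContDiffAt ℝ 2 g w) (hX : ∀ i, DifferentiableAt ℝ (X i) w) :
    hopfOperator X b (fun z ↦ f z + c * g z) w = hopfOperator X b f w + c * hopfOperator X b g w := by
  have hd : ∀ᶠ y in 𝓝 w, fderiv ℝ (fun z ↦ f z + c * g z) y = fderiv ℝ f y + c • fderiv ℝ g y := by
    filter_upwards [hf.eventually (by simp), hg.eventually (by simp)] with y h1 h2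
    have h1' := h1.differentiableAt (by norm_num)
    have h2' := h2.differentiableAt (by norm_num)
    rw [fderiv_fun_add h1' (h2'.const_mul c), fderiv_const_mul h2' c]
  have hf2 : DifferentiableAt ℝ (fderiv ℝ f) w :=
    (hf.fderiv_right (m := 1) (by norm_num)).differentiableAt (by norm_num)
  have hg2 : DifferentiableAt ℝ (fderiv ℝ g) w :=
    (hg.fderiv_right (m := 1) (by norm_num)).differentiableAt (by norm_num)
  simp only [hopfOperator, Finset.mul_sum, ← Finset.sum_add_distrib]
  refine Finset.sum_congr rfl fun i _ ↦ ?_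
  have h1 : (fun y ↦ fderiv ℝ (fun z ↦ f z + c * g z) y (X i y)) =ᶠ[𝓝 w]
      fun y ↦ fderiv ℝ f y (X i y) + c * fderiv ℝ g y (X i y) := by
    filter_upwards [hd] with y hy
    rw [hy]; simp
  rw [h1.fderiv_eq, hd.self_of_nhds,
    fderiv_fun_add (hf2.clm_apply (hX i)) ((hg2.clm_apply (hX i)).const_mul c),
    fderiv_const_mul (hg2.clm_apply (hX i))]
  simp
  ring

/-- The barrier function of the proof of the strong maximum principle. -/
def barrier (α : ℝ) (p : E) (c : ℝ) (z : E) : ℝ := Real.exp (-(α * ‖z - p‖ ^ 2)) - c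

theorem contDiff_barrier (α : ℝ) (p : E) (c : ℝ) : ContDiff ℝ 2 (barrier α p c) := by
  unfold barrier
  have : ContDiff ℝ 2 fun z : E ↦ ‖z - p‖ ^ 2 := (contDiff_id.sub contDiff_const).norm_sq ℝ
  fun_prop

theorem fderiv_barrier_apply (α : ℝ) (p : E) (c : ℝ) (z v : E) :
    fderiv ℝ (barrier α p c) z v =
      -(2 * α) * (Real.exp (-(α * ‖z - p‖ ^ 2)) * ⟪z - p, v⟫_ℝ) := by
  have h1 : HasFDerivAt (fun z : E ↦ ‖z - p‖ ^ 2) (2 • innerSL ℝ (z - p)) z := by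
    simpa using ((hasFDerivAt_id z).sub_const p).norm_sq
  have h2 := (((h1.const_mul α).neg).exp).sub_const c
  have : fderiv ℝ (barrier α p c) z = _ := h2.fderiv
  rw [this]
  simp [inner_sub_left]
  ring

theorem hopfOperator_barrier {X : ι → E → E} {b : ι → E → ℝ} {z : E} (α : ℝ) (p : E) (c : ℝ)
    (hX : ∀ i, DifferentiableAt ℝ (X i) z) :
    hopfOperator X b (barrier α p c) z = 2 * α * Real.exp (-(α * ‖z - p‖ ^ 2)) *
      (2 * α * (∑ i, ⟪z - p, X i z⟫_ℝ ^ 2) -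
        ∑ i, (fderiv ℝ (fun y ↦ ⟪y - p, X i y⟫_ℝ) z (X i z) + b i z * ⟪z - p, X i z⟫_ℝ)) := by
  simp only [hopfOperator, Finset.mul_sum, ← Finset.sum_sub_distrib]
  refine Finset.sum_congr rfl fun i _ ↦ ?_
  simp only [fderiv_barrier_apply]
  have h1 : DifferentiableAt ℝ (fun y ↦ ⟪y - p, X i y⟫_ℝ) z :=
    (differentiableAt_id.sub_const p).inner ℝ (hX i)
  have h2 : HasFDerivAt (fun y ↦ Real.exp (-(α * ‖y - p‖ ^ 2)))
      (fderiv ℝ (barrier α p 0) z) z := by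
    have := ((contDiff_barrier α p 0).differentiable (by norm_num) z).hasFDerivAt
    exact this.congr_of_eventuallyEq (.of_forall fun y ↦ by simp [barrier])
  have h3 := (h2.mul h1.hasFDerivAt).const_mul (-(2 * α))
  have e : fderiv ℝ (fun y ↦ -(2 * α) * (Real.exp (-(α * ‖y - p‖ ^ 2)) * ⟪y - p, X i y⟫_ℝ)) z = _ :=
    h3.fderiv
  rw [e]
  simp [fderiv_barrier_apply]
  ring

variable [FiniteDimensional ℝ E]

/-- The strong maximum principle of Hopf, in a neighbourhood of a maximum. -/
theorem eventually_eq_of_hopfOperator_nonneg {V : Set E} (hV : IsOpen V) {X : ι → E → E}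
    {b : ι → E → ℝ} {v : E → ℝ} (hX : ∀ i, ContDiffOn ℝ 1 (X i) V)
    (hb : ∀ i, ContinuousOn (b i) V)
    (hspan : ∀ z ∈ V, ∀ w, (∀ i, ⟪w, X i z⟫_ℝ = 0) → w = 0) (hv : ContDiffOn ℝ 2 v V)
    (hL : ∀ z ∈ V, 0 ≤ hopfOperator X b v z) {z₀ : E} (hz₀ : z₀ ∈ V)
    (hmax : ∀ z ∈ V, v z ≤ v z₀) : ∀ᶠ z in 𝓝 z₀, v z = v z₀ := by
  have hXd : ∀ i, ∀ z ∈ V, DifferentiableAt ℝ (X i) z := fun i z hz ↦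
    ((hX i).contDiffAt (hV.mem_nhds hz)).differentiableAt (by norm_num)
  obtain ⟨r', hr', hball⟩ := Metric.isOpen_iff.1 hV z₀ hz₀
  obtain ⟨r, hr, hrr⟩ : ∃ r > 0, 4 * r = r' := ⟨r' / 4, by positivity, by ring⟩
  subst hrr
  by_contra hne
  have hne' : ∃ p₀ ∈ Metric.ball z₀ r, v p₀ ≠ v z₀ := by
    by_contra! hcon
    exact hne (Filter.mem_of_superset (Metric.ball_mem_nhds z₀ hr) hcon)
  obtain ⟨p₀, hp₀, hvp⟩ := hne'
  have hsub3 : Metric.closedBall z₀ (3 * r) ⊆ V :=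
    (Metric.closedBall_subset_ball (by linarith)).trans hball
  set K := Metric.closedBall z₀ (3 * r) ∩ v ⁻¹' {v z₀} with hK
  have hKc : IsCompact K := by
    have hc : IsClosed K :=
      (hv.continuousOn.mono hsub3).preimage_isClosed_of_isClosed Metric.isClosed_closedBall
        isClosed_singleton
    exact (isCompact_closedBall z₀ (3 * r)).of_isClosed_subset hc Set.inter_subset_left
  have hKne : K.Nonempty := ⟨z₀, Metric.mem_closedBall_self (by positivity), rfl⟩
  obtain ⟨q, hqK, hq⟩ := hKc.exists_isMinOn hKne (f := fun z ↦ dist z p₀)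
    (continuous_id.dist continuous_const).continuousOn
  set d := dist q p₀ with hd
  have hqv : v q = v z₀ := hqK.2
  have hp₀r : dist p₀ z₀ < r := hp₀
  have hdr : d < r := by
    have : d ≤ dist z₀ p₀ := hq (show z₀ ∈ K from ⟨Metric.mem_closedBall_self (by positivity), rfl⟩)
    rw [dist_comm z₀] at this
    exact this.trans_lt hp₀r
  have hdpos : 0 < d := by
    refine dist_pos.2 fun h ↦ hvp ?_
    rw [← h, hqv]
  have hlt : ∀ z, dist z p₀ < d → v z < v z₀ := by
    intro z hz
    have hz3 : z ∈ Metric.closedBall z₀ (3 * r) := by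
      have := dist_triangle z p₀ z₀
      rw [Metric.mem_closedBall]; linarith
    refine lt_of_le_of_ne (hmax z (hsub3 hz3)) fun h ↦ ?_
    have : d ≤ dist z p₀ := hq (show z ∈ K from ⟨hz3, h⟩)
    linarith
  set p : E := (1 / 2 : ℝ) • (p₀ + q) with hp
  have hpq : q - p = (1 / 2 : ℝ) • (q - p₀) := by rw [hp]; module
  have hpp : p - p₀ = (1 / 2 : ℝ) • (q - p₀) := by rw [hp]; module
  have hd' : ‖q - p₀‖ = d := by rw [hd, dist_eq_norm]
  have hR : ‖q - p‖ = d / 2 := by rw [hpq, norm_smul, hd']; norm_num; ring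
  have htouch : ∀ z, ‖z - p‖ ≤ d / 2 → z ≠ q → v z < v z₀ := by
    intro z hz hzq
    apply hlt
    rw [dist_eq_norm]
    by_contra! hge
    set y := z - p
    set a := q - p with ha
    have e1 : z - p₀ = y + a := by
      rw [show a = p - p₀ from hpq.trans hpp.symm]; simp only [y]; abel
    have e2 : z - q = y - a := by simp only [y, ha]; abel
    have hpar := parallelogram_law_with_norm ℝ y a
    rw [← e1, ← e2, hR] at hpar
    have h0 : 0 < ‖z - q‖ := norm_pos_iff.2 (sub_ne_zero.2 hzq)
    nlinarith [norm_nonneg y]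
  set ρ := d / 4 with hρ
  have hρpos : 0 < ρ := by positivity
  have hqz : dist q z₀ < 2 * r := by
    have := dist_triangle q p₀ z₀
    linarith
  have hB : Metric.closedBall q ρ ⊆ V := by
    refine fun z hz ↦ hsub3 ?_
    have := dist_triangle z q z₀
    rw [Metric.mem_closedBall] at hz ⊢
    linarith
  have hBc : IsCompact (Metric.closedBall q ρ) := isCompact_closedBall q ρ
  have hBne : (Metric.closedBall q ρ).Nonempty := ⟨q, Metric.mem_closedBall_self hρpos.le⟩
  have hfar : ∀ z ∈ Metric.closedBall q ρ, 0 < ‖z - p‖ := by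
    intro z hz
    rw [Metric.mem_closedBall, dist_eq_norm] at hz
    have := norm_sub_norm_le (q - p) (q - z)
    rw [show q - p - (q - z) = z - p by abel, hR, norm_sub_rev q z] at this
    linarith
  have hXc : ∀ i, ContinuousOn (X i) (Metric.closedBall q ρ) := fun i ↦
    (hX i).continuousOn.mono hB
  have hinc : ∀ i, ContinuousOn (fun z ↦ ⟪z - p, X i z⟫_ℝ) (Metric.closedBall q ρ) := fun i ↦
    (continuousOn_id.sub continuousOn_const).inner (𝕜 := ℝ) (hXc i)
  obtain ⟨c₀, hc₀, hlow⟩ : ∃ c₀ > 0, ∀ z ∈ Metric.closedBall q ρ,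
      c₀ ≤ ∑ i, ⟪z - p, X i z⟫_ℝ ^ 2 := by
    obtain ⟨w, hw, hwm⟩ := hBc.exists_isMinOn hBne (f := fun z ↦ ∑ i, ⟪z - p, X i z⟫_ℝ ^ 2)
      (continuousOn_finsetSum _ fun i _ ↦ (hinc i).pow 2)
    refine ⟨_, ?_, fun z hz ↦ hwm hz⟩
    refine lt_of_le_of_ne (Finset.sum_nonneg fun i _ ↦ sq_nonneg _) fun h ↦ ?_
    have h0 := (Finset.sum_eq_zero_iff_of_nonneg fun i _ ↦ sq_nonneg _).1 h.symm
    have := hspan w (hB hw) (w - p) fun i ↦ by simpa using h0 i (Finset.mem_univ i)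
    have h1 := hfar w hw
    rw [this] at h1
    simp at h1
  obtain ⟨C, hC⟩ : ∃ C, ∀ z ∈ Metric.closedBall q ρ, ∑ i, (fderiv ℝ (fun y ↦ ⟪y - p, X i y⟫_ℝ) z (X i z)
      + b i z * ⟪z - p, X i z⟫_ℝ) ≤ C := by
    have hcont : ContinuousOn (fun z ↦ ∑ i, (fderiv ℝ (fun y ↦ ⟪y - p, X i y⟫_ℝ) z (X i z)
        + b i z * ⟪z - p, X i z⟫_ℝ)) (Metric.closedBall q ρ) := by
      refine continuousOn_finsetSum _ fun i _ ↦ ContinuousOn.add ?_ (((hb i).mono hB).mul (hinc i))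
      have h1 : ContDiffOn ℝ 1 (fun y ↦ ⟪y - p, X i y⟫_ℝ) V :=
        (contDiffOn_id.sub contDiffOn_const).inner ℝ (hX i)
      exact ((h1.continuousOn_fderiv_of_isOpen hV le_rfl).mono hB).clm_apply (hXc i)
    obtain ⟨w, hw, hwm⟩ := hBc.exists_isMaxOn hBne hcont
    exact ⟨_, fun z hz ↦ hwm hz⟩
  obtain ⟨α, hα, hαC⟩ : ∃ α > 0, C < 2 * α * c₀ := by
    refine ⟨(|C| + 1) / (2 * c₀), by positivity, ?_⟩
    have : 2 * ((|C| + 1) / (2 * c₀)) * c₀ = |C| + 1 := by field_simp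
    rw [this]
    linarith [le_abs_self C]
  set h := barrier α p (Real.exp (-(α * (d / 2) ^ 2))) with hh
  have hLh : ∀ z ∈ Metric.closedBall q ρ, 0 < hopfOperator X b h z := by
    intro z hz
    rw [hopfOperator_barrier α p _ fun i ↦ hXd i z (hB hz)]
    have h1 := hC z hz
    have h2 := hlow z hz
    have h3 : 2 * α * c₀ ≤ 2 * α * ∑ i, ⟪z - p, X i z⟫_ℝ ^ 2 := by gcongr
    exact mul_pos (by positivity) (by linarith)
  have hhc : Continuous h := (contDiff_barrier ..).continuous
  have hneg : ∀ z, d / 2 < ‖z - p‖ → h z < 0 := by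
    intro z hz
    simp only [hh, barrier, sub_neg, Real.exp_lt_exp, neg_lt_neg_iff]
    have : (d / 2) ^ 2 < ‖z - p‖ ^ 2 := by gcongr
    exact mul_lt_mul_of_pos_left this hα
  have hhq : h q = 0 := by simp [hh, barrier, hR]
  obtain ⟨ε, hε, hside⟩ : ∃ ε > 0, ∀ z ∈ Metric.sphere q ρ, v z + ε * h z < v z₀ := by
    set S := Metric.sphere q ρ ∩ {z | ‖z - p‖ ≤ d / 2} with hS
    have hSc : IsCompact S := (isCompact_sphere q ρ).inter_right
      (isClosed_le (by fun_prop) continuous_const)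
    have hSV : S ⊆ V := fun z hz ↦ hB (Metric.sphere_subset_closedBall hz.1)
    have hout : ∀ ε > 0, ∀ z ∈ Metric.sphere q ρ, d / 2 < ‖z - p‖ → v z + ε * h z < v z₀ := by
      intro ε hε z hz hzp
      have h1 := hneg z hzp
      have h2 := hmax z (hB (Metric.sphere_subset_closedBall hz))
      nlinarith
    rcases S.eq_empty_or_nonempty with hE | hSne
    · refine ⟨1, one_pos, fun z hz ↦ hout 1 one_pos z hz ?_⟩
      by_contra! hcon
      have : z ∈ S := ⟨hz, hcon⟩
      rw [hE] at this
      exact this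
    obtain ⟨w, hw, hwm⟩ := hSc.exists_isMaxOn hSne (hv.continuousOn.mono hSV)
    have hwlt : v w < v z₀ := by
      refine htouch w hw.2 fun h ↦ ?_
      have := hw.1
      rw [h, Metric.mem_sphere, dist_self] at this
      linarith
    refine ⟨(v z₀ - v w) / 2, by linarith, fun z hz ↦ ?_⟩
    by_cases hzp : d / 2 < ‖z - p‖
    · exact hout _ (by linarith) z hz hzp
    · have h1 : v z ≤ v w := hwm (show z ∈ S from ⟨hz, not_lt.1 hzp⟩)
      have h2 : h z ≤ 1 := by
        have e1 : Real.exp (-(α * ‖z - p‖ ^ 2)) ≤ 1 := Real.exp_le_one_iff.2 (by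
          have : 0 ≤ α * ‖z - p‖ ^ 2 := by positivity
          linarith)
        have e2 := Real.exp_pos (-(α * (d / 2) ^ 2))
        simp only [hh, barrier]
        linarith
      nlinarith
  obtain ⟨w, hw, hwm⟩ := hBc.exists_isMaxOn hBne (f := fun z ↦ v z + ε * h z)
    ((hv.continuousOn.mono hB).add (continuousOn_const.mul hhc.continuousOn))
  have hwq : v z₀ ≤ v w + ε * h w := by
    have : v q + ε * h q ≤ v w + ε * h w := hwm (Metric.mem_closedBall_self hρpos.le)
    rwa [hhq, mul_zero, add_zero, hqv] at this
  have hwb : w ∈ Metric.ball q ρ := by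
    rcases (Metric.mem_closedBall.1 hw).lt_or_eq with h1 | h1
    · exact h1
    · exact absurd (hside w h1) (not_lt.2 hwq)
  have hwmax : IsLocalMax (fun z ↦ v z + ε * h z) w :=
    hwm.isLocalMax (Filter.mem_of_superset (Metric.isOpen_ball.mem_nhds hwb)
      Metric.ball_subset_closedBall)
  have hvw : ContDiffAt ℝ 2 v w := hv.contDiffAt (hV.mem_nhds (hB hw))
  have hhw : ContDiffAt ℝ 2 h w := (contDiff_barrier ..).contDiffAt
  have h1 := hopfOperator_nonpos_of_isLocalMax (b := b) (hvw.add (contDiffAt_const.mul hhw))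
    (fun i ↦ hXd i w (hB hw)) hwmax
  rw [hopfOperator_add_const_mul ε hvw hhw fun i ↦ hXd i w (hB hw)] at h1
  have h2 := hL w (hB hw)
  have h3 := hLh w hw
  nlinarith

end MaximumPrinciple
end


noncomputable section

/-! ### Smooth functions and vector fields on an open set -/

section Smooth

set_option linter.unusedSectionVars false

variable {E : Type*} [NormedAddCommGroup E] [NormedSpace ℝ E] [FiniteDimensional ℝ E]
  {H : Type*} [TopologicalSpace H] {I : ModelWithCorners ℝ E H}
  {M : Type*} [TopologicalSpace M] [ChartedSpace H M] [IsManifold I ∞ M]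

theorem contMDiffOn_mvfderiv_apply {F : Type*} [NormedAddCommGroup F] [NormedSpace ℝ F]
    {f : M → F} {X : Π x : M, TangentSpace I x} {U : Set M} (hU : IsOpen U)
    (hf : ContMDiffOn I 𝓘(ℝ, F) ∞ f U) (hX : ContMDiffOn I I.tangent ∞ (T% X) U) :
    ContMDiffOn I 𝓘(ℝ, F) ∞ (fun y ↦ mvfderiv I f y (X y)) U := by
  have h1 := hf.contMDiffOn_tangentMapWithin (m := ∞) (by simp) hU.uniqueMDiffOn
  have h2 := h1.comp hX (fun y hy ↦ hy)
  have h3 := ((contMDiff_snd_tangentBundle_modelSpace F 𝓘(ℝ, F) (n := ∞)).contMDiffOn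
    (s := Set.univ)).comp h2 (fun _ _ ↦ Set.mem_univ _)
  refine h3.congr fun y hy ↦ ?_
  change mvfderiv I f y (X y) = mfderivWithin I 𝓘(ℝ, F) f U y (X y)
  rw [mfderivWithin_of_isOpen hU hy]
  rfl

theorem contMDiffOn_mlieBracket {X Y : Π x : M, TangentSpace I x} {U : Set M} (hU : IsOpen U)
    (hX : ContMDiffOn I I.tangent ∞ (T% X) U) (hY : ContMDiffOn I I.tangent ∞ (T% Y) U) :
    ContMDiffOn I I.tangent ∞ (T% (mlieBracket I X Y)) U := by
  intro y hy
  have : CompleteSpace E := FiniteDimensional.complete ℝ E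
  have : IsManifold I (minSmoothness ℝ 2) M := by
    rw [minSmoothness_of_isRCLikeNormedField]; infer_instance
  have : IsManifold I (((⊤ : ℕ∞) : WithTop ℕ∞) + 1) M := by simpa using (inferInstance : IsManifold I ∞ M)
  exact (ContMDiffAt.mlieBracket_vectorField (m := ⊤) (n := ⊤) (hX.contMDiffAt (hU.mem_nhds hy))
    (hY.contMDiffAt (hU.mem_nhds hy)) (by simp)).contMDiffWithinAt

theorem mdiffAt_of_contMDiffOn {X : Π x : M, TangentSpace I x} {U : Set M} (hU : IsOpen U)
    (hX : ContMDiffOn I I.tangent ∞ (T% X) U) {x : M} (hx : x ∈ U) : MDiffAt (T% X) x :=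
  (hX.contMDiffAt (hU.mem_nhds hx)).mdifferentiableAt (by simp)

theorem mdiffAt_fun_of_contMDiffOn {F : Type*} [NormedAddCommGroup F] [NormedSpace ℝ F]
    {f : M → F} {U : Set M} (hU : IsOpen U)
    (hf : ContMDiffOn I 𝓘(ℝ, F) ∞ f U) {x : M} (hx : x ∈ U) : MDiffAt f x :=
  (hf.contMDiffAt (hU.mem_nhds hx)).mdifferentiableAt (by simp)

theorem leibniz_mlieBracket {X Y Z : Π x : M, TangentSpace I x} {U : Set M} (hU : IsOpen U)
    (hX : ContMDiffOn I I.tangent ∞ (T% X) U) (hY : ContMDiffOn I I.tangent ∞ (T% Y) U)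
    (hZ : ContMDiffOn I I.tangent ∞ (T% Z) U) {x : M} (hx : x ∈ U) :
    mlieBracket I X (mlieBracket I Y Z) x =
      mlieBracket I (mlieBracket I X Y) Z x + mlieBracket I Y (mlieBracket I X Z) x := by
  have : CompleteSpace E := FiniteDimensional.complete ℝ E
  have : IsManifold I (minSmoothness ℝ 3) M := by
    rw [minSmoothness_of_isRCLikeNormedField]; infer_instance
  have h2 : minSmoothness ℝ 2 ≤ ∞ := by
    rw [minSmoothness_of_isRCLikeNormedField]; exact ENat.LEInfty.out
  exact leibniz_identity_mlieBracket_apply ((hX.contMDiffAt (hU.mem_nhds hx)).of_le h2)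
    ((hY.contMDiffAt (hU.mem_nhds hx)).of_le h2) ((hZ.contMDiffAt (hU.mem_nhds hx)).of_le h2)

/-- The Lie bracket acts on functions as a commutator. -/
theorem mvfderiv_mlieBracket_smul {X Y Z : Π x : M, TangentSpace I x} {U : Set M} (hU : IsOpen U)
    (hX : ContMDiffOn I I.tangent ∞ (T% X) U) (hY : ContMDiffOn I I.tangent ∞ (T% Y) U)
    (hZ : ContMDiffOn I I.tangent ∞ (T% Z) U) {f : M → ℝ} (hf : ContMDiffOn I 𝓘(ℝ) ∞ f U)
    {x : M} (hx : x ∈ U) :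
    mvfderiv I f x (mlieBracket I X Y x) • Z x =
      (mvfderiv I (fun y ↦ mvfderiv I f y (Y y)) x (X x)
        - mvfderiv I (fun y ↦ mvfderiv I f y (X y)) x (Y x)) • Z x := by
  have : CompleteSpace E := FiniteDimensional.complete ℝ E
  have : IsManifold I 2 M := inferInstance
  have hfZ : ContMDiffOn I I.tangent ∞ (T% (f • Z)) U := hf.smul_section hZ
  have hYZ := contMDiffOn_mlieBracket hU hY hZ
  have hXZ := contMDiffOn_mlieBracket hU hX hZ
  have hXY := contMDiffOn_mlieBracket hU hX hY
  have hYf := contMDiffOn_mvfderiv_apply hU hf hY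
  have hXf := contMDiffOn_mvfderiv_apply hU hf hX
  have dv : ∀ {W : Π x : M, TangentSpace I x}, ContMDiffOn I I.tangent ∞ (T% W) U →
    MDiffAt (T% W) x := fun hW ↦ mdiffAt_of_contMDiffOn hU hW hx
  have df : ∀ {g : M → ℝ}, ContMDiffOn I 𝓘(ℝ) ∞ g U → MDiffAt g x := fun hg ↦
    mdiffAt_fun_of_contMDiffOn hU hg hx
  have key : ∀ {V : Π x : M, TangentSpace I x}, ContMDiffOn I I.tangent ∞ (T% V) U →
      mlieBracket I V (f • Z) =ᶠ[𝓝 x] (fun y ↦ mvfderiv I f y (V y)) • Z + f • mlieBracket I V Z := by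
    intro V hV
    filter_upwards [hU.mem_nhds hx] with y hy
    rw [mlieBracket_smul_right (mdiffAt_fun_of_contMDiffOn hU hf hy) (mdiffAt_of_contMDiffOn hU hZ hy)]
    rfl
  have h := leibniz_mlieBracket hU hX hY hfZ hx
  have e1 : ∀ {V W : Π x : M, TangentSpace I x}, ContMDiffOn I I.tangent ∞ (T% V) U →
      ContMDiffOn I I.tangent ∞ (T% W) U → mlieBracket I W (mlieBracket I V (f • Z)) x =
        mvfderiv I (fun y ↦ mvfderiv I f y (V y)) x (W x) • Z x
          + mvfderiv I f x (V x) • mlieBracket I W Z x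
          + (mvfderiv I f x (W x) • mlieBracket I V Z x
            + f x • mlieBracket I W (mlieBracket I V Z) x) := by
    intro V W hV hW
    have hVf := contMDiffOn_mvfderiv_apply hU hf hV
    have hVZ := contMDiffOn_mlieBracket hU hV hZ
    rw [Filter.EventuallyEq.mlieBracket_vectorField_eq (.refl _ W) (key hV),
      mlieBracket_add_right (dv (hVf.smul_section hZ)) (dv (hf.smul_section hVZ)),
      mlieBracket_smul_right (df hVf) (dv hZ), mlieBracket_smul_right (df hf) (dv hVZ)]
  rw [e1 hY hX, e1 hX hY, mlieBracket_smul_right (df hf) (dv hZ),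
    leibniz_mlieBracket hU hX hY hZ hx] at h
  rw [sub_smul, eq_sub_iff_add_eq]
  rw [smul_add] at h
  generalize mvfderiv I f x (mlieBracket I X Y x) • Z x = a at *
  generalize mvfderiv I (fun y ↦ mvfderiv I f y (Y y)) x (X x) • Z x = b at *
  generalize mvfderiv I (fun y ↦ mvfderiv I f y (X y)) x (Y x) • Z x = c at *
  rw [← sub_eq_zero] at h ⊢
  rw [← neg_eq_zero, ← h]
  abel

end Smooth
end


noncomputable section

section Frame

set_option linter.unusedSectionVars false

variable {E : Type*} [NormedAddCommGroup E] [NormedSpace ℝ E] [FiniteDimensional ℝ E]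
  {H : Type*} [TopologicalSpace H] {I : ModelWithCorners ℝ E H}
  {M : Type*} [TopologicalSpace M] [ChartedSpace H M] [IsManifold I ∞ M]

theorem mvfderiv_congr {F : Type*} [NormedAddCommGroup F] [NormedSpace ℝ F] {f g : M → F} {x : M}
    (h : f =ᶠ[𝓝 x] g) (v : TangentSpace I x) : mvfderiv I f x v = mvfderiv I g x v := by
  change mfderiv I 𝓘(ℝ, F) f x v = mfderiv I 𝓘(ℝ, F) g x v
  rw [h.mfderiv_eq]
  rfl

theorem mdiffAt_sum_smul {ι : Type*} (s : Finset ι) {f : ι → M → ℝ}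
    {Z : ι → Π x : M, TangentSpace I x} {x : M} (hf : ∀ p, MDiffAt (f p) x)
    (hZ : ∀ p, MDiffAt (T% (Z p)) x) : MDiffAt (T% (∑ p ∈ s, f p • Z p)) x := by
  classical
  induction s using Finset.induction_on with
  | empty => exact mdifferentiable_zeroSection ..
  | insert a s ha ih =>
    rw [Finset.sum_insert ha]
    exact mdifferentiableAt_add_section ((hf a).smul_section (hZ a)) ih

theorem mlieBracket_sum_smul {ι : Type*} (s : Finset ι) {f : ι → M → ℝ}
    {Z : ι → Π x : M, TangentSpace I x} {x : M} (X : Π x : M, TangentSpace I x)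
    (hf : ∀ p, MDiffAt (f p) x) (hZ : ∀ p, MDiffAt (T% (Z p)) x) :
    mlieBracket I X (∑ p ∈ s, f p • Z p) x =
      ∑ p ∈ s, (mvfderiv I (f p) x (X x) • Z p x + f p x • mlieBracket I X (Z p) x) := by
  classical
  have : IsManifold I 2 M := inferInstance
  have : CompleteSpace E := FiniteDimensional.complete ℝ E
  induction s using Finset.induction_on with
  | empty => simp
  | insert a s ha ih =>
    rw [Finset.sum_insert ha, Finset.sum_insert ha,
      mlieBracket_add_right ((hf a).smul_section (hZ a)) (mdiffAt_sum_smul s hf hZ), ih,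
      mlieBracket_smul_right (hf a) (hZ a)]

theorem cov_sum_smul (cov : CovariantDerivative I E (fun x : M ↦ TangentSpace I x))
    {ι : Type*} (s : Finset ι) {f : ι → M → ℝ}
    {Z : ι → Π x : M, TangentSpace I x} {x : M} (v : TangentSpace I x)
    (hf : ∀ p, MDiffAt (f p) x) (hZ : ∀ p, MDiffAt (T% (Z p)) x) :
    cov (∑ p ∈ s, f p • Z p) x v =
      ∑ p ∈ s, (mvfderiv I (f p) x v • Z p x + f p x • cov (Z p) x v) := by
  classical
  induction s using Finset.induction_on with
  | empty =>
    have := cov.zero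
    simp [this]
  | insert a s ha ih =>
    rw [Finset.sum_insert ha, Finset.sum_insert ha,
      cov.isCovariantDerivativeOnUniv.add ((hf a).smul_section (hZ a)) (mdiffAt_sum_smul s hf hZ),
      add_apply, ih, cov.isCovariantDerivativeOnUniv.leibniz (hZ a) (hf a)]
    simp [add_comm]

variable (I) in
/-- The ring of functions which are smooth on `U`. -/
def smoothRing (U : Set M) : Subalgebra ℝ (M → ℝ) where
  carrier := {f | ContMDiffOn I 𝓘(ℝ) ∞ f U}
  mul_mem' hf hg := ContMDiffOn.mul hf hg
  add_mem' hf hg := ContMDiffOn.add hf hg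
  algebraMap_mem' _ := contMDiffOn_const

variable {U : Set M}

open Classical in
/-- A function which is smooth on `U`, as an element of the ring of smooth functions. -/
def smoothRing.mk (f : M → ℝ) (hf : ContMDiffOn I 𝓘(ℝ) ∞ f U) : smoothRing I U :=
  ⟨U.indicator f, hf.congr fun _ hy ↦ Set.indicator_of_mem hy f⟩

theorem smoothRing.mk_apply {f : M → ℝ} (hf : ContMDiffOn I 𝓘(ℝ) ∞ f U) {y : M} (hy : y ∈ U) :
    (smoothRing.mk f hf : M → ℝ) y = f y := Set.indicator_of_mem hy f

theorem smoothRing.mk_apply_of_notMem {f : M → ℝ} (hf : ContMDiffOn I 𝓘(ℝ) ∞ f U) {y : M}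
    (hy : y ∉ U) : (smoothRing.mk f hf : M → ℝ) y = 0 := Set.indicator_of_notMem hy f

theorem smoothRing.mvfderiv_mk (hU : IsOpen U) {f : M → ℝ} (hf : ContMDiffOn I 𝓘(ℝ) ∞ f U) {y : M}
    (hy : y ∈ U) (v : TangentSpace I y) :
    mvfderiv I (smoothRing.mk f hf : M → ℝ) y v = mvfderiv I f y v := by
  refine mvfderiv_congr ?_ v
  filter_upwards [hU.mem_nhds hy] with z hz
  exact smoothRing.mk_apply hf hz

theorem smoothRing.mdiffAt (hU : IsOpen U) (f : smoothRing I U) {y : M} (hy : y ∈ U) :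
    MDiffAt (f : M → ℝ) y := mdiffAt_fun_of_contMDiffOn hU f.2 hy

/-- The derivation of the ring of smooth functions defined by a vector field. -/
def fieldDerivation (hU : IsOpen U) (X : Π x : M, TangentSpace I x)
    (hX : ContMDiffOn I I.tangent ∞ (T% X) U) :
    Derivation ℝ (smoothRing I U) (smoothRing I U) :=
  Derivation.mk'
    { toFun f := smoothRing.mk (fun y ↦ mvfderiv I (f : M → ℝ) y (X y))
        (contMDiffOn_mvfderiv_apply hU f.2 hX)
      map_add' f g := by
        refine Subtype.ext (funext fun y ↦ ?_)
        by_cases hy : y ∈ U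
        · simp only [Subalgebra.coe_add, Pi.add_apply, smoothRing.mk_apply _ hy]
          rw [mvfderiv_add (smoothRing.mdiffAt hU f hy) (smoothRing.mdiffAt hU g hy)]
          rfl
        · simp [smoothRing.mk_apply_of_notMem _ hy]
      map_smul' c f := by
        refine Subtype.ext (funext fun y ↦ ?_)
        by_cases hy : y ∈ U
        · simp only [Subalgebra.coe_smul, Pi.smul_apply, smoothRing.mk_apply _ hy, RingHom.id_apply]
          have e : (c • (f : M → ℝ)) = (fun _ ↦ c) * (f : M → ℝ) := rfl
          rw [e, mvfderiv_mul mdifferentiableAt_const (smoothRing.mdiffAt hU f hy), mvfderiv_const]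
          simp
        · simp [smoothRing.mk_apply_of_notMem _ hy] }
    (fun f g ↦ by
      refine Subtype.ext (funext fun y ↦ ?_)
      by_cases hy : y ∈ U
      · simp only [LinearMap.coe_mk, AddHom.coe_mk, Subalgebra.coe_mul, smul_eq_mul,
          Subalgebra.coe_add, Pi.add_apply, Pi.mul_apply, smoothRing.mk_apply _ hy]
        rw [mvfderiv_mul (smoothRing.mdiffAt hU f hy) (smoothRing.mdiffAt hU g hy)]
        simp
      · simp [smoothRing.mk_apply_of_notMem _ hy])

theorem fieldDerivation_apply (hU : IsOpen U) {X : Π x : M, TangentSpace I x}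
    (hX : ContMDiffOn I I.tangent ∞ (T% X) U) (f : smoothRing I U) {y : M} (hy : y ∈ U) :
    (fieldDerivation hU X hX f : M → ℝ) y = mvfderiv I (f : M → ℝ) y (X y) :=
  smoothRing.mk_apply (contMDiffOn_mvfderiv_apply hU f.2 hX) hy

theorem fieldDerivation_apply_of_notMem (hU : IsOpen U) {X : Π x : M, TangentSpace I x}
    (hX : ContMDiffOn I I.tangent ∞ (T% X) U) (f : smoothRing I U) {y : M} (hy : y ∉ U) :
    (fieldDerivation hU X hX f : M → ℝ) y = 0 :=
  smoothRing.mk_apply_of_notMem (contMDiffOn_mvfderiv_apply hU f.2 hX) hy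

variable [RiemannianBundle (fun x : M ↦ TangentSpace I x)]
  [IsContMDiffRiemannianBundle I ∞ E (fun x : M ↦ TangentSpace I x)]

theorem contMDiffOn_inner {X Y : Π x : M, TangentSpace I x}
    (hX : ContMDiffOn I I.tangent ∞ (T% X) U) (hY : ContMDiffOn I I.tangent ∞ (T% Y) U) :
    ContMDiffOn I 𝓘(ℝ) ∞ (fun y ↦ ⟪X y, Y y⟫_ℝ) U :=
  ContMDiffOn.inner_bundle (F := E) (E := fun x : M ↦ TangentSpace I x) (b := fun y ↦ y) hX hY

variable {ι : Type*} [Fintype ι]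

/-- A smooth orthonormal frame on an open set. -/
structure IsOrthoFrame (e : ι → Π y : M, TangentSpace I y) (U : Set M) : Prop where
  isOpen : IsOpen U
  smooth : ∀ i, ContMDiffOn I I.tangent ∞ (T% (e i)) U
  orthonormal : ∀ y ∈ U, Orthonormal ℝ (fun i ↦ e i y)
  span : ∀ y ∈ U, ⊤ ≤ Submodule.span ℝ (Set.range fun i ↦ e i y)

namespace IsOrthoFrame

variable {e : ι → Π y : M, TangentSpace I y}

theorem mono (h : IsOrthoFrame e U) {V : Set M} (hV : IsOpen V) (hVU : V ⊆ U) :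
    IsOrthoFrame e V where
  isOpen := hV
  smooth i := (h.smooth i).mono hVU
  orthonormal y hy := h.orthonormal y (hVU hy)
  span y hy := h.span y (hVU hy)

/-- The orthonormal basis of a tangent space given by a frame. -/
def basisAt (h : IsOrthoFrame e U) {y : M} (hy : y ∈ U) :
    OrthonormalBasis ι ℝ (TangentSpace I y) :=
  OrthonormalBasis.mk (h.orthonormal y hy) (h.span y hy)

theorem basisAt_apply (h : IsOrthoFrame e U) {y : M} (hy : y ∈ U) (i : ι) :
    h.basisAt hy i = e i y := by simp [basisAt]

theorem sum_inner_smul (h : IsOrthoFrame e U) {y : M} (hy : y ∈ U) (v : TangentSpace I y) :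
    ∑ i, ⟪v, e i y⟫_ℝ • e i y = v := by
  have := (h.basisAt hy).sum_repr' v
  simp only [h.basisAt_apply] at this
  conv_rhs => rw [← this]
  exact Finset.sum_congr rfl fun i _ ↦ by rw [real_inner_comm]

theorem inner_eq [DecidableEq ι] (h : IsOrthoFrame e U) {y : M} (hy : y ∈ U) (i j : ι) :
    ⟪e i y, e j y⟫_ℝ = if i = j then 1 else 0 :=
  orthonormal_iff_ite.1 (h.orthonormal y hy) i j

theorem sum_mul_inner (h : IsOrthoFrame e U) {y : M} (hy : y ∈ U) (f : ι → ℝ) (l : ι) :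
    ∑ i, f i * ⟪e i y, e l y⟫_ℝ = f l := by
  classical
  simp [h.inner_eq hy]

theorem inner_sum_smul (h : IsOrthoFrame e U) {y : M} (hy : y ∈ U) (f : ι → ℝ) (l : ι) :
    ⟪∑ i, f i • e i y, e l y⟫_ℝ = f l := by
  rw [sum_inner]
  simp only [inner_smul_left, h.sum_mul_inner hy, conj_trivial]

theorem ext (h : IsOrthoFrame e U) {y : M} (hy : y ∈ U) {v w : TangentSpace I y}
    (hvw : ∀ i, ⟪v, e i y⟫_ℝ = ⟪w, e i y⟫_ℝ) : v = w := by
  rw [← h.sum_inner_smul hy v, ← h.sum_inner_smul hy w]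
  simp only [hvw]

theorem mdiffAt (h : IsOrthoFrame e U) {y : M} (hy : y ∈ U) (i : ι) : MDiffAt (T% (e i)) y :=
  mdiffAt_of_contMDiffOn h.isOpen (h.smooth i) hy

/-- The expansion of a vector field in a frame. -/
def expand (e : ι → Π y : M, TangentSpace I y) (W : Π y : M, TangentSpace I y) :
    Π y : M, TangentSpace I y := ∑ p, (fun z ↦ ⟪W z, e p z⟫_ℝ) • e p

theorem eventually_eq_expand (h : IsOrthoFrame e U) {y : M} (hy : y ∈ U)
    (W : Π y : M, TangentSpace I y) : ∀ᶠ z in 𝓝 y, W z = expand e W z := by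
  filter_upwards [h.isOpen.mem_nhds hy] with z hz
  rw [expand, Finset.sum_apply]
  exact (h.sum_inner_smul hz (W z)).symm

theorem inner_mlieBracket (h : IsOrthoFrame e U) {y : M} (hy : y ∈ U)
    {W : Π y : M, TangentSpace I y} (hW : MDiffAt (T% W) y) (X : Π y : M, TangentSpace I y)
    (l : ι) : ⟪mlieBracket I X W y, e l y⟫_ℝ = mvfderiv I (fun z ↦ ⟪W z, e l z⟫_ℝ) y (X y)
      + ∑ p, ⟪W y, e p y⟫_ℝ * ⟪mlieBracket I X (e p) y, e l y⟫_ℝ := by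
  have e1 : mlieBracket I X W y = mlieBracket I X (expand e W) y :=
    Filter.EventuallyEq.mlieBracket_vectorField_eq (.refl _ X) (h.eventually_eq_expand hy W)
  rw [e1, expand, mlieBracket_sum_smul _ X (fun p ↦ mdiff_inner hW (h.mdiffAt hy p)) (h.mdiffAt hy),
    Finset.sum_add_distrib, inner_add_left, h.inner_sum_smul hy, sum_inner]
  simp only [inner_smul_left, conj_trivial]

theorem inner_cov (h : IsOrthoFrame e U) (cov : CovariantDerivative I E (fun x : M ↦ TangentSpace I x))
    {y : M} (hy : y ∈ U) {W : Π y : M, TangentSpace I y} (hW : MDiffAt (T% W) y)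
    (v : TangentSpace I y) (l : ι) :
    ⟪cov W y v, e l y⟫_ℝ = mvfderiv I (fun z ↦ ⟪W z, e l z⟫_ℝ) y v
      + ∑ p, ⟪W y, e p y⟫_ℝ * ⟪cov (e p) y v, e l y⟫_ℝ := by
  have e1 : cov W y = cov (expand e W) y :=
    cov.isCovariantDerivativeOnUniv.congr_of_eventuallyEq hW
      (mdiffAt_sum_smul _ (fun p ↦ mdiff_inner hW (h.mdiffAt hy p)) (h.mdiffAt hy)) Filter.univ_mem
      (h.eventually_eq_expand hy W)
  rw [e1, expand, cov_sum_smul cov _ v (fun p ↦ mdiff_inner hW (h.mdiffAt hy p)) (h.mdiffAt hy),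
    Finset.sum_add_distrib, inner_add_left, h.inner_sum_smul hy, sum_inner]
  simp only [inner_smul_left, conj_trivial]

/-- The structure functions of a frame. -/
def struc (h : IsOrthoFrame e U) (i j k : ι) : smoothRing I U :=
  smoothRing.mk (fun y ↦ ⟪mlieBracket I (e i) (e j) y, e k y⟫_ℝ)
    (contMDiffOn_inner (contMDiffOn_mlieBracket h.isOpen (h.smooth i) (h.smooth j)) (h.smooth k))

theorem struc_apply (h : IsOrthoFrame e U) (i j k : ι) {y : M} (hy : y ∈ U) :
    (h.struc i j k : M → ℝ) y = ⟪mlieBracket I (e i) (e j) y, e k y⟫_ℝ := smoothRing.mk_apply _ hy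

/-- The derivative along a vector of a frame. -/
def deriv (h : IsOrthoFrame e U) (i : ι) : Derivation ℝ (smoothRing I U) (smoothRing I U) :=
  fieldDerivation h.isOpen (e i) (h.smooth i)

theorem deriv_apply (h : IsOrthoFrame e U) (i : ι) (f : smoothRing I U) {y : M} (hy : y ∈ U) :
    (h.deriv i f : M → ℝ) y = mvfderiv I (f : M → ℝ) y (e i y) := fieldDerivation_apply _ _ _ hy

theorem deriv_mk_apply (h : IsOrthoFrame e U) (i : ι) {f : M → ℝ}
    (hf : ContMDiffOn I 𝓘(ℝ) ∞ f U) {y : M} (hy : y ∈ U) :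
    (h.deriv i (smoothRing.mk f hf) : M → ℝ) y = mvfderiv I f y (e i y) := by
  rw [h.deriv_apply i _ hy, smoothRing.mvfderiv_mk h.isOpen hf hy]

theorem deriv_comm (h : IsOrthoFrame e U) (f : smoothRing I U) (i j : ι) :
    h.deriv i (h.deriv j f) - h.deriv j (h.deriv i f) = ∑ p, h.struc i j p * h.deriv p f := by
  refine Subtype.ext (funext fun y ↦ ?_)
  by_cases hy : y ∈ U
  · have e1 : ∀ i j, (h.deriv i (h.deriv j f) : M → ℝ) y =
        mvfderiv I (fun z ↦ mvfderiv I (f : M → ℝ) z (e j z)) y (e i y) := fun i j ↦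
      h.deriv_mk_apply i (contMDiffOn_mvfderiv_apply h.isOpen f.2 (h.smooth j)) hy
    have key := congrArg (fun v ↦ ⟪v, e i y⟫_ℝ)
      (mvfderiv_mlieBracket_smul h.isOpen (h.smooth i) (h.smooth j) (h.smooth i) f.2 hy)
    have hn : ⟪e i y, e i y⟫_ℝ = 1 := by classical rw [h.inner_eq hy, if_pos rfl]
    simp only [inner_smul_left, hn, mul_one, conj_trivial] at key
    have h2 : mvfderiv I (f : M → ℝ) y (mlieBracket I (e i) (e j) y) =
        ∑ p, (h.struc i j p : M → ℝ) y * (h.deriv p f : M → ℝ) y := by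
      conv_lhs => rw [← h.sum_inner_smul hy (mlieBracket I (e i) (e j) y), map_sum]
      refine Finset.sum_congr rfl fun p _ ↦ ?_
      rw [map_smul, h.struc_apply _ _ _ hy, h.deriv_apply p f hy, smul_eq_mul]
    simp only [Subalgebra.coe_sub, Pi.sub_apply, e1, ← key, h2]
    simp
  · simp [deriv, struc, fieldDerivation_apply_of_notMem _ _ _ hy,
      smoothRing.mk_apply_of_notMem _ hy]

theorem struc_swap (h : IsOrthoFrame e U) (i j k : ι) : h.struc i j k = - h.struc j i k := by
  refine Subtype.ext (funext fun y ↦ ?_)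
  by_cases hy : y ∈ U
  · simp only [Subalgebra.coe_neg, Pi.neg_apply, h.struc_apply _ _ _ hy]
    rw [mlieBracket_swap_apply, inner_neg_left]
  · simp [struc, smoothRing.mk_apply_of_notMem _ hy]

theorem struc_jacobi (h : IsOrthoFrame e U) (i j k l : ι) :
    h.deriv i (h.struc j k l) + h.deriv j (h.struc k i l) + h.deriv k (h.struc i j l) +
    ∑ p, (h.struc j k p * h.struc i p l + h.struc k i p * h.struc j p l
      + h.struc i j p * h.struc k p l) = 0 := by
  refine Subtype.ext (funext fun y ↦ ?_)
  by_cases hy : y ∈ U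
  · have e1 : ∀ i j k, ⟪mlieBracket I (e i) (mlieBracket I (e j) (e k)) y, e l y⟫_ℝ =
        (h.deriv i (h.struc j k l) : M → ℝ) y
          + ∑ p, (h.struc j k p : M → ℝ) y * (h.struc i p l : M → ℝ) y := by
      intro i j k
      have hb := contMDiffOn_mlieBracket h.isOpen (h.smooth j) (h.smooth k)
      rw [h.inner_mlieBracket hy (mdiffAt_of_contMDiffOn h.isOpen hb hy)]
      simp only [struc]
      rw [h.deriv_mk_apply i _ hy]
      simp only [smoothRing.mk_apply _ hy]
    have key := congrArg (fun v ↦ ⟪v, e l y⟫_ℝ)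
      (leibniz_mlieBracket h.isOpen (h.smooth i) (h.smooth j) (h.smooth k) hy)
    rw [inner_add_left, mlieBracket_swap_apply (V := mlieBracket I (e i) (e j)), inner_neg_left,
      e1, e1, e1, h.struc_swap i k l, map_neg] at key
    simp only [h.struc_swap i k, Subalgebra.coe_neg, Pi.neg_apply, neg_mul,
      Finset.sum_neg_distrib] at key
    simp only [Subalgebra.coe_add, Pi.add_apply, AddSubmonoidClass.coe_finsetSum,
      Finset.sum_apply, Subalgebra.coe_mul, Pi.mul_apply, Finset.sum_add_distrib,
      Subalgebra.coe_zero, Pi.zero_apply]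
    linarith
  · simp [deriv, struc, fieldDerivation_apply_of_notMem _ _ _ hy,
      smoothRing.mk_apply_of_notMem _ hy]

/-- The components of a connection in a frame. -/
def conn (_ : IsOrthoFrame e U) (cov : CovariantDerivative I E (fun x : M ↦ TangentSpace I x))
    (i j k : ι) (y : M) : ℝ := ⟪cov (e j) y (e i y), e k y⟫_ℝ

/-- The calculus in a frame for a metric connection with skew-symmetric torsion. -/
def calculus (h : IsOrthoFrame e U) (cov : CovariantDerivative I E (fun x : M ↦ TangentSpace I x))
    (hs : ∀ i j k, ContMDiffOn I 𝓘(ℝ) ∞ (h.conn cov i j k) U)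
    (hm : ∀ y ∈ U, ∀ i j k, h.conn cov i j k y = - h.conn cov i k j y)
    (ht : ∀ y ∈ U, ∀ i j k, h.conn cov i j k y - h.conn cov j i k y - (h.struc i j k : M → ℝ) y
      = - (h.conn cov i k j y - h.conn cov k i j y - (h.struc i k j : M → ℝ) y)) :
    FrameCalculus ι (smoothRing I U) where
  D := h.deriv
  conn i j k := smoothRing.mk (h.conn cov i j k) (hs i j k)
  struc := h.struc
  tor i j k := smoothRing.mk (h.conn cov i j k) (hs i j k)
    - smoothRing.mk (h.conn cov j i k) (hs j i k) - h.struc i j k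
  conn_skew i j k := by
    refine Subtype.ext (funext fun y ↦ ?_)
    by_cases hy : y ∈ U
    · simpa [smoothRing.mk_apply _ hy] using hm y hy i j k
    · simp [smoothRing.mk_apply_of_notMem _ hy]
  tor_eq _ _ _ := rfl
  tor_swap_left i j k := by rw [h.struc_swap i j]; ring
  tor_swap_right i j k := by
    refine Subtype.ext (funext fun y ↦ ?_)
    by_cases hy : y ∈ U
    · simpa [smoothRing.mk_apply _ hy] using ht y hy i j k
    · simp [smoothRing.mk_apply_of_notMem _ hy, struc]
  comm := h.deriv_comm
  jacobi := h.struc_jacobi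

end IsOrthoFrame
end Frame
end


noncomputable section

/-! ### Sums over orthonormal bases -/

section Bases

variable {V : Type*} [NormedAddCommGroup V] [InnerProductSpace ℝ V]
  {κ κ' : Type*} [Fintype κ] [Fintype κ']

theorem OrthonormalBasis.sum_apply_apply (b : OrthonormalBasis κ ℝ V) (c : OrthonormalBasis κ' ℝ V)
    {f : V → V → ℝ} (h₁ : ∀ w, IsLinearMap ℝ fun v ↦ f v w) (h₂ : ∀ v, IsLinearMap ℝ (f v)) :
    ∑ i, f (b i) (b i) = ∑ i, f (c i) (c i) := by
  have e : ∀ i, f (b i) (b i) = ∑ p, ∑ q, ⟪c p, b i⟫_ℝ * ⟪b i, c q⟫_ℝ * f (c p) (c q) := by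
    intro i
    have h1 : ∀ w, f (b i) w = ∑ p, ⟪c p, b i⟫_ℝ * f (c p) w := fun w ↦ by
      conv_lhs => rw [← c.sum_repr' (b i)]
      exact (map_sum ((h₁ w).mk') (fun p ↦ ⟪c p, b i⟫_ℝ • c p) Finset.univ).trans
        (Finset.sum_congr rfl fun p _ ↦ (h₁ w).map_smul _ _)
    have h2 : ∀ v, f v (b i) = ∑ p, ⟪c p, b i⟫_ℝ * f v (c p) := fun v ↦ by
      conv_lhs => rw [← c.sum_repr' (b i)]
      exact (map_sum ((h₂ v).mk') (fun p ↦ ⟪c p, b i⟫_ℝ • c p) Finset.univ).trans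
        (Finset.sum_congr rfl fun p _ ↦ (h₂ v).map_smul _ _)
    rw [h1]
    refine Finset.sum_congr rfl fun p _ ↦ ?_
    rw [h2, Finset.mul_sum]
    refine Finset.sum_congr rfl fun q _ ↦ ?_
    rw [real_inner_comm (c q)]; ring
  simp only [e]
  rw [Finset.sum_comm]
  refine Finset.sum_congr rfl fun p _ ↦ ?_
  rw [Finset.sum_comm]
  classical
  simp only [← Finset.sum_mul, b.sum_inner_mul_inner, orthonormal_iff_ite.1 c.orthonormal]
  simp

theorem MultilinearMap.apply_eq_sum (b : OrthonormalBasis κ ℝ V) {k : ℕ}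
    (A : MultilinearMap ℝ (fun _ : Fin k ↦ V) ℝ) (v : Fin k → V) :
    A v = ∑ P : Fin k → κ, (∏ m, ⟪v m, b (P m)⟫_ℝ) * A (fun m ↦ b (P m)) := by
  classical
  have h : v = fun m ↦ ∑ p, ⟪v m, b p⟫_ℝ • b p := funext fun m ↦ by
    conv_lhs => rw [← b.sum_repr' (v m)]
    simp only [real_inner_comm]
  conv_lhs => rw [h]
  rw [A.map_sum]
  refine Finset.sum_congr rfl fun P _ ↦ ?_
  rw [A.map_smul_univ, smul_eq_mul]

theorem OrthonormalBasis.sum_mul_apply (b : OrthonormalBasis κ ℝ V) (c : OrthonormalBasis κ' ℝ V)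
    {k : ℕ} (A B : MultilinearMap ℝ (fun _ : Fin k ↦ V) ℝ) :
    ∑ J : Fin k → κ, A (fun m ↦ b (J m)) * B (fun m ↦ b (J m)) =
      ∑ J : Fin k → κ', A (fun m ↦ c (J m)) * B (fun m ↦ c (J m)) := by
  classical
  have e : ∀ P Q : Fin k → κ', ∑ J : Fin k → κ, (∏ m, ⟪b (J m), c (P m)⟫_ℝ) *
      (∏ m, ⟪b (J m), c (Q m)⟫_ℝ) = if P = Q then 1 else 0 := by
    intro P Q
    simp only [← Finset.prod_mul_distrib]
    have := Finset.prod_univ_sum (fun _ : Fin k ↦ (Finset.univ : Finset κ))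
      (fun m j ↦ ⟪b j, c (P m)⟫_ℝ * ⟪b j, c (Q m)⟫_ℝ)
    rw [Fintype.piFinset_univ] at this
    rw [← this]
    have h1 : ∀ m, ∑ j, ⟪b j, c (P m)⟫_ℝ * ⟪b j, c (Q m)⟫_ℝ = if P m = Q m then 1 else 0 := by
      intro m
      rw [← orthonormal_iff_ite.1 c.orthonormal, ← b.sum_inner_mul_inner]
      simp only [real_inner_comm]
    simp only [h1, Finset.prod_ite_zero, Finset.mem_univ, forall_true_left, Finset.prod_const_one,
      funext_iff]
  have h1 : ∀ J : Fin k → κ, A (fun m ↦ b (J m)) * B (fun m ↦ b (J m)) =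
      ∑ P : Fin k → κ', ∑ Q : Fin k → κ', ((∏ m, ⟪b (J m), c (P m)⟫_ℝ) *
      (∏ m, ⟪b (J m), c (Q m)⟫_ℝ)) * (A (fun m ↦ c (P m)) * B (fun m ↦ c (Q m))) := by
    intro J
    rw [A.apply_eq_sum c, B.apply_eq_sum c, Finset.sum_mul_sum]
    refine Finset.sum_congr rfl fun P _ ↦ Finset.sum_congr rfl fun Q _ ↦ by ring
  simp only [h1]
  rw [Finset.sum_comm]
  refine Finset.sum_congr rfl fun P _ ↦ ?_
  rw [Finset.sum_comm]
  simp only [← Finset.sum_mul, e]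
  simp

theorem sum_fin_succ_pi {k : ℕ} (g : (Fin (k + 1) → κ) → ℝ) :
    ∑ J, g J = ∑ i, ∑ J : Fin k → κ, g (Matrix.vecCons i J) := by
  rw [← (Fin.consEquiv fun _ ↦ κ).sum_comp, Fintype.sum_prod_type]
  rfl

theorem sum_fin_three_pi (g : (Fin 3 → κ) → ℝ) :
    ∑ J, g J = ∑ i, ∑ j, ∑ k, g ![i, j, k] := by
  simp only [sum_fin_succ_pi (k := 2), sum_fin_succ_pi (k := 1), sum_fin_succ_pi (k := 0)]
  have : (default : Fin 0 → κ) = ![] := Subsingleton.elim _ _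
  simp [this]

end Bases

/-! ### Covariant derivatives of tensor fields -/

section Tensors

set_option linter.unusedSectionVars false

variable {E : Type*} [NormedAddCommGroup E] [NormedSpace ℝ E] [FiniteDimensional ℝ E]
  {H : Type*} [TopologicalSpace H] {I : ModelWithCorners ℝ E H}
  {M : Type*} [TopologicalSpace M] [ChartedSpace H M] [IsManifold I ∞ M]

/-- The tensor field is multilinear at `x`. -/
def IsTensorAt {k : ℕ} (α : TensorField I M k) (x : M) : Prop :=
  ∃ A : MultilinearMap ℝ (fun _ : Fin k ↦ TangentSpace I x) ℝ, ∀ v, α x v = A v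

/-- The values of the tensor field on differentiable vector fields are differentiable. -/
def DiffTensorAt {k : ℕ} (α : TensorField I M k) (x : M) : Prop :=
  ∀ X : Fin k → Π y : M, TangentSpace I y, (∀ i, MDiffAt (T% (X i)) x) →
    MDiffAt (fun y ↦ α y (fun i ↦ X i y)) x

/-- The covariant derivative of a tensor field, evaluated on vector fields. -/
def covField (cov : CovariantDerivative I E (fun x : M ↦ TangentSpace I x)) {k : ℕ}
    (α : TensorField I M k) (x : M) (v : TangentSpace I x)
    (X : Fin k → Π y : M, TangentSpace I y) : ℝ :=
  mvfderiv I (fun y ↦ α y (fun i ↦ X i y)) x v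
    - ∑ i : Fin k, α x (Function.update (fun j ↦ X j x) i (cov (X i) x v))

theorem update_field_apply {k : ℕ} (X : Fin k → Π y : M, TangentSpace I y) (m : Fin k)
    (Z : Π y : M, TangentSpace I y) (y : M) :
    (fun i ↦ Function.update X m Z i y) = Function.update (fun i ↦ X i y) m (Z y) := by
  funext i
  by_cases hi : i = m
  · subst hi; simp
  · simp [hi]

variable {k : ℕ} {α : TensorField I M k} {x : M}

theorem IsTensorAt.add (hα : IsTensorAt α x) (v : Fin k → TangentSpace I x) (m : Fin k)
    (a b : TangentSpace I x) : α x (Function.update v m (a + b)) =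
      α x (Function.update v m a) + α x (Function.update v m b) := by
  obtain ⟨A, hA⟩ := hα
  simp only [hA, A.map_update_add]

theorem IsTensorAt.smul (hα : IsTensorAt α x) (v : Fin k → TangentSpace I x) (m : Fin k)
    (c : ℝ) (a : TangentSpace I x) : α x (Function.update v m (c • a)) =
      c * α x (Function.update v m a) := by
  obtain ⟨A, hA⟩ := hα
  simp only [hA, A.map_update_smul, smul_eq_mul]

theorem mdiffAt_update {X : Fin k → Π y : M, TangentSpace I y} (hX : ∀ i, MDiffAt (T% (X i)) x)
    {Z : Π y : M, TangentSpace I y} (hZ : MDiffAt (T% Z) x) (m i : Fin k) :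
    MDiffAt (T% (Function.update X m Z i)) x := by
  by_cases hi : i = m
  · subst hi; simpa using hZ
  · simpa [hi] using hX i

theorem covField_update (cov : CovariantDerivative I E (fun x : M ↦ TangentSpace I x))
    (X : Fin k → Π y : M, TangentSpace I y) (m : Fin k) (Z : Π y : M, TangentSpace I y)
    (v : TangentSpace I x) :
    covField cov α x v (Function.update X m Z) =
      mvfderiv I (fun y ↦ α y (Function.update (fun i ↦ X i y) m (Z y))) x v
        - (α x (Function.update (fun i ↦ X i x) m (cov Z x v)) +
          ∑ i ∈ Finset.univ.erase m, α x (Function.update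
            (Function.update (fun j ↦ X j x) i (cov (X i) x v)) m (Z x))) := by
  simp only [covField, update_field_apply]
  rw [← Finset.add_sum_erase _ _ (Finset.mem_univ m)]
  congr 2
  · simp
  · refine Finset.sum_congr rfl fun i hi ↦ ?_
    have hi' : i ≠ m := (Finset.mem_erase.1 hi).1
    rw [Function.update_comm hi'.symm, Function.update_of_ne hi']

theorem covField_tensorial (cov : CovariantDerivative I E (fun x : M ↦ TangentSpace I x))
    (hα : ∀ y, IsTensorAt α y) (hd : DiffTensorAt α x)
    {X : Fin k → Π y : M, TangentSpace I y} (hX : ∀ i, MDiffAt (T% (X i)) x) (m : Fin k)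
    (v : TangentSpace I x) :
    TensorialAt I E (fun Y ↦ covField cov α x v (Function.update X m Y)) x where
  smul {f Y} hf hY := by
    have hdY := hd _ (mdiffAt_update hX hY m)
    simp only [update_field_apply] at hdY
    simp only [covField_update]
    have e1 : (fun y ↦ α y (Function.update (fun i ↦ X i y) m ((f • Y) y))) =
        f * fun y ↦ α y (Function.update (fun i ↦ X i y) m (Y y)) :=
      funext fun y ↦ (hα y).smul _ m _ _
    have e2 : cov (f • Y) x v = f x • cov Y x v + mvfderiv I f x v • Y x := by
      rw [cov.isCovariantDerivativeOnUniv.leibniz hY hf]; simp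
    have e3 : (f • Y) x = f x • Y x := rfl
    rw [e1, mvfderiv_mul hf hdY, e2, e3]
    simp only [(hα x).add, (hα x).smul, ← Finset.mul_sum, add_apply, smul_apply, smul_eq_mul]
    ring
  add {Y Y'} hY hY' := by
    have hdY := hd _ (mdiffAt_update hX hY m)
    have hdY' := hd _ (mdiffAt_update hX hY' m)
    simp only [update_field_apply] at hdY hdY'
    simp only [covField_update]
    have e1 : (fun y ↦ α y (Function.update (fun i ↦ X i y) m ((Y + Y') y))) =
        (fun y ↦ α y (Function.update (fun i ↦ X i y) m (Y y))) +
        fun y ↦ α y (Function.update (fun i ↦ X i y) m (Y' y)) :=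
      funext fun y ↦ (hα y).add _ m _ _
    have e2 : cov (Y + Y') x v = cov Y x v + cov Y' x v := by
      rw [cov.isCovariantDerivativeOnUniv.add hY hY']; simp
    have e3 : (Y + Y') x = Y x + Y' x := rfl
    rw [e1, mvfderiv_add hdY hdY', e2, e3]
    simp only [(hα x).add, Finset.sum_add_distrib, add_apply]
    ring

theorem covField_congr (cov : CovariantDerivative I E (fun x : M ↦ TangentSpace I x))
    (hα : ∀ y, IsTensorAt α y) (hd : DiffTensorAt α x)
    {X X' : Fin k → Π y : M, TangentSpace I y} (hX : ∀ i, MDiffAt (T% (X i)) x)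
    (hX' : ∀ i, MDiffAt (T% (X' i)) x) (hXX' : ∀ i, X i x = X' i x) (v : TangentSpace I x) :
    covField cov α x v X = covField cov α x v X' := by
  have key : ∀ s : Finset (Fin k), covField cov α x v (s.piecewise X' X) = covField cov α x v X := by
    intro s
    induction s using Finset.induction_on with
    | empty => simp
    | insert a s ha ih =>
      have hs : ∀ i, MDiffAt (T% (s.piecewise X' X i)) x := fun i ↦ by
        by_cases hi : i ∈ s
        · simpa [hi] using hX' i
        · simpa [hi] using hX i
      have e : s.piecewise X' X = Function.update (s.piecewise X' X) a (X a) := by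
        rw [Function.eq_update_iff]
        simp [ha]
      rw [← ih, Finset.piecewise_insert]
      conv_rhs => rw [e]
      exact (covField_tensorial cov hα hd hs a v).pointwise (hX' a) (hX a) (hXX' a).symm
  have := key Finset.univ
  rw [Finset.piecewise_univ] at this
  exact this.symm

theorem covDeriv_eq_covField (cov : CovariantDerivative I E (fun x : M ↦ TangentSpace I x))
    (hα : ∀ y, IsTensorAt α y) (hd : DiffTensorAt α x) {v : Fin (k + 1) → TangentSpace I x}
    {X : Fin k → Π y : M, TangentSpace I y} (hX : ∀ i, MDiffAt (T% (X i)) x)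
    (hXv : ∀ i, X i x = v i.succ) : covDeriv cov α x v = covField cov α x (v 0) X := by
  rw [← covField_congr cov hα hd (X := fun i ↦ extend E (v i.succ))
    (fun i ↦ mdifferentiableAt_extend ..) hX (fun i ↦ by rw [extend_apply_self, hXv])]
  simp [covDeriv, covField]

theorem covDeriv_update_succ (cov : CovariantDerivative I E (fun x : M ↦ TangentSpace I x))
    (hα : ∀ y, IsTensorAt α y) (hd : DiffTensorAt α x) (v : Fin (k + 1) → TangentSpace I x)
    (m : Fin k) {Y : Π y : M, TangentSpace I y} (hY : MDiffAt (T% Y) x) :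
    covDeriv cov α x (Function.update v m.succ (Y x)) =
      covField cov α x (v 0) (Function.update (fun i ↦ extend E (v i.succ)) m Y) := by
  rw [covDeriv_eq_covField cov hα hd
    (mdiffAt_update (fun i ↦ mdifferentiableAt_extend I E (v i.succ)) hY m)]
  · rw [Function.update_of_ne (Fin.succ_ne_zero m).symm]
  · intro i
    by_cases hi : i = m
    · subst hi; simp
    · simp [hi, extend_apply_self]

/-- The covariant derivative of a differentiable tensor field is a tensor field. -/
theorem isTensorAt_covDeriv (cov : CovariantDerivative I E (fun x : M ↦ TangentSpace I x))
    (hα : ∀ y, IsTensorAt α y) (hd : DiffTensorAt α x) : IsTensorAt (covDeriv cov α) x := by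
  have h0 : ∀ (v : Fin (k + 1) → TangentSpace I x) a, covDeriv cov α x (Function.update v 0 a) =
      covField cov α x a (fun i ↦ extend E (v i.succ)) := by
    intro v a
    rw [covDeriv_eq_covField cov hα hd (fun i ↦ mdifferentiableAt_extend I E (v i.succ))]
    · simp
    · intro i; simp [extend_apply_self]
  refine ⟨{ toFun := covDeriv cov α x, map_update_add' := ?_, map_update_smul' := ?_ },
    fun _ ↦ rfl⟩
  · intro inst v m a b
    rw [Subsingleton.elim inst (instDecidableEqFin _)]
    refine Fin.cases ?_ (fun m ↦ ?_) m
    · simp only [h0, covField, map_add, (hα x).add, Finset.sum_add_distrib]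
      ring
    · have hab := mdifferentiableAt_add_section (mdifferentiableAt_extend I E a)
        (mdifferentiableAt_extend I E b)
      have e := covDeriv_update_succ cov hα hd v m hab
      rw [(covField_tensorial cov hα hd (fun i ↦ mdifferentiableAt_extend I E (v i.succ)) m
        (v 0)).add (mdifferentiableAt_extend I E a) (mdifferentiableAt_extend I E b),
        ← covDeriv_update_succ cov hα hd v m (mdifferentiableAt_extend I E a),
        ← covDeriv_update_succ cov hα hd v m (mdifferentiableAt_extend I E b)] at e
      simpa [extend_apply_self] using e
  · intro inst v m c a
    rw [Subsingleton.elim inst (instDecidableEqFin _)]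
    refine Fin.cases ?_ (fun m ↦ ?_) m
    · simp only [h0, covField, map_smul, (hα x).smul, ← Finset.mul_sum, smul_eq_mul]
      ring
    · have hc : MDiffAt (fun _ : M ↦ c) x := mdifferentiableAt_const
      have e := covDeriv_update_succ cov hα hd v m (hc.smul_section (mdifferentiableAt_extend I E a))
      rw [(covField_tensorial cov hα hd (fun i ↦ mdifferentiableAt_extend I E (v i.succ)) m
        (v 0)).smul hc (mdifferentiableAt_extend I E a),
        ← covDeriv_update_succ cov hα hd v m (mdifferentiableAt_extend I E a)] at e
      simpa [extend_apply_self] using e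

end Tensors
end


noncomputable section

theorem exists_multilinearMap_inner {V : Type*} [NormedAddCommGroup V] [InnerProductSpace ℝ V]
    (t : V →L[ℝ] V →L[ℝ] V) :
    ∃ A : MultilinearMap ℝ (fun _ : Fin 3 ↦ V) ℝ, ∀ v, ⟪t (v 0) (v 1), v 2⟫_ℝ = A v := by
  refine ⟨{ toFun v := ⟪t (v 0) (v 1), v 2⟫_ℝ, map_update_add' := ?_, map_update_smul' := ?_ },
    fun _ ↦ rfl⟩
  · intro inst v m a b
    obtain rfl : inst = instDecidableEqFin 3 := Subsingleton.elim _ _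
    fin_cases m <;> simp [Function.update, inner_add_left, inner_add_right]
  · intro inst v m c a
    obtain rfl : inst = instDecidableEqFin 3 := Subsingleton.elim _ _
    fin_cases m <;> simp [Function.update, inner_smul_left, inner_smul_right]

namespace IsOrthoFrame

set_option linter.unusedSectionVars false

variable {E : Type*} [NormedAddCommGroup E] [NormedSpace ℝ E] [FiniteDimensional ℝ E]
  {H : Type*} [TopologicalSpace H] {I : ModelWithCorners ℝ E H}
  {M : Type*} [TopologicalSpace M] [ChartedSpace H M] [IsManifold I ∞ M]
  [RiemannianBundle (fun x : M ↦ TangentSpace I x)]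
  [IsContMDiffRiemannianBundle I ∞ E (fun x : M ↦ TangentSpace I x)]
  {ι : Type*} [Fintype ι] {U : Set M} {e : ι → Π y : M, TangentSpace I y}
  {k : ℕ} {α β : TensorField I M k} {x : M}

theorem tensor_apply (h : IsOrthoFrame e U) (hx : x ∈ U) (hα : IsTensorAt α x)
    (v : Fin k → TangentSpace I x) :
    α x v = ∑ P : Fin k → ι, (∏ m, ⟪v m, e (P m) x⟫_ℝ) * α x (fun m ↦ e (P m) x) := by
  obtain ⟨A, hA⟩ := hα
  rw [hA, A.apply_eq_sum (h.basisAt hx)]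
  simp only [hA, h.basisAt_apply]

theorem _root_.mdiffAt_finset_sum {κ : Type*} (s : Finset κ) {f : κ → M → ℝ}
    (hf : ∀ i, MDiffAt (f i) x) : MDiffAt (fun y ↦ ∑ i ∈ s, f i y) x := by
  classical
  induction s using Finset.induction_on with
  | empty => simpa using mdifferentiableAt_const
  | insert a s ha ih =>
    simp only [Finset.sum_insert ha]
    exact (hf a).add ih

theorem _root_.mdiffAt_finset_prod {κ : Type*} (s : Finset κ) {f : κ → M → ℝ}
    (hf : ∀ i, MDiffAt (f i) x) : MDiffAt (fun y ↦ ∏ i ∈ s, f i y) x := by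
  classical
  induction s using Finset.induction_on with
  | empty => simpa using mdifferentiableAt_const
  | insert a s ha ih =>
    simp only [Finset.prod_insert ha]
    exact (hf a).mul ih

theorem diffTensorAt (h : IsOrthoFrame e U) (hx : x ∈ U) (hα : ∀ y ∈ U, IsTensorAt α y)
    (hd : ∀ P : Fin k → ι, MDiffAt (fun y ↦ α y (fun m ↦ e (P m) y)) x) : DiffTensorAt α x := by
  intro X hX
  have h1 : MDiffAt (fun y ↦ ∑ P : Fin k → ι, (∏ m, ⟪X m y, e (P m) y⟫_ℝ) *
      α y (fun m ↦ e (P m) y)) x :=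
    mdiffAt_finset_sum _ fun P ↦ (mdiffAt_finset_prod _ fun m ↦
      mdiff_inner (hX m) (h.mdiffAt hx (P m))).mul (hd P)
  refine h1.congr_of_eventuallyEq ?_
  filter_upwards [h.isOpen.mem_nhds hx] with y hy
  exact h.tensor_apply hy (hα y hy) _

theorem cov_eq_sum (h : IsOrthoFrame e U)
    (cov : CovariantDerivative I E (fun x : M ↦ TangentSpace I x)) (hx : x ∈ U) (i j : ι) :
    cov (e j) x (e i x) = ∑ p, h.conn cov i j p x • e p x :=
  (h.sum_inner_smul hx _).symm

/-- The components of the covariant derivative of a tensor field. -/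
theorem covDeriv_apply (h : IsOrthoFrame e U)
    (cov : CovariantDerivative I E (fun x : M ↦ TangentSpace I x)) (hx : x ∈ U)
    (hα : ∀ y, IsTensorAt α y) (hd : DiffTensorAt α x) (i : ι) (P : Fin k → ι) :
    covDeriv cov α x (Matrix.vecCons (e i x) fun m ↦ e (P m) x) =
      mvfderiv I (fun y ↦ α y (fun m ↦ e (P m) y)) x (e i x)
        - ∑ m, ∑ p, h.conn cov i (P m) p x * α x (fun m' ↦ e (Function.update P m p m') x) := by
  rw [covDeriv_eq_covField cov hα hd (X := fun m ↦ e (P m)) (fun m ↦ h.mdiffAt hx (P m))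
    (fun m ↦ by simp)]
  simp only [covField, Matrix.cons_val_zero]
  congr 1
  refine Finset.sum_congr rfl fun m _ ↦ ?_
  obtain ⟨A, hA⟩ := hα x
  rw [h.cov_eq_sum cov hx, hA, A.map_update_sum]
  refine Finset.sum_congr rfl fun p _ ↦ ?_
  rw [A.map_update_smul, hA, smul_eq_mul]
  congr 2
  funext m'
  by_cases hm : m' = m
  · subst hm; simp
  · simp [hm]

theorem codiff_apply {α : TensorField I M (k + 1)} (h : IsOrthoFrame e U) (hx : x ∈ U)
    (hα : IsTensorAt (covDeriv (leviCivita I M) α) x) (v : Fin k → TangentSpace I x) :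
    codiff α x v = - ∑ i, covDeriv (leviCivita I M) α x
      (Matrix.vecCons (e i x) (Matrix.vecCons (e i x) v)) := by
  obtain ⟨A, hA⟩ := hα
  have := (orthoBasis I x).sum_apply_apply (h.basisAt hx)
    (f := fun a b ↦ A (Matrix.vecCons a (Matrix.vecCons b v)))
    (fun w ↦ ⟨fun a b ↦ A.cons_add _ a b, fun c a ↦ A.cons_smul _ c a⟩)
    (fun w ↦ ⟨fun a b ↦ (A.curryLeft w).cons_add _ a b, fun c a ↦ (A.curryLeft w).cons_smul _ c a⟩)
  simp only [codiff, hA, this, h.basisAt_apply]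

theorem isTensorAt_codiff {α : TensorField I M (k + 1)}
    (hα : IsTensorAt (covDeriv (leviCivita I M) α) x) : IsTensorAt (codiff α) x := by
  obtain ⟨A, hA⟩ := hα
  refine ⟨- ∑ i, ((A.curryLeft (orthoBasis I x i)).curryLeft (orthoBasis I x i)), fun v ↦ ?_⟩
  simp [codiff, hA]
  rfl

theorem conn_leviCivita (h : IsOrthoFrame e U) (hx : x ∈ U) (i j k : ι) :
    h.conn (leviCivita I M) i j k x = (1 / 2 : ℝ) * ((h.struc i j k : M → ℝ) x
      - (h.struc i k j : M → ℝ) x - (h.struc j k i : M → ℝ) x) := by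
  have hc : ∀ a b (v : TangentSpace I x), mvfderiv I (fun y ↦ ⟪e a y, e b y⟫_ℝ) x v = 0 := by
    classical
    intro a b v
    rw [mvfderiv_congr (g := fun _ ↦ if a = b then (1 : ℝ) else 0), mvfderiv_const]
    · simp
    · filter_upwards [h.isOpen.mem_nhds hx] with y hy
      exact h.inner_eq hy a b
  rw [conn, inner_leviCivita (h.mdiffAt hx i) (h.mdiffAt hx j) (h.mdiffAt hx k)]
  simp only [koszul, hc, h.struc_apply _ _ _ hx]
  ring

theorem torsion_apply [CompleteSpace E] (h : IsOrthoFrame e U)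
    (cov : CovariantDerivative I E (fun x : M ↦ TangentSpace I x)) (hx : x ∈ U) (i j k : ι) :
    torsionTensor cov x ![e i x, e j x, e k x] =
      h.conn cov i j k x - h.conn cov j i k x - (h.struc i j k : M → ℝ) x := by
  simp only [torsionTensor, Matrix.cons_val_zero, Matrix.cons_val_one, Matrix.cons_val]
  rw [CovariantDerivative.torsion_apply _ (h.mdiffAt hx i) (h.mdiffAt hx j), inner_sub_left,
    inner_sub_left, h.struc_apply _ _ _ hx]
  rfl

end IsOrthoFrame

section Torsion

set_option linter.unusedSectionVars false

variable {E : Type*} [NormedAddCommGroup E] [NormedSpace ℝ E] [FiniteDimensional ℝ E]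
  {H : Type*} [TopologicalSpace H] {I : ModelWithCorners ℝ E H}
  {M : Type*} [TopologicalSpace M] [ChartedSpace H M] [IsManifold I ∞ M]
  [RiemannianBundle (fun x : M ↦ TangentSpace I x)]
  [IsContMDiffRiemannianBundle I ∞ E (fun x : M ↦ TangentSpace I x)]
  [CompleteSpace E]

theorem isTensorAt_torsionTensor (cov : CovariantDerivative I E (fun x : M ↦ TangentSpace I x))
    (x : M) : IsTensorAt (torsionTensor cov) x :=
  exists_multilinearMap_inner (cov.torsion x)

/-- The exterior derivative of a 3-form in terms of a connection. -/
theorem extDerivThree_eq (cov : CovariantDerivative I E (fun x : M ↦ TangentSpace I x))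
    {α : TensorField I M 3} {x : M} (hα : IsTensorAt α x) (hs : IsSkew α)
    (v : Fin 4 → TangentSpace I x) :
    extDerivThree α x v = covDeriv cov α x ![v 0, v 1, v 2, v 3]
      - covDeriv cov α x ![v 1, v 0, v 2, v 3] + covDeriv cov α x ![v 2, v 0, v 1, v 3]
      - covDeriv cov α x ![v 3, v 0, v 1, v 2]
      + α x ![cov.torsion x (v 0) (v 1), v 2, v 3] - α x ![cov.torsion x (v 0) (v 2), v 1, v 3]
      + α x ![cov.torsion x (v 0) (v 3), v 1, v 2] + α x ![cov.torsion x (v 1) (v 2), v 0, v 3]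
      - α x ![cov.torsion x (v 1) (v 3), v 0, v 2] + α x ![cov.torsion x (v 2) (v 3), v 0, v 1] := by
  have hb : ∀ a b, mlieBracket I (extend E (v a)) (extend E (v b)) x =
      cov (extend E (v b)) x (v a) - cov (extend E (v a)) x (v b) - cov.torsion x (v a) (v b) := by
    intro a b
    have := CovariantDerivative.torsion_apply cov (mdifferentiableAt_extend I E (v a))
      (mdifferentiableAt_extend I E (v b))
    simp only [extend_apply_self] at this
    rw [this]
    abel
  obtain ⟨A, hA⟩ := hα
  have s1 : ∀ a b c : TangentSpace I x, A ![b, a, c] = - A ![a, b, c] := by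
    intro a b c
    have := hs x ![a, b, c] (Equiv.swap 0 1)
    rw [hA, hA] at this
    have e : ![a, b, c] ∘ (Equiv.swap (0 : Fin 3) 1) = ![b, a, c] := by
      funext i; fin_cases i <;> rfl
    rw [e, Equiv.Perm.sign_swap (by decide)] at this
    simpa using this
  have s2 : ∀ a b c : TangentSpace I x, A ![a, c, b] = - A ![a, b, c] := by
    intro a b c
    have := hs x ![a, b, c] (Equiv.swap 1 2)
    rw [hA, hA] at this
    have e : ![a, b, c] ∘ (Equiv.swap (1 : Fin 3) 2) = ![a, c, b] := by
      funext i; fin_cases i <;> rfl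
    rw [e, Equiv.Perm.sign_swap (by decide)] at this
    simpa using this
  have l0 : ∀ a b c d : TangentSpace I x, A ![a - b, c, d] = A ![a, c, d] - A ![b, c, d] := by
    intro a b c d
    have := A.cons_add ![c, d] (a - b) b
    simp only [sub_add_cancel] at this
    exact eq_sub_of_add_eq this.symm
  have hc : ∀ a b c d, covDeriv cov α x ![v a, v b, v c, v d] =
      mvfderiv I (fun y ↦ α y ![extend E (v b) y, extend E (v c) y, extend E (v d) y]) x (v a)
      - (A ![cov (extend E (v b)) x (v a), v c, v d] + A ![v b, cov (extend E (v c)) x (v a), v d]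
        + A ![v b, v c, cov (extend E (v d)) x (v a)]) := by
    intro a b c d
    simp only [covDeriv, Fin.sum_univ_three, hA]
    congr 1
    · congr 2
      funext y
      congr 1
      funext i; fin_cases i <;> rfl
    · congr 1
      · congr 1
        · congr 1; funext i; fin_cases i <;> rfl
        · congr 1; funext i; fin_cases i <;> rfl
      · congr 1; funext i; fin_cases i <;> rfl
  simp only [extDerivThree, hc, hb, hA, l0]
  rw [s1 (cov (extend E (v 2)) x (v 0)) (v 1), s2 (v 1) (cov (extend E (v 3)) x (v 0)) (v 2),
    s1 (cov (extend E (v 3)) x (v 0)) (v 1)]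
  rw [s1 (cov (extend E (v 2)) x (v 1)) (v 0), s2 (v 0) (cov (extend E (v 3)) x (v 1)) (v 2),
    s1 (cov (extend E (v 3)) x (v 1)) (v 0)]
  rw [s1 (cov (extend E (v 1)) x (v 2)) (v 0), s2 (v 0) (cov (extend E (v 3)) x (v 2)) (v 1),
    s1 (cov (extend E (v 3)) x (v 2)) (v 0)]
  rw [s1 (cov (extend E (v 1)) x (v 3)) (v 0), s2 (v 0) (cov (extend E (v 2)) x (v 3)) (v 1),
    s1 (cov (extend E (v 2)) x (v 3)) (v 0)]
  ring

end Torsion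
end


noncomputable section

theorem sum_curvature_terms {ι : Type*} [Fintype ι] (u v q : ι → ℝ) (a b dq G r : ι → ι → ℝ)
    (c : ι → ι → ι → ℝ) :
    ∑ i, u i * ((∑ j, (a i j * q j + v j * dq i j)) + ∑ p, (∑ j, v j * r j p) * G i p)
      - ∑ i, v i * ((∑ j, (b i j * q j + u j * dq i j)) + ∑ p, (∑ j, u j * r j p) * G i p)
      - ∑ j, ((∑ i, u i * a i j) - (∑ i, v i * b i j) + ∑ i, ∑ k, u i * v k * c i k j) * q j =
    ∑ i, ∑ j, u i * v j * (dq i j - dq j i + ∑ p, (r j p * G i p - r i p * G j p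
      - c i j p * q p)) := by
  have e1 : ∀ (u : ι → ℝ) (a : ι → ι → ℝ),
      ∑ j, ∑ i, u i * a i j * q j = ∑ i, ∑ j, u i * (a i j * q j) := fun u a ↦ by
    rw [Finset.sum_comm]; simp only [mul_assoc]
  have e2 : ∑ i, ∑ j, v i * (u j * dq i j) = ∑ i, ∑ j, u i * v j * dq j i := by
    rw [Finset.sum_comm]
    exact Finset.sum_congr rfl fun i _ ↦ Finset.sum_congr rfl fun j _ ↦ by ring
  have e3 : ∑ i, ∑ p, ∑ j, u i * (v j * r j p * G i p) =
      ∑ i, ∑ j, ∑ p, u i * v j * (r j p * G i p) := by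
    refine Finset.sum_congr rfl fun i _ ↦ ?_
    rw [Finset.sum_comm]
    exact Finset.sum_congr rfl fun j _ ↦ Finset.sum_congr rfl fun p _ ↦ by ring
  have e4 : ∑ i, ∑ p, ∑ j, v i * (u j * r j p * G i p) =
      ∑ i, ∑ j, ∑ p, u i * v j * (r i p * G j p) := by
    rw [Finset.sum_congr rfl fun i _ ↦ Finset.sum_comm, Finset.sum_comm]
    exact Finset.sum_congr rfl fun i _ ↦ Finset.sum_congr rfl fun j _ ↦
      Finset.sum_congr rfl fun p _ ↦ by ring
  have e5 : ∑ j, ∑ i, ∑ k, u i * v k * c i k j * q j =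
      ∑ i, ∑ k, ∑ j, u i * v k * (c i k j * q j) := by
    rw [Finset.sum_comm]
    refine Finset.sum_congr rfl fun i _ ↦ ?_
    rw [Finset.sum_comm]
    simp only [mul_assoc]
  simp only [mul_add, add_mul, sub_mul, mul_sub, Finset.mul_sum, Finset.sum_mul,
    Finset.sum_add_distrib, Finset.sum_sub_distrib, e1, e2, e3, e4, e5]
  simp only [mul_assoc]
  ring

section Curvature

set_option linter.unusedSectionVars false

variable {E : Type*} [NormedAddCommGroup E] [NormedSpace ℝ E] [FiniteDimensional ℝ E]
  {H : Type*} [TopologicalSpace H] {I : ModelWithCorners ℝ E H}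
  {M : Type*} [TopologicalSpace M] [ChartedSpace H M] [IsManifold I ∞ M]
  [RiemannianBundle (fun x : M ↦ TangentSpace I x)]
  [IsContMDiffRiemannianBundle I ∞ E (fun x : M ↦ TangentSpace I x)]
  {ι : Type*} [Fintype ι] {U : Set M} {e : ι → Π y : M, TangentSpace I y} {x : M}

theorem mdiffAt_sum_mul {κ : Type*} (s : Finset κ) {f g : κ → M → ℝ}
    (hf : ∀ i, MDiffAt (f i) x) (hg : ∀ i, MDiffAt (g i) x) :
    MDiffAt (fun y ↦ ∑ i ∈ s, f i y * g i y) x :=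
  mdiffAt_finset_sum s fun i ↦ (hf i).mul (hg i)

theorem mvfderiv_sum_mul {κ : Type*} (s : Finset κ) {f g : κ → M → ℝ}
    (hf : ∀ i, MDiffAt (f i) x) (hg : ∀ i, MDiffAt (g i) x) (v : TangentSpace I x) :
    mvfderiv I (fun y ↦ ∑ i ∈ s, f i y * g i y) x v =
      ∑ i ∈ s, (mvfderiv I (f i) x v * g i x + f i x * mvfderiv I (g i) x v) := by
  classical
  induction s using Finset.induction_on with
  | empty => simp [mvfderiv_const]
  | insert a s ha ih =>
    simp only [Finset.sum_insert ha]
    have h1 : (fun y ↦ f a y * g a y + ∑ i ∈ s, f i y * g i y) =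
      f a * g a + fun y ↦ ∑ i ∈ s, f i y * g i y := rfl
    rw [h1, mvfderiv_add ((hf a).mul (hg a)) (mdiffAt_sum_mul s hf hg),
      mvfderiv_mul (hf a) (hg a), add_apply, ih]
    simp
    ring

namespace IsOrthoFrame

/-- The derivative of the components of a vector field. -/
theorem inner_cov_eq_sum (h : IsOrthoFrame e U)
    (cov : CovariantDerivative I E (fun x : M ↦ TangentSpace I x)) (hx : x ∈ U)
    {W : Π y : M, TangentSpace I y} (hW : MDiffAt (T% W) x) (v : TangentSpace I x) (l : ι) :
    ⟪cov W x v, e l x⟫_ℝ = ∑ j, ⟪v, e j x⟫_ℝ * (mvfderiv I (fun z ↦ ⟪W z, e l z⟫_ℝ) x (e j x)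
      + ∑ p, ⟪W x, e p x⟫_ℝ * h.conn cov j p l x) := by
  have e1 : ∀ (L : TangentSpace I x →L[ℝ] ℝ), L v = ∑ j, ⟪v, e j x⟫_ℝ * L (e j x) := fun L ↦ by
    conv_lhs => rw [← h.sum_inner_smul hx v, map_sum]
    simp
  have e2 : ∀ p, ⟪cov (e p) x v, e l x⟫_ℝ = ∑ j, ⟪v, e j x⟫_ℝ * h.conn cov j p l x := fun p ↦ by
    conv_lhs => rw [← h.sum_inner_smul hx v, map_sum, sum_inner]
    simp [inner_smul_left, conn]
  rw [h.inner_cov cov hx hW, e1]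
  simp only [e2, mul_add, Finset.sum_add_distrib, Finset.mul_sum]
  congr 1
  rw [Finset.sum_comm]
  exact Finset.sum_congr rfl fun j _ ↦ Finset.sum_congr rfl fun p _ ↦ by ring

theorem inner_mlieBracket_eq_sum (h : IsOrthoFrame e U) (hx : x ∈ U)
    {X W : Π y : M, TangentSpace I y} (hX : MDiffAt (T% X) x) (hW : MDiffAt (T% W) x) (l : ι) :
    ⟪mlieBracket I X W x, e l x⟫_ℝ =
      (∑ i, ⟪X x, e i x⟫_ℝ * mvfderiv I (fun z ↦ ⟪W z, e l z⟫_ℝ) x (e i x))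
      - (∑ i, ⟪W x, e i x⟫_ℝ * mvfderiv I (fun z ↦ ⟪X z, e l z⟫_ℝ) x (e i x))
      + ∑ i, ∑ j, ⟪X x, e i x⟫_ℝ * ⟪W x, e j x⟫_ℝ * (h.struc i j l : M → ℝ) x := by
  have e1 : ∀ (L : TangentSpace I x →L[ℝ] ℝ), L (X x) = ∑ j, ⟪X x, e j x⟫_ℝ * L (e j x) :=
    fun L ↦ by
      conv_lhs => rw [← h.sum_inner_smul hx (X x), map_sum]
      simp
  have e2 : ∀ p, ⟪mlieBracket I X (e p) x, e l x⟫_ℝ =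
      - mvfderiv I (fun z ↦ ⟪X z, e l z⟫_ℝ) x (e p x)
        + ∑ i, ⟪X x, e i x⟫_ℝ * (h.struc i p l : M → ℝ) x := fun p ↦ by
    rw [mlieBracket_swap_apply, inner_neg_left, h.inner_mlieBracket hx hX]
    simp only [h.struc_apply _ _ _ hx]
    rw [neg_add, ← Finset.sum_neg_distrib]
    congr 1
    refine Finset.sum_congr rfl fun i _ ↦ ?_
    rw [mlieBracket_swap_apply (V := e i), inner_neg_left]
    ring
  rw [h.inner_mlieBracket hx hW, e1]
  simp only [e2, mul_add, Finset.sum_add_distrib, mul_neg, Finset.sum_neg_distrib, Finset.mul_sum]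
  rw [Finset.sum_comm (f := fun i j ↦ ⟪X x, e i x⟫_ℝ * ⟪W x, e j x⟫_ℝ * (h.struc i j l : M → ℝ) x)]
  have : ∀ i j, ⟪W x, e i x⟫_ℝ * (⟪X x, e j x⟫_ℝ * (h.struc j i l : M → ℝ) x) =
    ⟪X x, e j x⟫_ℝ * ⟪W x, e i x⟫_ℝ * (h.struc j i l : M → ℝ) x := fun i j ↦ by ring
  simp only [this]
  ring

/-- The components of the curvature of a connection. -/
def curv (h : IsOrthoFrame e U) (cov : CovariantDerivative I E (fun x : M ↦ TangentSpace I x))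
    (x : M) (i j k l : ι) : ℝ :=
  mvfderiv I (h.conn cov j k l) x (e i x) - mvfderiv I (h.conn cov i k l) x (e j x)
    + ∑ p, (h.conn cov j k p x * h.conn cov i p l x - h.conn cov i k p x * h.conn cov j p l x
      - (h.struc i j p : M → ℝ) x * h.conn cov p k l x)

theorem inner_curvature (h : IsOrthoFrame e U)
    (cov : CovariantDerivative I E (fun x : M ↦ TangentSpace I x)) (hx : x ∈ U)
    (hs : ∀ i j k, ContMDiffOn I 𝓘(ℝ) ∞ (h.conn cov i j k) U) (u v w : TangentSpace I x) (l : ι) :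
    ⟪curvature cov x u v w, e l x⟫_ℝ =
      ∑ i, ∑ j, ∑ k, ⟪u, e i x⟫_ℝ * ⟪v, e j x⟫_ℝ * ⟪w, e k x⟫_ℝ * h.curv cov x i j k l := by
  obtain ⟨s, hs0, hsW⟩ := exists_contMDiffOn_extend (k := ∞) I E w
  obtain ⟨V, hVs, hVo, hxV⟩ := mem_nhds_iff.1 (Filter.inter_mem hs0 (h.isOpen.mem_nhds hx))
  have hVU : V ⊆ U := fun y hy ↦ (hVs hy).2
  have hW : ContMDiffOn I I.tangent ∞ (T% (extend E w : Π y : M, TangentSpace I y)) V :=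
    hsW.mono fun y hy ↦ (hVs hy).1
  set W : Π y : M, TangentSpace I y := extend E w with hWd
  have hWx : W x = w := extend_apply_self ..
  have hec : ∀ i, ContMDiffOn I I.tangent ∞ (T% (e i)) V := fun i ↦ (h.smooth i).mono hVU
  have hWc : ∀ l, ContMDiffOn I 𝓘(ℝ) ∞ (fun z ↦ ⟪W z, e l z⟫_ℝ) V := fun l ↦
    contMDiffOn_inner hW (hec l)
  have hGd : ∀ i j k, MDiffAt (h.conn cov i j k) x := fun i j k ↦
    mdiffAt_fun_of_contMDiffOn h.isOpen (hs i j k) hx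
  have hWdiff : ∀ l, MDiffAt (fun z ↦ ⟪W z, e l z⟫_ℝ) x := fun l ↦
    mdiffAt_fun_of_contMDiffOn hVo (hWc l) hxV
  set DW : ι → ι → M → ℝ := fun j l y ↦ mvfderiv I (fun z ↦ ⟪W z, e l z⟫_ℝ) y (e j y) with hDW
  have hDWd : ∀ j l, MDiffAt (DW j l) x := fun j l ↦
    mdiffAt_fun_of_contMDiffOn hVo (contMDiffOn_mvfderiv_apply hVo (hWc l) (hec j)) hxV
  set Q : ι → ι → M → ℝ := fun j l y ↦ DW j l y + ∑ k, ⟪W y, e k y⟫_ℝ * h.conn cov j k l y with hQ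
  have hQd : ∀ j l, MDiffAt (Q j l) x := fun j l ↦
    (hDWd j l).add (mdiffAt_finset_sum _ fun k ↦ (hWdiff k).mul (hGd j k l))
  have hcovW : ∀ y ∈ V, ∀ (a : TangentSpace I y) l, ⟪cov W y a, e l y⟫_ℝ =
      ∑ j, ⟪a, e j y⟫_ℝ * Q j l y := fun y hy a l ↦
    h.inner_cov_eq_sum cov (hVU hy) (mdiffAt_of_contMDiffOn hVo hW hy) a l
  have hDQ : ∀ i j l, mvfderiv I (Q j l) x (e i x) = mvfderiv I (DW j l) x (e i x)
      + ∑ k, (DW i k x * h.conn cov j k l x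
        + ⟪w, e k x⟫_ℝ * mvfderiv I (h.conn cov j k l) x (e i x)) := by
    intro i j l
    have h1 : Q j l = DW j l + fun y ↦ ∑ k, ⟪W y, e k y⟫_ℝ * h.conn cov j k l y := rfl
    rw [h1, mvfderiv_add (hDWd j l) (mdiffAt_sum_mul _ hWdiff fun k ↦ hGd j k l),
      add_apply, mvfderiv_sum_mul _ hWdiff (fun k ↦ hGd j k l), hWx]
  have hcomm : ∀ i j l, mvfderiv I (DW j l) x (e i x) - mvfderiv I (DW i l) x (e j x) =
      ∑ p, (h.struc i j p : M → ℝ) x * DW p l x := by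
    intro i j l
    have key := congrArg (fun v ↦ ⟪v, e i x⟫_ℝ)
      (mvfderiv_mlieBracket_smul hVo (hec i) (hec j) (hec i) (hWc l) hxV)
    have hn : ⟪e i x, e i x⟫_ℝ = 1 := by classical rw [h.inner_eq hx, if_pos rfl]
    simp only [inner_smul_left, hn, mul_one, conj_trivial] at key
    rw [← key]
    conv_lhs => rw [← h.sum_inner_smul hx (mlieBracket I (e i) (e j) x), map_sum]
    refine Finset.sum_congr rfl fun p _ ↦ ?_
    rw [map_smul, h.struc_apply _ _ _ hx, smul_eq_mul]
  -- the second covariant derivative along an extended vector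
  have hsec : ∀ a b : TangentSpace I x, ∀ l,
      ⟪cov (fun y ↦ cov W y ((extend E b : Π y : M, TangentSpace I y) y)) x a, e l x⟫_ℝ =
        ∑ i, ⟪a, e i x⟫_ℝ * ((∑ j, (mvfderiv I (fun z ↦
            ⟪(extend E b : Π y : M, TangentSpace I y) z, e j z⟫_ℝ) x (e i x) * Q j l x
            + ⟪b, e j x⟫_ℝ * mvfderiv I (Q j l) x (e i x)))
          + ∑ p, (∑ j, ⟪b, e j x⟫_ℝ * Q j p x) * h.conn cov i p l x) := by
    intro a b l
    set B : Π y : M, TangentSpace I y := extend E b with hBd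
    have hBx : B x = b := extend_apply_self ..
    have hB : MDiffAt (T% B) x := mdifferentiableAt_extend ..
    have hBdiff : ∀ l, MDiffAt (fun z ↦ ⟪B z, e l z⟫_ℝ) x := fun l ↦ mdiff_inner hB (h.mdiffAt hx l)
    have hev : ∀ l, (fun y ↦ ⟪cov W y (B y), e l y⟫_ℝ) =ᶠ[𝓝 x]
        fun y ↦ ∑ j, ⟪B y, e j y⟫_ℝ * Q j l y := fun l ↦ by
      filter_upwards [hVo.mem_nhds hxV] with y hy
      exact hcovW y hy (B y) l
    have hd : ∀ l, MDiffAt (fun y ↦ ∑ j, ⟪B y, e j y⟫_ℝ * Q j l y) x := fun l ↦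
      mdiffAt_finset_sum _ fun j ↦ (hBdiff j).mul (hQd j l)
    have hX : MDiffAt (T% (fun y ↦ cov W y (B y))) x := by
      have h1 : MDiffAt (T% (expand e fun y ↦ cov W y (B y))) x :=
        mdiffAt_sum_smul _ (fun p ↦ (hd p).congr_of_eventuallyEq (hev p)) (h.mdiffAt hx)
      refine h1.congr_of_eventuallyEq ?_
      filter_upwards [h.eventually_eq_expand hx fun y ↦ cov W y (B y)] with y hy
      rw [hy]
    rw [h.inner_cov_eq_sum cov hx hX]
    refine Finset.sum_congr rfl fun i _ ↦ ?_
    rw [mvfderiv_congr (hev l), mvfderiv_sum_mul _ hBdiff (fun j ↦ hQd j l)]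
    simp only [hcovW x hxV, hBx]
  simp only [curvature]
  rw [inner_sub_left, inner_sub_left, hsec, hsec, hcovW x hxV]
  simp only [h.inner_mlieBracket_eq_sum hx (mdifferentiableAt_extend I E u)
    (mdifferentiableAt_extend I E v), extend_apply_self]
  have hbr : ∀ i j, mvfderiv I (Q j l) x (e i x) - mvfderiv I (Q i l) x (e j x)
      + ∑ p, (Q j p x * h.conn cov i p l x - Q i p x * h.conn cov j p l x
        - (h.struc i j p : M → ℝ) x * Q p l x) = ∑ k, ⟪w, e k x⟫_ℝ * h.curv cov x i j k l := by
    intro i j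
    have c1 : ∀ i j, ∑ p, Q j p x * h.conn cov i p l x = (∑ p, DW j p x * h.conn cov i p l x)
        + ∑ k, ∑ p, ⟪w, e k x⟫_ℝ * (h.conn cov j k p x * h.conn cov i p l x) := by
      intro i j
      rw [Finset.sum_comm, ← Finset.sum_add_distrib]
      refine Finset.sum_congr rfl fun p _ ↦ ?_
      simp only [hQ, hWx, add_mul, Finset.sum_mul]
      congr 1
      exact Finset.sum_congr rfl fun k _ ↦ by ring
    have c2 : ∑ p, (h.struc i j p : M → ℝ) x * Q p l x = (∑ p, (h.struc i j p : M → ℝ) x * DW p l x)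
        + ∑ k, ∑ p, ⟪w, e k x⟫_ℝ * ((h.struc i j p : M → ℝ) x * h.conn cov p k l x) := by
      rw [Finset.sum_comm, ← Finset.sum_add_distrib]
      refine Finset.sum_congr rfl fun p _ ↦ ?_
      simp only [hQ, hWx, mul_add, Finset.mul_sum]
      congr 1
      exact Finset.sum_congr rfl fun k _ ↦ by ring
    simp only [hDQ, curv, Finset.sum_sub_distrib, c1, c2, mul_add, mul_sub, Finset.sum_add_distrib,
      Finset.mul_sum, ← hcomm]
    ring
  have hR : ∀ i j, ∑ k, ⟪u, e i x⟫_ℝ * ⟪v, e j x⟫_ℝ * ⟪w, e k x⟫_ℝ * h.curv cov x i j k l =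
      ⟪u, e i x⟫_ℝ * ⟪v, e j x⟫_ℝ * (mvfderiv I (Q j l) x (e i x) - mvfderiv I (Q i l) x (e j x)
      + ∑ p, (Q j p x * h.conn cov i p l x - Q i p x * h.conn cov j p l x
        - (h.struc i j p : M → ℝ) x * Q p l x)) := by
    intro i j
    rw [hbr, Finset.mul_sum]
    exact Finset.sum_congr rfl fun k _ ↦ by ring
  simp only [hR]
  exact sum_curvature_terms _ _ (fun j ↦ Q j l x) _ _ (fun i j ↦ mvfderiv I (Q j l) x (e i x))
    (fun i p ↦ h.conn cov i p l x) (fun j p ↦ Q j p x) fun i j p ↦ (h.struc i j p : M → ℝ) x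

end IsOrthoFrame
end Curvature
end


noncomputable section

namespace FrameCalculus

variable {ι A : Type*} [Fintype ι] [CommRing A] [Algebra ℝ A] (F : FrameCalculus ι A)

theorem levi_divOne (θ : ι → A) : F.levi.divOne θ = F.divOne θ := by
  refine Finset.sum_congr rfl fun i _ ↦ ?_
  simp [nablaOne, levi, F.tor_self_left]

theorem sum_levi_nablaThree_tor (j k : ι) :
    ∑ i, F.levi.nablaThree F.tor i i j k = F.divTor j k := by
  refine Finset.sum_congr rfl fun i _ ↦ ?_
  simp only [nablaThree, levi, F.tor_self_left, sub_right_inj]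
  refine Finset.sum_congr rfl fun p _ ↦ ?_
  rw [F.tor_swap_right i p k]
  ring

end FrameCalculus

section FrameEvaluation

set_option linter.unusedSectionVars false

variable {E : Type*} [NormedAddCommGroup E] [NormedSpace ℝ E] [FiniteDimensional ℝ E]
  {H : Type*} [TopologicalSpace H] {I : ModelWithCorners ℝ E H}
  {M : Type*} [TopologicalSpace M] [ChartedSpace H M] [IsManifold I ∞ M]
  {U : Set M}

/-- The value at `x` of a smooth function. -/
def smoothRing.eval (x : M) : smoothRing I U →ₐ[ℝ] ℝ :=
  (Pi.evalAlgHom ℝ (fun _ ↦ ℝ) x).comp (smoothRing I U).val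

theorem smoothRing.eval_eq (x : M) (f : smoothRing I U) : smoothRing.eval x f = (f : M → ℝ) x := rfl

theorem smoothRing.eval_mk {f : M → ℝ} (hf : ContMDiffOn I 𝓘(ℝ) ∞ f U) {x : M} (hx : x ∈ U) :
    smoothRing.eval x (smoothRing.mk f hf) = f x := smoothRing.mk_apply hf hx

variable [RiemannianBundle (fun x : M ↦ TangentSpace I x)]
  [IsContMDiffRiemannianBundle I ∞ E (fun x : M ↦ TangentSpace I x)]
  {ι : Type*} [Fintype ι] {e : ι → Π y : M, TangentSpace I y} {x : M}
  {cov : CovariantDerivative I E (fun x : M ↦ TangentSpace I x)}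
  {F : FrameCalculus ι (smoothRing I U)}

/-- The frame calculus `F` is that of the connection `cov` in an orthonormal frame. -/
structure IsOrthoFrame.Represents (h : IsOrthoFrame e U)
    (cov : CovariantDerivative I E (fun x : M ↦ TangentSpace I x))
    (F : FrameCalculus ι (smoothRing I U)) : Prop where
  D : F.D = h.deriv
  struc : F.struc = h.struc
  conn : ∀ y ∈ U, ∀ i j k, smoothRing.eval y (F.conn i j k) = h.conn cov i j k y

namespace IsOrthoFrame

theorem eval_deriv (h : IsOrthoFrame e U) (hx : x ∈ U) (i : ι) (f : smoothRing I U) :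
    smoothRing.eval x (h.deriv i f) = mvfderiv I (f : M → ℝ) x (e i x) := h.deriv_apply i f hx

theorem calculus_represents (h : IsOrthoFrame e U)
    (hs : ∀ i j k, ContMDiffOn I 𝓘(ℝ) ∞ (h.conn cov i j k) U)
    (hm : ∀ y ∈ U, ∀ i j k, h.conn cov i j k y = - h.conn cov i k j y)
    (ht : ∀ y ∈ U, ∀ i j k, h.conn cov i j k y - h.conn cov j i k y - (h.struc i j k : M → ℝ) y
      = - (h.conn cov i k j y - h.conn cov k i j y - (h.struc i k j : M → ℝ) y)) :
    h.Represents cov (h.calculus cov hs hm ht) where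
  D := rfl
  struc := rfl
  conn _ hy i j k := smoothRing.eval_mk (hs i j k) hy

namespace Represents

variable {h : IsOrthoFrame e U}

theorem contMDiffOn_conn (hF : h.Represents cov F) (i j k : ι) :
    ContMDiffOn I 𝓘(ℝ) ∞ (h.conn cov i j k) U :=
  ContMDiffOn.congr (F.conn i j k).2 fun y hy ↦ (hF.conn y hy i j k).symm

theorem eval_D (hF : h.Represents cov F) (hx : x ∈ U) (i : ι) (f : smoothRing I U) :
    smoothRing.eval x (F.D i f) = mvfderiv I (f : M → ℝ) x (e i x) := by
  rw [hF.D, h.eval_deriv hx]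

theorem eval_D_of_eqOn (hF : h.Represents cov F) (hx : x ∈ U) (i : ι) {f : smoothRing I U}
    {g : M → ℝ} (hfg : ∀ y ∈ U, smoothRing.eval y f = g y) :
    smoothRing.eval x (F.D i f) = mvfderiv I g x (e i x) := by
  rw [hF.eval_D hx]
  refine mvfderiv_congr ?_ _
  filter_upwards [h.isOpen.mem_nhds hx] with y hy
  exact hfg y hy

theorem eval_curv (hF : h.Represents cov F) (hx : x ∈ U) (i j k l : ι) :
    smoothRing.eval x (F.curv i j k l) = h.curv cov x i j k l := by
  simp only [FrameCalculus.curv, map_add, map_sub, map_sum, map_mul, IsOrthoFrame.curv,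
    hF.conn x hx, hF.struc, smoothRing.eval_eq x (h.struc _ _ _)]
  rw [hF.eval_D_of_eqOn hx i fun y hy ↦ hF.conn y hy j k l,
    hF.eval_D_of_eqOn hx j fun y hy ↦ hF.conn y hy i k l]

theorem inner_curvature_eq (hF : h.Represents cov F) (hx : x ∈ U)
    (u v w a : TangentSpace I x) :
    ⟪curvature cov x u v w, a⟫_ℝ = ∑ l, ∑ i, ∑ j, ∑ k, ⟪a, e l x⟫_ℝ * (⟪u, e i x⟫_ℝ * ⟪v, e j x⟫_ℝ *
      ⟪w, e k x⟫_ℝ * smoothRing.eval x (F.curv i j k l)) := by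
  conv_lhs => rw [← h.sum_inner_smul hx a, inner_sum]
  simp only [inner_smul_right, h.inner_curvature cov hx hF.contMDiffOn_conn, hF.eval_curv hx,
    Finset.mul_sum]

theorem ricci_eq (hF : h.Represents cov F) (hx : x ∈ U) (v w : TangentSpace I x) :
    ricci cov x v w = ∑ j, ∑ k, ⟪v, e j x⟫_ℝ * ⟪w, e k x⟫_ℝ * smoothRing.eval x (F.ric j k) := by
  classical
  have h1 := (orthoBasis I x).sum_apply_apply (h.basisAt hx)
    (f := fun a b ↦ ⟪curvature cov x a v w, b⟫_ℝ)
    (fun b ↦ by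
      constructor
      · intro a a'
        simp only [hF.inner_curvature_eq hx, inner_add_left, add_mul, mul_add,
          Finset.sum_add_distrib]
      · intro c a
        simp only [hF.inner_curvature_eq hx, inner_smul_left, conj_trivial, Finset.mul_sum,
          smul_eq_mul]
        refine Finset.sum_congr rfl fun _ _ ↦ Finset.sum_congr rfl fun _ _ ↦
          Finset.sum_congr rfl fun _ _ ↦ Finset.sum_congr rfl fun _ _ ↦ by ring)
    (fun a ↦ ⟨fun b b' ↦ inner_add_right _ _ _, fun c b ↦ inner_smul_right _ _ _⟩)
  rw [ricci, h1]
  simp only [h.basisAt_apply, h.inner_curvature cov hx hF.contMDiffOn_conn, h.inner_eq hx,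
    ← hF.eval_curv hx, FrameCalculus.ric, map_sum, ite_mul, one_mul, zero_mul]
  simp only [Finset.sum_ite_irrel, Finset.sum_const_zero, Finset.sum_ite_eq, Finset.mem_univ,
    if_true]
  rw [Finset.sum_comm]
  refine Finset.sum_congr rfl fun j _ ↦ ?_
  rw [Finset.sum_comm]
  simp only [Finset.mul_sum]

theorem ricci_frame (hF : h.Represents cov F) (hx : x ∈ U) (j k : ι) :
    ricci cov x (e j x) (e k x) = smoothRing.eval x (F.ric j k) := by
  classical
  rw [hF.ricci_eq hx]
  simp [h.inner_eq hx]

theorem scalarCurvature_eq (hF : h.Represents cov F) (hx : x ∈ U) :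
    scalarCurvature cov x = smoothRing.eval x (∑ j, F.ric j j) := by
  have h1 := (orthoBasis I x).sum_apply_apply (h.basisAt hx)
    (f := fun a b ↦ ricci cov x a b)
    (fun b ↦ by
      constructor
      · intro a a'
        simp only [hF.ricci_eq hx, inner_add_left, add_mul, Finset.sum_add_distrib]
      · intro c a
        simp only [hF.ricci_eq hx, inner_smul_left, conj_trivial, Finset.mul_sum,
          smul_eq_mul, mul_assoc])
    (fun b ↦ by
      constructor
      · intro a a'
        simp only [hF.ricci_eq hx, inner_add_left, add_mul, mul_add, Finset.sum_add_distrib]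
      · intro c a
        simp only [hF.ricci_eq hx, inner_smul_left, conj_trivial, Finset.mul_sum,
          smul_eq_mul]
        exact Finset.sum_congr rfl fun _ _ ↦ Finset.sum_congr rfl fun _ _ ↦ by ring)
  rw [scalarCurvature, h1]
  simp only [h.basisAt_apply, hF.ricci_frame hx, map_sum]

end Represents

variable {h : IsOrthoFrame e U}

/-- The functions `a` are the components of the tensor field `α`. -/
def Components (_ : IsOrthoFrame e U) {k : ℕ} (α : TensorField I M k)
    (a : (Fin k → ι) → smoothRing I U) : Prop :=
  ∀ y ∈ U, ∀ P, α y (fun m ↦ e (P m) y) = smoothRing.eval y (a P)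

theorem Components.diffTensorAt {k : ℕ} {α : TensorField I M k}
    {a : (Fin k → ι) → smoothRing I U} (ha : h.Components α a) (hα : ∀ y, IsTensorAt α y)
    (hx : x ∈ U) : DiffTensorAt α x := by
  refine h.diffTensorAt hx (fun y _ ↦ hα y) fun P ↦ ?_
  refine (smoothRing.mdiffAt h.isOpen (a P) hx).congr_of_eventuallyEq ?_
  filter_upwards [h.isOpen.mem_nhds hx] with y hy
  exact ha y hy P

theorem Components.covDeriv_apply {k : ℕ} {α : TensorField I M k}
    {a : (Fin k → ι) → smoothRing I U} (ha : h.Components α a) (hα : ∀ y, IsTensorAt α y)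
    (hF : h.Represents cov F) (hx : x ∈ U) (i : ι) (P : Fin k → ι) :
    covDeriv cov α x (Matrix.vecCons (e i x) fun m ↦ e (P m) x) =
      smoothRing.eval x (F.D i (a P) - ∑ m, ∑ p, F.conn i (P m) p * a (Function.update P m p)) := by
  rw [h.covDeriv_apply cov hx hα (ha.diffTensorAt hα hx)]
  simp only [map_sub, map_sum, map_mul, hF.conn x hx]
  rw [hF.eval_D_of_eqOn hx i fun y hy ↦ (ha y hy P).symm]
  congr 1
  refine Finset.sum_congr rfl fun m _ ↦ Finset.sum_congr rfl fun p _ ↦ ?_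
  rw [ha x hx]

theorem Components.covDeriv_one {α : TensorField I M 1} {a : ι → smoothRing I U}
    (ha : h.Components α fun P ↦ a (P 0)) (hα : ∀ y, IsTensorAt α y)
    (hF : h.Represents cov F) (hx : x ∈ U) (i j : ι) :
    covDeriv cov α x ![e i x, e j x] = smoothRing.eval x (F.nablaOne a i j) := by
  have := ha.covDeriv_apply hα hF hx i ![j]
  simp only [Finset.univ_unique, Fin.default_eq_zero, Finset.sum_singleton, Fin.isValue,
    Function.update_self, Matrix.cons_val_zero] at this
  rw [FrameCalculus.nablaOne, ← this]
  congr 1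
  funext m; fin_cases m <;> rfl

theorem Components.covDeriv_three {α : TensorField I M 3} {a : ι → ι → ι → smoothRing I U}
    (ha : h.Components α fun P ↦ a (P 0) (P 1) (P 2)) (hα : ∀ y, IsTensorAt α y)
    (hF : h.Represents cov F) (hx : x ∈ U) (i j k l : ι) :
    covDeriv cov α x ![e i x, e j x, e k x, e l x] =
      smoothRing.eval x (F.nablaThree a i j k l) := by
  have := ha.covDeriv_apply hα hF hx i ![j, k, l]
  rw [FrameCalculus.nablaThree, Finset.sum_add_distrib, Finset.sum_add_distrib]
  rw [Fin.sum_univ_three] at this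
  simp only [Function.update, Fin.isValue] at this
  refine Eq.trans ?_ (this.trans ?_)
  · congr 1
    funext m; fin_cases m <;> rfl
  · rfl

theorem Components.normSq_three {α : TensorField I M 3} {a : ι → ι → ι → smoothRing I U}
    (ha : h.Components α fun P ↦ a (P 0) (P 1) (P 2)) (hα : IsTensorAt α x) (hx : x ∈ U) :
    normSq α x = smoothRing.eval x (∑ i, ∑ j, ∑ k, a i j k * a i j k) := by
  obtain ⟨A, hA⟩ := hα
  have e1 := (orthoBasis I x).sum_mul_apply (h.basisAt hx) A A
  simp only [h.basisAt_apply, ← hA, ← pow_two] at e1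
  rw [normSq, e1, sum_fin_three_pi]
  simp only [ha x hx, map_sum, map_mul, pow_two]
  rfl

end IsOrthoFrame
end FrameEvaluation
end


noncomputable section

section LeviCalculus

set_option linter.unusedSectionVars false

variable {E : Type*} [NormedAddCommGroup E] [NormedSpace ℝ E] [FiniteDimensional ℝ E]
  {H : Type*} [TopologicalSpace H] {I : ModelWithCorners ℝ E H}
  {M : Type*} [TopologicalSpace M] [ChartedSpace H M] [IsManifold I ∞ M]
  [RiemannianBundle (fun x : M ↦ TangentSpace I x)]
  [IsContMDiffRiemannianBundle I ∞ E (fun x : M ↦ TangentSpace I x)]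
  {ι : Type*} [Fintype ι] {U : Set M} {e : ι → Π y : M, TangentSpace I y} {x : M}

theorem isTensorAt_of_linearMap {α : TensorField I M 1} (L : TangentSpace I x →ₗ[ℝ] ℝ)
    (h : ∀ v, α x v = L (v 0)) : IsTensorAt α x :=
  ⟨MultilinearMap.ofSubsingleton ℝ (TangentSpace I x) ℝ (0 : Fin 1) L, fun v ↦ h v⟩

theorem isTensorAt_metricTensor (x : M) : IsTensorAt (metricTensor I M) x := by
  refine ⟨{ toFun v := ⟪v 0, v 1⟫_ℝ, map_update_add' := ?_, map_update_smul' := ?_ },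
    fun _ ↦ rfl⟩
  · intro inst v m a b
    obtain rfl : inst = instDecidableEqFin 2 := Subsingleton.elim _ _
    fin_cases m <;> simp [Function.update, inner_add_left, inner_add_right]
  · intro inst v m c a
    obtain rfl : inst = instDecidableEqFin 2 := Subsingleton.elim _ _
    fin_cases m <;> simp [Function.update, inner_smul_left, inner_smul_right]

theorem diffTensorAt_metricTensor (x : M) : DiffTensorAt (metricTensor I M) x :=
  fun _ hX ↦ mdiff_inner (hX 0) (hX 1)

namespace IsOrthoFrame

theorem struc_swap_apply (h : IsOrthoFrame e U) (i j k : ι) (y : M) :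
    (h.struc i j k : M → ℝ) y = - (h.struc j i k : M → ℝ) y := by
  rw [h.struc_swap i j]; rfl

theorem contMDiffOn_conn_leviCivita (h : IsOrthoFrame e U) (i j k : ι) :
    ContMDiffOn I 𝓘(ℝ) ∞ (h.conn (leviCivita I M) i j k) U := by
  exact ContMDiffOn.congr (algebraMap ℝ (smoothRing I U) (1 / 2) * (h.struc i j k
      - h.struc i k j - h.struc j k i) : smoothRing I U).2 fun y hy ↦ h.conn_leviCivita hy i j k

theorem conn_leviCivita_skew (h : IsOrthoFrame e U) {y : M} (hy : y ∈ U) (i j k : ι) :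
    h.conn (leviCivita I M) i j k y = - h.conn (leviCivita I M) i k j y := by
  rw [h.conn_leviCivita hy, h.conn_leviCivita hy, h.struc_swap_apply k j]
  ring

theorem conn_leviCivita_torsion (h : IsOrthoFrame e U) {y : M} (hy : y ∈ U) (i j k : ι) :
    h.conn (leviCivita I M) i j k y - h.conn (leviCivita I M) j i k y
      - (h.struc i j k : M → ℝ) y = 0 := by
  rw [h.conn_leviCivita hy, h.conn_leviCivita hy, h.struc_swap_apply j i]
  ring

/-- The calculus of the Levi-Civita connection in a frame. -/
def leviCalculus (h : IsOrthoFrame e U) : FrameCalculus ι (smoothRing I U) :=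
  h.calculus (leviCivita I M) h.contMDiffOn_conn_leviCivita
    (fun _ hy ↦ h.conn_leviCivita_skew hy)
    (fun _ hy i j k ↦ by
      rw [h.conn_leviCivita_torsion hy, h.conn_leviCivita_torsion hy, neg_zero])

theorem leviCalculus_represents (h : IsOrthoFrame e U) :
    h.Represents (leviCivita I M) h.leviCalculus := h.calculus_represents _ _ _

/-- A metric connection is skew-symmetric in an orthonormal frame. -/
theorem covDeriv_metricTensor (h : IsOrthoFrame e U)
    (cov : CovariantDerivative I E (fun x : M ↦ TangentSpace I x)) (hx : x ∈ U) (i j k : ι) :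
    covDeriv cov (metricTensor I M) x ![e i x, e j x, e k x] =
      - (h.conn cov i j k x + h.conn cov i k j x) := by
  classical
  have h0 := h.covDeriv_apply cov hx isTensorAt_metricTensor (diffTensorAt_metricTensor x) i ![j, k]
  have h1 : mvfderiv I (fun y ↦ metricTensor I M y fun m ↦ e (![j, k] m) y) x (e i x) = 0 := by
    rw [mvfderiv_congr (g := fun _ ↦ if j = k then (1 : ℝ) else 0), mvfderiv_const]
    · simp
    · filter_upwards [h.isOpen.mem_nhds hx] with y hy
      exact h.inner_eq hy j k
  rw [h1, Fin.sum_univ_two] at h0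
  refine Eq.trans ?_ (h0.trans ?_)
  · congr 1
    funext m; fin_cases m <;> rfl
  · simp [metricTensor, Function.update, h.inner_eq hx, add_comm]

/-- A metric connection differs from the Levi-Civita connection by its torsion. -/
theorem conn_leviCivita_eq_sub (h : IsOrthoFrame e U)
    {cov : CovariantDerivative I E (fun x : M ↦ TangentSpace I x)} (hx : x ∈ U)
    (hm : ∀ i j k, h.conn cov i j k x = - h.conn cov i k j x)
    {T : ι → ι → ι → ℝ}
    (hT : ∀ i j k, T i j k = h.conn cov i j k x - h.conn cov j i k x - (h.struc i j k : M → ℝ) x)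
    (h₁ : ∀ i j k, T i j k = - T j i k) (h₂ : ∀ i j k, T i j k = - T i k j) (i j k : ι) :
    h.conn (leviCivita I M) i j k x = h.conn cov i j k x - 1 / 2 * T i j k := by
  rw [h.conn_leviCivita hx]
  have e1 := hT i j k
  have e2 := hT i k j
  have e3 := hT j k i
  have e4 := h₂ i j k
  have e5 := h₁ i j k
  have e6 := h₂ j k i
  have e7 := hm i j k
  have e8 := hm k i j
  have e9 := hm j i k
  linarith

end IsOrthoFrame
end LeviCalculus

section Spin7Frames

set_option linter.unusedSectionVars false

variable {M : Type*} [TopologicalSpace M] [ChartedSpace (EuclideanSpace ℝ (Fin 8)) M]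
  [IsManifold (𝓡 8) ∞ M] [RiemannianBundle (fun x : M ↦ TangentSpace (𝓡 8) x)]
  [IsContMDiffRiemannianBundle (𝓡 8) ∞ (EuclideanSpace ℝ (Fin 8))
    (fun x : M ↦ TangentSpace (𝓡 8) x)]

namespace Spin7Structure

variable {S : Spin7Structure M} {e : Fin 8 → (y : M) → TangentSpace (𝓡 8) y} {U : Set M} {x : M}

/-- The frame `e` is orthonormal and `Φ` is the standard form in it. -/
structure IsAdapted (S : Spin7Structure M) (e : Fin 8 → (y : M) → TangentSpace (𝓡 8) y)
    (U : Set M) : Prop extends frame : IsOrthoFrame e U where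
  form_apply : ∀ y ∈ U, ∀ P : Fin 4 → Fin 8,
    S.fundamentalForm y (fun m ↦ e (P m) y) = phi (P 0) (P 1) (P 2) (P 3)

theorem exists_isAdapted (S : Spin7Structure M) (x : M) : ∃ U, x ∈ U ∧ ∃ e, S.IsAdapted e U := by
  obtain ⟨U, hU, hx, e, he, h⟩ := S.exists_frame x
  refine ⟨U, hx, e, ⟨hU, he.contMDiffOn, fun y hy ↦ (h y hy).1, fun y hy ↦ he.generating hy⟩, ?_⟩
  intro y hy P
  rw [fundamentalForm, (h y hy).2, ← standardForm_kron]
  congr 1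
  funext m n
  rw [orthonormal_iff_ite.1 (h y hy).1, kron_eq]
  fin_cases m <;> simp [eq_comm]

theorem isTensorAt_fundamentalForm (S : Spin7Structure M) (x : M) :
    IsTensorAt S.fundamentalForm x :=
  ⟨(S.form x).toMultilinearMap, fun _ ↦ rfl⟩

namespace IsAdapted

theorem components_fundamentalForm (h : S.IsAdapted e U) :
    h.frame.Components S.fundamentalForm
      fun P ↦ phiCast (smoothRing (𝓡 8) U) (P 0) (P 1) (P 2) (P 3) := by
  intro y hy P
  simp only [h.form_apply y hy, phiCast, map_intCast]

theorem diffTensorAt_fundamentalForm (h : S.IsAdapted e U) (hx : x ∈ U) :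
    DiffTensorAt S.fundamentalForm x :=
  h.components_fundamentalForm.diffTensorAt S.isTensorAt_fundamentalForm hx

theorem covDeriv_fundamentalForm (h : S.IsAdapted e U)
    (cov : CovariantDerivative (𝓡 8) (EuclideanSpace ℝ (Fin 8))
      (fun x : M ↦ TangentSpace (𝓡 8) x)) (hx : x ∈ U) (i a b c d : Fin 8) :
    covDeriv cov S.fundamentalForm x ![e i x, e a x, e b x, e c x, e d x] =
      - actFour (fun j k ↦ h.frame.conn cov i j k x) (phiCast ℝ) a b c d := by
  have h0 := h.frame.covDeriv_apply cov hx S.isTensorAt_fundamentalForm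
    (h.diffTensorAt_fundamentalForm hx) i ![a, b, c, d]
  have h1 : mvfderiv (𝓡 8) (fun y ↦ S.fundamentalForm y fun m ↦ e (![a, b, c, d] m) y) x (e i x)
      = 0 := by
    rw [mvfderiv_congr (g := fun _ ↦ (phi a b c d : ℝ)), mvfderiv_const]
    · simp
    · filter_upwards [h.frame.isOpen.mem_nhds hx] with y hy
      exact h.form_apply y hy _
  rw [h1, Fin.sum_univ_four, zero_sub] at h0
  refine Eq.trans ?_ (h0.trans ?_)
  · congr 1
    funext m; fin_cases m <;> rfl
  · simp only [h.form_apply x hx, actFour, Finset.sum_add_distrib]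
    rfl

/-- The components of `δΦ`. -/
def codiffForm (h : S.IsAdapted e U) (j k l : Fin 8) : smoothRing (𝓡 8) U :=
  ∑ i, actFour (h.frame.leviCalculus.conn i) (phiCast _) i j k l

theorem eval_codiffForm (h : S.IsAdapted e U) (hx : x ∈ U) (j k l : Fin 8) :
    smoothRing.eval x (h.codiffForm j k l) =
      ∑ i, actFour (fun a b ↦ h.frame.conn (leviCivita (𝓡 8) M) i a b x) (phiCast ℝ) i j k l := by
  simp only [codiffForm, actFour, phiCast, map_sum, map_add, map_mul, map_intCast,
    h.frame.leviCalculus_represents.conn x hx]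

theorem components_codiff (h : S.IsAdapted e U) :
    h.frame.Components (codiff S.fundamentalForm) fun P ↦ h.codiffForm (P 0) (P 1) (P 2) := by
  intro y hy P
  rw [h.frame.codiff_apply hy (isTensorAt_covDeriv _ S.isTensorAt_fundamentalForm
    (h.diffTensorAt_fundamentalForm hy)), h.eval_codiffForm hy, ← Finset.sum_neg_distrib]
  refine Finset.sum_congr rfl fun i _ ↦ ?_
  rw [← neg_eq_iff_eq_neg.2 (h.covDeriv_fundamentalForm (leviCivita (𝓡 8) M) hy i i (P 0) (P 1) (P 2))]
  congr 2
  funext m; fin_cases m <;> rfl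

end IsAdapted

theorem isTensorAt_codiff_fundamentalForm (S : Spin7Structure M) (x : M) :
    IsTensorAt (codiff S.fundamentalForm) x := by
  obtain ⟨U, hx, e, h⟩ := S.exists_isAdapted x
  exact IsOrthoFrame.isTensorAt_codiff (isTensorAt_covDeriv _ S.isTensorAt_fundamentalForm
    (h.diffTensorAt_fundamentalForm hx))

/-- `Φ(a, b, c, ·)` as a function of `a`, `b`, `c`. -/
def formCurry (S : Spin7Structure M) (x : M) (w : TangentSpace (𝓡 8) x) :
    MultilinearMap ℝ (fun _ : Fin 3 ↦ TangentSpace (𝓡 8) x) ℝ :=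
  (LinearMap.applyₗ w).compMultilinearMap
    (MultilinearMap.curryRight (S.form x).toMultilinearMap)

theorem formCurry_apply (S : Spin7Structure M) (x : M) (v : Fin 3 → TangentSpace (𝓡 8) x)
    (w : TangentSpace (𝓡 8) x) : S.formCurry x w v = S.form x ![v 0, v 1, v 2, w] := by
  simp only [formCurry, LinearMap.compMultilinearMap_apply]
  have : (Fin.snoc v w : Fin 4 → TangentSpace (𝓡 8) x) = ![v 0, v 1, v 2, w] := by
    funext m; fin_cases m <;> rfl
  simp [this]

theorem isTensorAt_leeForm (S : Spin7Structure M) (x : M) : IsTensorAt S.leeForm x := by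
  refine isTensorAt_of_linearMap ((1 / 42 : ℝ) • ∑ i, ∑ j, ∑ k,
    codiff S.fundamentalForm x ![orthoBasis (𝓡 8) x i, orthoBasis (𝓡 8) x j, orthoBasis (𝓡 8) x k]
      • MultilinearMap.curryRight (S.form x).toMultilinearMap
        ![orthoBasis (𝓡 8) x i, orthoBasis (𝓡 8) x j, orthoBasis (𝓡 8) x k]) fun v ↦ ?_
  simp only [leeForm, LinearMap.smul_apply, LinearMap.sum_apply, smul_eq_mul]
  congr 1
  refine Finset.sum_congr rfl fun i _ ↦ Finset.sum_congr rfl fun j _ ↦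
    Finset.sum_congr rfl fun k _ ↦ ?_
  congr 1
  exact (S.formCurry_apply x
    ![orthoBasis (𝓡 8) x i, orthoBasis (𝓡 8) x j, orthoBasis (𝓡 8) x k] (v 0)).symm

theorem IsAdapted.leeForm_apply (h : S.IsAdapted e U) (hx : x ∈ U) (a : Fin 8) :
    S.leeForm x ![e a x] = 1 / 42 * ∑ i, ∑ j, ∑ k,
      smoothRing.eval x (h.codiffForm i j k) * phi i j k a := by
  obtain ⟨A, hA⟩ := S.isTensorAt_codiff_fundamentalForm x
  have e1 := (orthoBasis (𝓡 8) x).sum_mul_apply (h.frame.basisAt hx) A (S.formCurry x (e a x))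
  have hv : ∀ i j k, (fun m ↦ orthoBasis (𝓡 8) x (![i, j, k] m)) =
      ![orthoBasis (𝓡 8) x i, orthoBasis (𝓡 8) x j, orthoBasis (𝓡 8) x k] := fun i j k ↦ by
    funext m; fin_cases m <;> rfl
  simp only [h.frame.basisAt_apply, ← hA, sum_fin_three_pi, hv] at e1
  simp only [S.formCurry_apply, Matrix.cons_val_zero, Matrix.cons_val_one, Matrix.cons_val] at e1
  have e2 : S.leeForm x ![e a x] = _ := congrArg (fun t : ℝ ↦ 1 / 42 * t) e1
  rw [e2]
  congr 1
  refine Finset.sum_congr rfl fun i _ ↦ Finset.sum_congr rfl fun j _ ↦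
    Finset.sum_congr rfl fun k _ ↦ ?_
  rw [h.components_codiff x hx]
  congr 1
  refine Eq.trans ?_ (h.form_apply x hx ![i, j, k, a])
  rw [fundamentalForm]
  congr 1
  funext m; fin_cases m <;> rfl

end Spin7Structure
end Spin7Frames
end


noncomputable section

section SkewTensors

variable {E : Type*} [NormedAddCommGroup E] [NormedSpace ℝ E]
  {H : Type*} [TopologicalSpace H] {I : ModelWithCorners ℝ E H}
  {M : Type*} [TopologicalSpace M] [ChartedSpace H M]

theorem smoothRing.ext_eval {U : Set M} {f g : smoothRing I U}
    (h : ∀ y, smoothRing.eval y f = smoothRing.eval y g) : f = g :=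
  Subtype.ext (funext h)

theorem IsSkew.swap_left {α : TensorField I M 3} (hs : IsSkew α) {x : M}
    (a b c : TangentSpace I x) : α x ![a, b, c] = - α x ![b, a, c] := by
  have := hs x ![b, a, c] (Equiv.swap 0 1)
  have e : ![b, a, c] ∘ (Equiv.swap (0 : Fin 3) 1) = ![a, b, c] := by
    funext i; fin_cases i <;> rfl
  rw [e, Equiv.Perm.sign_swap (by decide)] at this
  simpa using this

theorem IsSkew.swap_right {α : TensorField I M 3} (hs : IsSkew α) {x : M}
    (a b c : TangentSpace I x) : α x ![a, b, c] = - α x ![a, c, b] := by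
  have := hs x ![a, c, b] (Equiv.swap 1 2)
  have e : ![a, c, b] ∘ (Equiv.swap (1 : Fin 3) 2) = ![a, b, c] := by
    funext i; fin_cases i <;> rfl
  rw [e, Equiv.Perm.sign_swap (by decide)] at this
  simpa using this

end SkewTensors

section TorsionCalculus

set_option linter.unusedSectionVars false

variable {M : Type*} [TopologicalSpace M] [ChartedSpace (EuclideanSpace ℝ (Fin 8)) M]
  [IsManifold (𝓡 8) ∞ M] [RiemannianBundle (fun x : M ↦ TangentSpace (𝓡 8) x)]
  [IsContMDiffRiemannianBundle (𝓡 8) ∞ (EuclideanSpace ℝ (Fin 8))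
    (fun x : M ↦ TangentSpace (𝓡 8) x)]

namespace Spin7Structure

variable {S : Spin7Structure M} {e : Fin 8 → (y : M) → TangentSpace (𝓡 8) y} {U : Set M} {x : M}
  {cov : CovariantDerivative (𝓡 8) (EuclideanSpace ℝ (Fin 8)) (fun x : M ↦ TangentSpace (𝓡 8) x)}

namespace IsAdapted

/-- The components of the torsion of the connection which preserves `Φ`. -/
def torsionComp (h : S.IsAdapted e U) (i j k : Fin 8) : smoothRing (𝓡 8) U :=
  h.codiffForm i j k + algebraMap ℝ _ (1 / 36) *
    ∑ a, (∑ l, ∑ m, ∑ n, h.codiffForm l m n * phi l m n a) * phi a i j k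

theorem two_mul_codiffForm (h : S.IsAdapted e U) (hx : x ∈ U) {T : Fin 8 → Fin 8 → Fin 8 → ℝ}
    (h₁ : ∀ i j k, T i j k = - T j i k) (h₂ : ∀ i j k, T i j k = - T i k j)
    (hT : ∀ i a b c d, actFour (fun j k ↦ h.frame.conn (leviCivita (𝓡 8) M) i j k x
      + 1 / 2 * T i j k) (phiCast ℝ) a b c d = 0) (j k l : Fin 8) :
    2 * smoothRing.eval x (h.codiffForm j k l) = phiTwist T j k l := by
  have e1 := sum_actFour_tor h₁ h₂ j k l
  have e2 : ∀ i, actFour (fun j k ↦ h.frame.conn (leviCivita (𝓡 8) M) i j k x) (phiCast ℝ) i j k l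
      = - (1 / 2) * actFour (T i) (phiCast ℝ) i j k l := by
    intro i
    have e3 := hT i i j k l
    simp only [actFour, add_mul, Finset.sum_add_distrib, mul_assoc, ← Finset.mul_sum] at e3 ⊢
    linarith
  rw [h.eval_codiffForm hx]
  simp only [e2, ← Finset.mul_sum, e1]
  ring

theorem sum_codiffForm (h : S.IsAdapted e U) (hx : x ∈ U) {T : Fin 8 → Fin 8 → Fin 8 → ℝ}
    (h₁ : ∀ i j k, T i j k = - T j i k) (h₂ : ∀ i j k, T i j k = - T i k j)
    (hT : ∀ i a b c d, actFour (fun j k ↦ h.frame.conn (leviCivita (𝓡 8) M) i j k x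
      + 1 / 2 * T i j k) (phiCast ℝ) a b c d = 0) (a : Fin 8) :
    ∑ i, ∑ j, ∑ k, smoothRing.eval x (h.codiffForm i j k) * (phi i j k a : ℝ) =
      6 * phiTrace T a :=
  sum_mul_phi_of_two_mul_eq_phiTwist h₁ h₂ (h.two_mul_codiffForm hx h₁ h₂ hT) a

theorem eq_torsionComp (h : S.IsAdapted e U) (hx : x ∈ U) {T : Fin 8 → Fin 8 → Fin 8 → ℝ}
    (h₁ : ∀ i j k, T i j k = - T j i k) (h₂ : ∀ i j k, T i j k = - T i k j)
    (hT : ∀ i a b c d, actFour (fun j k ↦ h.frame.conn (leviCivita (𝓡 8) M) i j k x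
      + 1 / 2 * T i j k) (phiCast ℝ) a b c d = 0) (i j k : Fin 8) :
    T i j k = smoothRing.eval x (h.torsionComp i j k) := by
  have e1 := six_mul_of_two_mul_eq_phiTwist h₁ h₂ (h.two_mul_codiffForm hx h₁ h₂ hT) i j k
  simp only [torsionComp, map_add, map_mul, map_sum, map_intCast, h.sum_codiffForm hx h₁ h₂ hT,
    mul_assoc, ← Finset.mul_sum]
  have e2 : smoothRing.eval x (algebraMap ℝ (smoothRing (𝓡 8) U) (1 / 36)) = 1 / 36 := rfl
  rw [e2]
  linarith

end IsAdapted

namespace IsTorsionConnection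

theorem conn_skew (hcov : S.IsTorsionConnection cov) (h : IsOrthoFrame e U) (hx : x ∈ U)
    (i j k : Fin 8) : h.conn cov i j k x = - h.conn cov i k j x := by
  have := hcov.metric x ![e i x, e j x, e k x]
  rw [h.covDeriv_metricTensor cov hx] at this
  linarith

theorem torsion_swap_left (hcov : S.IsTorsionConnection cov) (a b c : TangentSpace (𝓡 8) x) :
    torsionTensor cov x ![a, b, c] = - torsionTensor cov x ![b, a, c] := hcov.skew.swap_left a b c

theorem torsion_swap_right (hcov : S.IsTorsionConnection cov) (a b c : TangentSpace (𝓡 8) x) :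
    torsionTensor cov x ![a, b, c] = - torsionTensor cov x ![a, c, b] := hcov.skew.swap_right a b c

theorem actFour_conn (hcov : S.IsTorsionConnection cov) (h : S.IsAdapted e U) (hx : x ∈ U)
    (i a b c d : Fin 8) :
    actFour (fun j k ↦ h.frame.conn cov i j k x) (phiCast ℝ) a b c d = 0 := by
  have := hcov.form x ![e i x, e a x, e b x, e c x, e d x]
  rwa [h.covDeriv_fundamentalForm cov hx, neg_eq_zero] at this

theorem conn_leviCivita_eq (hcov : S.IsTorsionConnection cov) (h : IsOrthoFrame e U) (hx : x ∈ U)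
    (i j k : Fin 8) : h.conn (leviCivita (𝓡 8) M) i j k x =
      h.conn cov i j k x - 1 / 2 * torsionTensor cov x ![e i x, e j x, e k x] :=
  h.conn_leviCivita_eq_sub hx (hcov.conn_skew h hx) (h.torsion_apply cov hx)
    (fun _ _ _ ↦ hcov.torsion_swap_left _ _ _) (fun _ _ _ ↦ hcov.torsion_swap_right _ _ _) i j k

theorem actFour_leviCivita (hcov : S.IsTorsionConnection cov) (h : S.IsAdapted e U) (hx : x ∈ U)
    (i a b c d : Fin 8) : actFour (fun j k ↦ h.frame.conn (leviCivita (𝓡 8) M) i j k x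
      + 1 / 2 * torsionTensor cov x ![e i x, e j x, e k x]) (phiCast ℝ) a b c d = 0 := by
  simp only [hcov.conn_leviCivita_eq h.frame hx, sub_add_cancel]
  exact hcov.actFour_conn h hx i a b c d

theorem torsion_eq (hcov : S.IsTorsionConnection cov) (h : S.IsAdapted e U) (hx : x ∈ U)
    (i j k : Fin 8) : torsionTensor cov x ![e i x, e j x, e k x] =
      smoothRing.eval x (h.torsionComp i j k) :=
  h.eq_torsionComp hx (T := fun i j k ↦ torsionTensor cov x ![e i x, e j x, e k x])
    (fun _ _ _ ↦ hcov.torsion_swap_left _ _ _) (fun _ _ _ ↦ hcov.torsion_swap_right _ _ _)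
    (hcov.actFour_leviCivita h hx) i j k

theorem contMDiffOn_conn (hcov : S.IsTorsionConnection cov) (h : S.IsAdapted e U)
    (i j k : Fin 8) : ContMDiffOn (𝓡 8) 𝓘(ℝ) ∞ (h.frame.conn cov i j k) U := by
  refine ContMDiffOn.congr (h.frame.leviCalculus.conn i j k
    + algebraMap ℝ _ (1 / 2) * h.torsionComp i j k : smoothRing (𝓡 8) U).2 fun y hy ↦ ?_
  have e1 := hcov.conn_leviCivita_eq h.frame hy i j k
  rw [hcov.torsion_eq h hy, ← h.frame.leviCalculus_represents.conn y hy] at e1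
  exact (sub_eq_iff_eq_add.1 e1.symm)

/-- The calculus of the torsion connection in an adapted frame. -/
def calculus (hcov : S.IsTorsionConnection cov) (h : S.IsAdapted e U) :
    FrameCalculus (Fin 8) (smoothRing (𝓡 8) U) :=
  h.frame.calculus cov (hcov.contMDiffOn_conn h) (fun _ hy ↦ hcov.conn_skew h.frame hy)
    fun y hy i j k ↦ by
      rw [← h.frame.torsion_apply cov hy, ← h.frame.torsion_apply cov hy,
        hcov.torsion_swap_right]

theorem represents (hcov : S.IsTorsionConnection cov) (h : S.IsAdapted e U) :
    h.frame.Represents cov (hcov.calculus h) := h.frame.calculus_represents _ _ _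

theorem components_torsion (hcov : S.IsTorsionConnection cov) (h : S.IsAdapted e U) :
    h.frame.Components (torsionTensor cov) fun P ↦ (hcov.calculus h).tor (P 0) (P 1) (P 2) := by
  intro y hy P
  have e1 := h.frame.torsion_apply cov hy (P 0) (P 1) (P 2)
  simp only [(hcov.calculus h).tor_eq, map_sub, (hcov.represents h).conn y hy, (hcov.represents h).struc,
    smoothRing.eval_eq y (h.frame.struc _ _ _)]
  rw [← e1]
  congr 1
  funext m; fin_cases m <;> rfl

theorem eval_tor (hcov : S.IsTorsionConnection cov) (h : S.IsAdapted e U) (hx : x ∈ U)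
    (i j k : Fin 8) : smoothRing.eval x ((hcov.calculus h).tor i j k) =
      torsionTensor cov x ![e i x, e j x, e k x] := by
  refine (hcov.components_torsion h x hx ![i, j, k]).symm.trans ?_
  congr 1
  funext m; fin_cases m <;> rfl

theorem represents_levi (hcov : S.IsTorsionConnection cov) (h : S.IsAdapted e U) :
    h.frame.Represents (leviCivita (𝓡 8) M) (hcov.calculus h).levi where
  D := rfl
  struc := rfl
  conn y hy i j k := by
    have e1 : smoothRing.eval y (FrameCalculus.half (smoothRing (𝓡 8) U)) = 1 / 2 := rfl
    simp only [FrameCalculus.levi, map_sub, map_mul, (hcov.represents h).conn y hy, e1,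
      hcov.eval_tor h hy, hcov.conn_leviCivita_eq h.frame hy]

theorem eval_conn_of_notMem (hcov : S.IsTorsionConnection cov) (h : S.IsAdapted e U) (hx : x ∉ U)
    (i j k : Fin 8) : smoothRing.eval x ((hcov.calculus h).conn i j k) = 0 :=
  smoothRing.mk_apply_of_notMem (hcov.contMDiffOn_conn h i j k) hx

theorem eval_D_of_notMem (hcov : S.IsTorsionConnection cov) (h : S.IsAdapted e U) (hx : x ∉ U)
    (i : Fin 8) (f : smoothRing (𝓡 8) U) : smoothRing.eval x ((hcov.calculus h).D i f) = 0 :=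
  fieldDerivation_apply_of_notMem h.frame.isOpen (h.frame.smooth i) f hx

theorem eval_tor_of_notMem (hcov : S.IsTorsionConnection cov) (h : S.IsAdapted e U) (hx : x ∉ U)
    (i j k : Fin 8) : smoothRing.eval x ((hcov.calculus h).tor i j k) = 0 := by
  have e1 : smoothRing.eval x ((hcov.calculus h).struc i j k) = 0 :=
    (congrArg (smoothRing.eval x) (congrFun (congrFun (congrFun (hcov.represents h).struc i) j) k)).trans (by
      simp [IsOrthoFrame.struc, smoothRing.eval_eq, smoothRing.mk_apply_of_notMem _ hx])
  rw [(hcov.calculus h).tor_eq, map_sub, map_sub, hcov.eval_conn_of_notMem h hx,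
    hcov.eval_conn_of_notMem h hx, e1]
  simp

theorem phiParallel (hcov : S.IsTorsionConnection cov) (h : S.IsAdapted e U) :
    (hcov.calculus h).PhiParallel := by
  intro i a b c d
  refine smoothRing.ext_eval fun y ↦ ?_
  rw [map_zero]
  by_cases hy : y ∈ U
  · rw [← hcov.actFour_conn h hy i a b c d]
    simp only [actFour, phiCast, map_sum, map_add, map_mul, map_intCast,
      (hcov.represents h).conn y hy]
  · simp [actFour, hcov.eval_conn_of_notMem h hy]

theorem eval_phiTrace (hcov : S.IsTorsionConnection cov) (h : S.IsAdapted e U) (hx : x ∈ U)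
    (a : Fin 8) : smoothRing.eval x (phiTrace (hcov.calculus h).tor a) = 7 * S.leeForm x ![e a x] := by
  have e1 := h.sum_codiffForm hx (T := fun i j k ↦ torsionTensor cov x ![e i x, e j x, e k x])
    (fun _ _ _ ↦ hcov.torsion_swap_left _ _ _) (fun _ _ _ ↦ hcov.torsion_swap_right _ _ _)
    (hcov.actFour_leviCivita h hx) a
  rw [h.leeForm_apply hx, e1]
  simp only [phiTrace, map_sum, map_mul, map_intCast, hcov.eval_tor h hx]
  ring

/-- The components of the Lee form. -/
theorem components_leeForm (hcov : S.IsTorsionConnection cov) (h : S.IsAdapted e U) :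
    h.frame.Components S.leeForm fun P ↦
      algebraMap ℝ _ (1 / 7) * phiTrace (hcov.calculus h).tor (P 0) := by
  intro y hy P
  have e2 : smoothRing.eval y (algebraMap ℝ (smoothRing (𝓡 8) U) (1 / 7)) = 1 / 7 := rfl
  have e3 : (fun m ↦ e (P m) y) = ![e (P 0) y] := by funext m; fin_cases m; rfl
  rw [map_mul, hcov.eval_phiTrace h hy, e2, e3]
  ring

theorem closed (hcov : S.IsTorsionConnection cov) (hT : IsClosedThree (torsionTensor cov))
    (h : S.IsAdapted e U) : (hcov.calculus h).Closed := by
  intro i j k l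
  refine smoothRing.ext_eval fun y ↦ ?_
  rw [map_zero]
  by_cases hy : y ∈ U
  · have e1 := hT y ![e i y, e j y, e k y, e l y]
    rw [extDerivThree_eq cov (isTensorAt_torsionTensor cov y) hcov.skew] at e1
    have e2 := hcov.components_torsion h
    have e3 : ∀ a b c d, torsionTensor cov y ![cov.torsion y (e a y) (e b y), e c y, e d y] =
        ∑ p, torsionTensor cov y ![e a y, e b y, e p y] *
          torsionTensor cov y ![e c y, e d y, e p y] := by
      intro a b c d
      rw [hcov.torsion_swap_left, hcov.torsion_swap_right, neg_neg]
      have e4 : ∀ w, torsionTensor cov y ![e c y, e d y, w] = ⟪cov.torsion y (e c y) (e d y), w⟫_ℝ :=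
        fun _ ↦ rfl
      have e5 : ∀ w, torsionTensor cov y ![e a y, e b y, w] = ⟪cov.torsion y (e a y) (e b y), w⟫_ℝ :=
        fun _ ↦ rfl
      simp only [e4, e5]
      conv_lhs => rw [← h.frame.sum_inner_smul hy (cov.torsion y (e a y) (e b y)), inner_sum]
      simp only [inner_smul_right]
    simp only [Matrix.cons_val_zero, Matrix.cons_val_one, Matrix.cons_val,
      e2.covDeriv_three (isTensorAt_torsionTensor cov) (hcov.represents h) hy, e3] at e1
    simp only [map_add, map_sub, map_mul, map_ofNat]
    simp only [FrameCalculus.sig, map_sum, map_add, map_mul, hcov.eval_tor h hy,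
      Finset.sum_add_distrib]
    set Q : Fin 8 → Fin 8 → Fin 8 → Fin 8 → ℝ := fun a b c d ↦
      ∑ p, torsionTensor cov y ![e a y, e b y, e p y] * torsionTensor cov y ![e c y, e d y, e p y]
      with hQ
    have q1 : ∀ a b c d, Q a b c d = Q c d a b := fun a b c d ↦
      Finset.sum_congr rfl fun p _ ↦ mul_comm _ _
    have q2 : ∀ a b c d, Q a b c d = - Q b a c d := fun a b c d ↦ by
      simp only [hQ, ← Finset.sum_neg_distrib]
      refine Finset.sum_congr rfl fun p _ ↦ ?_
      rw [hcov.torsion_swap_left (e a y)]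
      ring
    change _ + 2 * (Q i j k l + Q j k i l + Q k i j l) = 0
    change _ + Q i j k l - Q i k j l + Q i l j k + Q j k i l - Q j l i k + Q k l i j = 0 at e1
    rw [q1 i l j k, q1 j l i k, q1 k l i j, q2 i k j l] at e1
    linarith
  · simp [FrameCalculus.nablaThree, FrameCalculus.sig, hcov.eval_conn_of_notMem h hy,
      hcov.eval_tor_of_notMem h hy, hcov.eval_D_of_notMem h hy]

end IsTorsionConnection
end Spin7Structure
end TorsionCalculus
end


noncomputable section

section MaximumPrinciple

set_option linter.unusedSectionVars false

variable {E : Type*} [NormedAddCommGroup E] [InnerProductSpace ℝ E] [FiniteDimensional ℝ E]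
  {H : Type*} [TopologicalSpace H] {I : ModelWithCorners ℝ E H} [I.Boundaryless]
  {M : Type*} [TopologicalSpace M] [ChartedSpace H M] [IsManifold I ∞ M]
  {ι : Type*} [Fintype ι] {U : Set M} {e : ι → Π y : M, TangentSpace I y} {x : M}

/-- The derivative of a function along a vector, computed in a chart. -/
theorem fderiv_comp_extChartAt_symm {g : M → ℝ} {y : M} (hg : MDiffAt g y)
    (hy : y ∈ (chartAt H x).source) (v : TangentSpace I y) :
    fderiv ℝ (g ∘ (extChartAt I x).symm) (extChartAt I x y) (mvfderiv I (extChartAt I x) y v) =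
      mvfderiv I g y v := by
  have hy' : y ∈ (extChartAt I x).source := by rwa [extChartAt_source]
  have h1 : MDiffAt (extChartAt I x) y :=
    ((contMDiffOn_extChartAt (n := ∞)).contMDiffAt
      ((chartAt H x).open_source.mem_nhds hy)).mdifferentiableAt (by simp)
  have h2 : MDifferentiableAt 𝓘(ℝ, E) I (extChartAt I x).symm (extChartAt I x y) :=
    ((contMDiffOn_extChartAt_symm (n := ∞) x).contMDiffAt
      ((isOpen_extChartAt_target x).mem_nhds ((extChartAt I x).map_source hy'))).mdifferentiableAt
      (by simp)
  have hl : (extChartAt I x).symm (extChartAt I x y) = y := (extChartAt I x).left_inv hy'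
  have h3 : MDiffAt (g ∘ (extChartAt I x).symm) (extChartAt I x y) :=
    MDifferentiableAt.comp _ (by rwa [hl]) h2
  have h4 : g =ᶠ[𝓝 y] (g ∘ (extChartAt I x).symm) ∘ extChartAt I x := by
    filter_upwards [(chartAt H x).open_source.mem_nhds hy] with z hz
    simp only [Function.comp_apply]
    rw [(extChartAt I x).left_inv (by rwa [extChartAt_source])]
  rw [mvfderiv_congr h4, mvfderiv_comp_apply _ h3 h1]
  change _ = mfderiv 𝓘(ℝ, E) 𝓘(ℝ, ℝ) (g ∘ (extChartAt I x).symm) (extChartAt I x y) _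
  rw [mfderiv_eq_fderiv]
  rfl

/-- The strong maximum principle for a second-order operator given by a frame. -/
theorem eventually_eq_of_frame_operator_nonneg (hU : IsOpen U)
    (he : ∀ i, ContMDiffOn I I.tangent ∞ (T% (e i)) U)
    (hspan : ∀ y ∈ U, ⊤ ≤ Submodule.span ℝ (Set.range fun i ↦ e i y)) (hx : x ∈ U)
    {f : M → ℝ} (hf : ContMDiffOn I 𝓘(ℝ) ∞ f U) {b : ι → M → ℝ} (hb : ∀ i, ContinuousOn (b i) U)
    (hL : ∀ y ∈ U, 0 ≤ ∑ i, (mvfderiv I (fun z ↦ mvfderiv I f z (e i z)) y (e i y)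
      + b i y * mvfderiv I f y (e i y)))
    (hmax : ∀ y ∈ U, f y ≤ f x) : ∀ᶠ y in 𝓝 x, f y = f x := by
  set φ := extChartAt I x with hφ
  set W : Set M := U ∩ (chartAt H x).source with hW
  have hWo : IsOpen W := hU.inter (chartAt H x).open_source
  have hxW : x ∈ W := ⟨hx, mem_chart_source H x⟩
  have hWs : ∀ y ∈ W, y ∈ φ.source := fun y hy ↦ by rw [hφ, extChartAt_source]; exact hy.2
  set V : Set E := φ.target ∩ φ.symm ⁻¹' W with hV
  have hVo : IsOpen V :=
    (continuousOn_extChartAt_symm x).isOpen_inter_preimage (isOpen_extChartAt_target x) hWo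
  have hxV : φ x ∈ V := ⟨φ.map_source (hWs x hxW), by
    rw [Set.mem_preimage, φ.left_inv (hWs x hxW)]; exact hxW⟩
  have hsymm : ContMDiffOn 𝓘(ℝ, E) I ∞ φ.symm V :=
    (contMDiffOn_extChartAt_symm x).mono Set.inter_subset_left
  set X : ι → M → E := fun i y ↦ mvfderiv I φ y (e i y) with hX
  have hXs : ∀ i, ContMDiffOn I 𝓘(ℝ, E) ∞ (X i) W := fun i ↦
    contMDiffOn_mvfderiv_apply hWo (contMDiffOn_extChartAt.mono fun y hy ↦ hy.2)
      ((he i).mono fun y hy ↦ hy.1)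
  have hfs : ContMDiffOn I 𝓘(ℝ) ∞ f W := hf.mono fun y hy ↦ hy.1
  have hDf : ∀ i, ContMDiffOn I 𝓘(ℝ) ∞ (fun z ↦ mvfderiv I f z (e i z)) W := fun i ↦
    contMDiffOn_mvfderiv_apply hWo hfs ((he i).mono fun y hy ↦ hy.1)
  have hchain : ∀ {g : M → ℝ}, ContMDiffOn I 𝓘(ℝ) ∞ g W → ∀ z ∈ V, ∀ i,
      fderiv ℝ (g ∘ φ.symm) z (X i (φ.symm z)) = mvfderiv I g (φ.symm z) (e i (φ.symm z)) := by
    intro g hg z hz i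
    have := fderiv_comp_extChartAt_symm (x := x) (mdiffAt_fun_of_contMDiffOn hWo hg hz.2) hz.2.2
      (e i (φ.symm z))
    rwa [φ.right_inv hz.1] at this
  have hmain : ∀ᶠ z in 𝓝 (φ x), (f ∘ φ.symm) z = (f ∘ φ.symm) (φ x) := by
    refine eventually_eq_of_hopfOperator_nonneg hVo (X := fun i ↦ X i ∘ φ.symm)
      (b := fun i ↦ b i ∘ φ.symm) (fun i ↦ (contMDiffOn_iff_contDiffOn.1 ((hXs i).comp hsymm fun z hz ↦ hz.2)).of_le (by simp))
      (fun i ↦ ((hb i).mono fun y hy ↦ hy.1).comp hsymm.continuousOn fun z hz ↦ hz.2)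
      ?_ ((contMDiffOn_iff_contDiffOn.1 (hfs.comp hsymm fun z hz ↦ hz.2)).of_le ENat.LEInfty.out) ?_ hxV ?_
    · intro z hz w hw
      have hinv := isInvertible_mfderiv_extChartAt (I := I) (x := x) (hWs _ hz.2)
      have hsp : ∀ t : TangentSpace I (φ.symm z), ⟪w, (mvfderiv I φ (φ.symm z) t : E)⟫_ℝ = 0 := by
        intro t
        have ht : t ∈ Submodule.span ℝ (Set.range fun i ↦ e i (φ.symm z)) :=
          hspan _ hz.2.1 Submodule.mem_top
        induction ht using Submodule.span_induction with
        | mem t ht => obtain ⟨i, rfl⟩ := ht; exact hw i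
        | zero => simp
        | add a c _ _ ha hc => rw [map_add, inner_add_right, ha, hc, add_zero]
        | smul r a _ ha => rw [map_smul, inner_smul_right, ha, mul_zero]
      obtain ⟨L, hL'⟩ := hinv
      have h1 := hsp (L.symm w)
      have h2 : (mvfderiv I φ (φ.symm z) (L.symm w) : E) = w := by
        change mfderiv I 𝓘(ℝ, E) φ (φ.symm z) (L.symm w) = w
        rw [← hL']
        exact L.apply_symm_apply w
      rw [h2] at h1
      exact inner_self_eq_zero.1 h1
    · intro z hz
      refine (hL _ hz.2.1).trans_eq (Finset.sum_congr rfl fun i _ ↦ ?_)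
      have h1 : (fun y ↦ fderiv ℝ (f ∘ φ.symm) y ((X i ∘ φ.symm) y)) =ᶠ[𝓝 z]
          (fun z ↦ mvfderiv I f z (e i z)) ∘ φ.symm := by
        filter_upwards [hVo.mem_nhds hz] with y hy
        exact hchain hfs y hy i
      rw [h1.fderiv_eq]
      simp only [Function.comp_apply]
      rw [hchain hfs z hz, ← hchain (hDf i) z hz]
    · intro z hz
      simp only [Function.comp_apply, φ.left_inv (hWs x hxW)]
      exact hmax _ hz.2.1
  have hcont : ContinuousAt φ x := continuousAt_extChartAt x
  filter_upwards [hcont.eventually hmain, hWo.mem_nhds hxW] with y hy hyW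
  simpa [φ.left_inv (hWs x hxW), φ.left_inv (hWs y hyW)] using hy

end MaximumPrinciple

/-- A continuous function on a compact space which is constant near each of its local maxima is
locally constant. -/
theorem IsLocallyConstant.of_forall_localMax {X : Type*} [TopologicalSpace X] [CompactSpace X]
    [LocallyConnectedSpace X] {f : X → ℝ} (hf : Continuous f)
    (h : ∀ x, (∀ᶠ y in 𝓝 x, f y ≤ f x) → ∀ᶠ y in 𝓝 x, f y = f x) : IsLocallyConstant f := by
  refine IsLocallyConstant.of_constant_on_preconnected_clopens fun C hC hcl a ha b hb ↦ ?_
  obtain ⟨m, hm, hmax⟩ := hcl.isClosed.isCompact.exists_isMaxOn ⟨a, ha⟩ hf.continuousOn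
  have hmax' : ∀ y ∈ C, f y ≤ f m := fun y hy ↦ hmax hy
  have hopen : IsOpen (C ∩ {y | f y = f m}) := by
    rw [isOpen_iff_mem_nhds]
    rintro y ⟨hy, hym⟩
    have h1 := h y (by
      filter_upwards [hcl.isOpen.mem_nhds hy] with z hz
      rw [hym]; exact hmax' z hz)
    filter_upwards [h1, hcl.isOpen.mem_nhds hy] with z hz hzC
    exact ⟨hzC, hz.trans hym⟩
  have hclosed : IsClosed (C ∩ {y | f y = f m}) :=
    hcl.isClosed.inter (isClosed_eq hf continuous_const)
  have hsub := hC.subset_isClopen ⟨hclosed, hopen⟩ ⟨m, hm, hm, rfl⟩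
  exact (hsub hb).2.trans (hsub ha).2.symm
end


noncomputable section

namespace FrameCalculus

variable {ι A : Type*} [Fintype ι] [CommRing A] [Algebra ℝ A] (F : FrameCalculus ι A)

theorem nablaOne_const_mul (c : ℝ) (θ : ι → A) (i j : ι) :
    F.nablaOne (fun k ↦ algebraMap ℝ A c * θ k) i j = algebraMap ℝ A c * F.nablaOne θ i j := by
  simp only [nablaOne, Derivation.leibniz, Derivation.map_algebraMap, smul_eq_mul, mul_zero,
    add_zero, mul_sub, Finset.mul_sum]
  congr 1
  exact Finset.sum_congr rfl fun p _ ↦ by ring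

theorem divOne_const_mul (c : ℝ) (θ : ι → A) :
    F.divOne (fun k ↦ algebraMap ℝ A c * θ k) = algebraMap ℝ A c * F.divOne θ := by
  simp only [divOne, nablaOne_const_mul, Finset.mul_sum]

end FrameCalculus

section LocallyConstant

variable {E : Type*} [NormedAddCommGroup E] [NormedSpace ℝ E] [FiniteDimensional ℝ E]
  {H : Type*} [TopologicalSpace H] {I : ModelWithCorners ℝ E H}
  {M : Type*} [TopologicalSpace M] [ChartedSpace H M] [IsManifold I ∞ M]

theorem IsLocallyConstant.mvfderiv_eq_zero {f : M → ℝ} (hf : IsLocallyConstant f) (x : M)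
    (v : TangentSpace I x) : mvfderiv I f x v = 0 := by
  rw [mvfderiv_congr (hf.eventually_eq x : f =ᶠ[𝓝 x] fun _ ↦ f x), mvfderiv_const]
  simp

end LocallyConstant

section LeeForm

set_option linter.unusedSectionVars false

variable {M : Type*} [TopologicalSpace M] [ChartedSpace (EuclideanSpace ℝ (Fin 8)) M]
  [IsManifold (𝓡 8) ∞ M] [RiemannianBundle (fun x : M ↦ TangentSpace (𝓡 8) x)]
  [IsContMDiffRiemannianBundle (𝓡 8) ∞ (EuclideanSpace ℝ (Fin 8))
    (fun x : M ↦ TangentSpace (𝓡 8) x)]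

namespace Spin7Structure.IsTorsionConnection

variable {S : Spin7Structure M} {e : Fin 8 → (y : M) → TangentSpace (𝓡 8) y} {U : Set M} {x : M}
  {cov : CovariantDerivative (𝓡 8) (EuclideanSpace ℝ (Fin 8)) (fun x : M ↦ TangentSpace (𝓡 8) x)}

theorem covDeriv_leeForm (hcov : S.IsTorsionConnection cov) (h : S.IsAdapted e U) (hx : x ∈ U)
    (i j : Fin 8) : 7 * covDeriv cov S.leeForm x ![e i x, e j x] =
      smoothRing.eval x ((hcov.calculus h).nablaOne (phiTrace (hcov.calculus h).tor) i j) := by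
  have h0 : h.frame.Components S.leeForm fun P ↦
      (fun k ↦ algebraMap ℝ _ (1 / 7) * phiTrace (hcov.calculus h).tor k) (P 0) :=
    hcov.components_leeForm h
  rw [IsOrthoFrame.Components.covDeriv_one (a := fun k ↦ algebraMap ℝ _ (1 / 7) *
      phiTrace (hcov.calculus h).tor k) h0 S.isTensorAt_leeForm (hcov.represents h) hx,
    FrameCalculus.nablaOne_const_mul, map_mul]
  rw [AlgHom.commutes, Algebra.algebraMap_self_apply]
  ring

theorem diffTensorAt_leeForm (hcov : S.IsTorsionConnection cov) (x : M) :
    DiffTensorAt S.leeForm x := by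
  obtain ⟨U, hx, e, h⟩ := S.exists_isAdapted x
  exact (hcov.components_leeForm h).diffTensorAt S.isTensorAt_leeForm hx

theorem codiff_leeForm (hcov : S.IsTorsionConnection cov) (h : S.IsAdapted e U) (hx : x ∈ U)
    (v : Fin 0 → TangentSpace (𝓡 8) x) : 7 * codiff S.leeForm x v =
      - smoothRing.eval x ((hcov.calculus h).divOne (phiTrace (hcov.calculus h).tor)) := by
  have h0 : h.frame.Components S.leeForm fun P ↦
      (fun k ↦ algebraMap ℝ _ (1 / 7) * phiTrace (hcov.calculus h).tor k) (P 0) :=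
    hcov.components_leeForm h
  rw [h.frame.codiff_apply hx (isTensorAt_covDeriv _ S.isTensorAt_leeForm
    (hcov.diffTensorAt_leeForm x)), Subsingleton.elim v ![]]
  have h1 : ∀ i, covDeriv (leviCivita (𝓡 8) M) S.leeForm x ![e i x, e i x] = _ := fun i ↦
    IsOrthoFrame.Components.covDeriv_one (a := fun k ↦ algebraMap ℝ _ (1 / 7) *
      phiTrace (hcov.calculus h).tor k) h0 S.isTensorAt_leeForm (hcov.represents_levi h) hx i i
  simp only [h1]
  rw [← map_sum]
  change 7 * - smoothRing.eval x (FrameCalculus.divOne _ _) = _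
  rw [FrameCalculus.levi_divOne, FrameCalculus.divOne_const_mul, map_mul]
  rw [AlgHom.commutes, Algebra.algebraMap_self_apply]
  ring

theorem isParallel_leeForm_of_forall (hcov : S.IsTorsionConnection cov) (h : S.IsAdapted e U)
    (hx : x ∈ U) (h0 : ∀ i j, smoothRing.eval x
      ((hcov.calculus h).nablaOne (phiTrace (hcov.calculus h).tor) i j) = 0)
    (v : Fin 2 → TangentSpace (𝓡 8) x) : covDeriv cov S.leeForm x v = 0 := by
  rw [h.frame.tensor_apply hx (isTensorAt_covDeriv _ S.isTensorAt_leeForm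
    (hcov.diffTensorAt_leeForm x))]
  refine Finset.sum_eq_zero fun P _ ↦ ?_
  have e1 : (fun m ↦ e (P m) x) = ![e (P 0) x, e (P 1) x] := by funext m; fin_cases m <;> rfl
  have e2 := hcov.covDeriv_leeForm h hx (P 0) (P 1)
  rw [h0] at e2
  rw [e1, (by linarith : covDeriv cov S.leeForm x ![e (P 0) x, e (P 1) x] = 0), mul_zero]

theorem ricci_frame (hcov : S.IsTorsionConnection cov) (hT : IsClosedThree (torsionTensor cov))
    (h : S.IsAdapted e U) (hx : x ∈ U) (j k : Fin 8) :
    6 * ricci cov x (e j x) (e k x) = - (7 * covDeriv cov S.leeForm x ![e j x, e k x]) := by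
  rw [(hcov.represents h).ricci_frame hx, hcov.covDeriv_leeForm h hx, ← map_neg,
    ← (hcov.phiParallel h).six_mul_ric (hcov.closed hT h), map_mul, map_ofNat]

/-- `∇` is Ricci flat if and only if the Lee form is parallel. -/
theorem ricci_eq_zero_iff (hcov : S.IsTorsionConnection cov)
    (hT : IsClosedThree (torsionTensor cov)) :
    (∀ x v w, ricci cov x v w = 0) ↔ IsParallel cov S.leeForm := by
  constructor
  · intro hR x v
    obtain ⟨U, hx, e, h⟩ := S.exists_isAdapted x
    refine hcov.isParallel_leeForm_of_forall h hx (fun i j ↦ ?_) v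
    have := hcov.ricci_frame hT h hx i j
    rw [hR] at this
    rw [← hcov.covDeriv_leeForm h hx]
    linarith
  · intro hP x v w
    obtain ⟨U, hx, e, h⟩ := S.exists_isAdapted x
    rw [(hcov.represents h).ricci_eq hx]
    refine Finset.sum_eq_zero fun j _ ↦ Finset.sum_eq_zero fun k _ ↦ ?_
    have := hcov.ricci_frame hT h hx j k
    rw [hP, (hcov.represents h).ricci_frame hx] at this
    rw [(by linarith : smoothRing.eval x ((hcov.calculus h).ric j k) = 0), mul_zero]

theorem scalarCurvature_eq (hcov : S.IsTorsionConnection cov)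
    (hT : IsClosedThree (torsionTensor cov)) (x : M) (v : Fin 0 → TangentSpace (𝓡 8) x) :
    6 * scalarCurvature cov x = 7 * codiff S.leeForm x v := by
  obtain ⟨U, hx, e, h⟩ := S.exists_isAdapted x
  rw [hcov.codiff_leeForm h hx, (hcov.represents h).scalarCurvature_eq hx, ← map_neg,
    ← map_ofNat (smoothRing.eval x (U := U) (I := 𝓡 8)) 6, ← map_mul, FrameCalculus.divOne,
    ← Finset.sum_neg_distrib, Finset.mul_sum]
  simp only [(hcov.phiParallel h).six_mul_ric (hcov.closed hT h)]

/-- The function `‖τ‖²`, where `τ = 7 θ`. -/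
def _root_.Spin7Structure.leeSq (S : Spin7Structure M)
    (cov : CovariantDerivative (𝓡 8) (EuclideanSpace ℝ (Fin 8)) (fun x : M ↦ TangentSpace (𝓡 8) x))
    (x : M) : ℝ := 6 * normSq (torsionTensor cov) x - 42 * codiff S.leeForm x ![]

theorem normSq_torsion (hcov : S.IsTorsionConnection cov) (h : S.IsAdapted e U) (hx : x ∈ U) :
    normSq (torsionTensor cov) x = smoothRing.eval x (∑ i, ∑ j, ∑ k,
      (hcov.calculus h).tor i j k * (hcov.calculus h).tor i j k) :=
  (hcov.components_torsion h).normSq_three (isTensorAt_torsionTensor cov x) hx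

theorem eval_sum_phiTrace_sq (hcov : S.IsTorsionConnection cov)
    (hT : IsClosedThree (torsionTensor cov)) (h : S.IsAdapted e U) (hx : x ∈ U) :
    smoothRing.eval x (∑ a, phiTrace (hcov.calculus h).tor a * phiTrace (hcov.calculus h).tor a) =
      S.leeSq cov x := by
  have e1 := hcov.codiff_leeForm h hx ![]
  rw [(hcov.phiParallel h).sum_phiTrace_sq (hcov.closed hT h), leeSq, map_add, map_mul, map_mul,
    map_ofNat, hcov.normSq_torsion h hx]
  linarith

theorem scalarCurvature_leviCivita_eq (hcov : S.IsTorsionConnection cov)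
    (hT : IsClosedThree (torsionTensor cov)) (x : M) :
    24 * scalarCurvature (leviCivita (𝓡 8) M) x = S.leeSq cov x + 70 * codiff S.leeForm x ![] := by
  obtain ⟨U, hx, e, h⟩ := S.exists_isAdapted x
  have e1 := congrArg (smoothRing.eval x) ((hcov.phiParallel h).levi_scal (hcov.closed hT h))
  have e2 := hcov.codiff_leeForm h hx ![]
  rw [map_sub, map_mul, map_mul, map_ofNat, map_ofNat, hcov.eval_sum_phiTrace_sq hT h hx,
    ← (hcov.represents_levi h).scalarCurvature_eq hx] at e1
  linarith

theorem codiff_torsion_frame (hcov : S.IsTorsionConnection cov)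
    (hT : IsClosedThree (torsionTensor cov)) (h : S.IsAdapted e U) (hx : x ∈ U) (j k : Fin 8) :
    codiff (torsionTensor cov) x ![e j x, e k x] =
      ricci cov x (e k x) (e j x) - ricci cov x (e j x) (e k x) := by
  have hc := hcov.components_torsion h
  rw [h.frame.codiff_apply hx (isTensorAt_covDeriv _ (isTensorAt_torsionTensor cov)
    (hc.diffTensorAt (isTensorAt_torsionTensor cov) hx))]
  have h1 : ∀ i, covDeriv (leviCivita (𝓡 8) M) (torsionTensor cov) x
      ![e i x, e i x, e j x, e k x] = _ := fun i ↦
    hc.covDeriv_three (isTensorAt_torsionTensor cov) (hcov.represents_levi h) hx i i j k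
  simp only [h1]
  rw [← map_sum, FrameCalculus.sum_levi_nablaThree_tor, FrameCalculus.divTor,
    ← FrameCalculus.ric_sub_ric (hcov.closed hT h), map_sub,
    (hcov.represents h).ricci_frame hx, (hcov.represents h).ricci_frame hx]
  ring

/-- The torsion is coclosed if `∇` is Ricci flat. -/
theorem isCoclosed_torsion (hcov : S.IsTorsionConnection cov)
    (hT : IsClosedThree (torsionTensor cov)) (hR : ∀ x v w, ricci cov x v w = 0) :
    IsCoclosed (torsionTensor cov) := by
  intro x v
  obtain ⟨U, hx, e, h⟩ := S.exists_isAdapted x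
  rw [h.frame.tensor_apply hx (IsOrthoFrame.isTensorAt_codiff (isTensorAt_covDeriv _
    (isTensorAt_torsionTensor cov) ((hcov.components_torsion h).diffTensorAt
      (isTensorAt_torsionTensor cov) hx)))]
  refine Finset.sum_eq_zero fun P _ ↦ ?_
  have e1 : (fun m ↦ e (P m) x) = ![e (P 0) x, e (P 1) x] := by funext m; fin_cases m <;> rfl
  rw [e1, hcov.codiff_torsion_frame hT h hx, hR, hR, sub_zero, mul_zero]

end Spin7Structure.IsTorsionConnection
end LeeForm
end


noncomputable section

section Bochner

set_option linter.unusedSectionVars false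

variable {M : Type*} [TopologicalSpace M] [ChartedSpace (EuclideanSpace ℝ (Fin 8)) M]
  [IsManifold (𝓡 8) ∞ M] [RiemannianBundle (fun x : M ↦ TangentSpace (𝓡 8) x)]
  [IsContMDiffRiemannianBundle (𝓡 8) ∞ (EuclideanSpace ℝ (Fin 8))
    (fun x : M ↦ TangentSpace (𝓡 8) x)]

namespace Spin7Structure.IsTorsionConnection

variable {S : Spin7Structure M} {e : Fin 8 → (y : M) → TangentSpace (𝓡 8) y} {U : Set M} {x : M}
  {cov : CovariantDerivative (𝓡 8) (EuclideanSpace ℝ (Fin 8)) (fun x : M ↦ TangentSpace (𝓡 8) x)}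

theorem contMDiffOn_leeSq (hcov : S.IsTorsionConnection cov)
    (hT : IsClosedThree (torsionTensor cov)) (h : S.IsAdapted e U) :
    ContMDiffOn (𝓡 8) 𝓘(ℝ) ∞ (S.leeSq cov) U :=
  ContMDiffOn.congr (∑ a, phiTrace (hcov.calculus h).tor a * phiTrace (hcov.calculus h).tor a).2
    fun _ hy ↦ (hcov.eval_sum_phiTrace_sq hT h hy).symm

theorem continuous_leeSq (hcov : S.IsTorsionConnection cov)
    (hT : IsClosedThree (torsionTensor cov)) : Continuous (S.leeSq cov) := by
  refine continuous_iff_continuousAt.2 fun x ↦ ?_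
  obtain ⟨U, hx, e, h⟩ := S.exists_isAdapted x
  exact (hcov.contMDiffOn_leeSq hT h).continuousOn.continuousAt (h.frame.isOpen.mem_nhds hx)

/-- The first-order coefficients in the equation for `‖τ‖²`. -/
def drift (hcov : S.IsTorsionConnection cov) (h : S.IsAdapted e U) (κ : ℝ) (p : Fin 8) :
    smoothRing (𝓡 8) U :=
  - (∑ i, (hcov.calculus h).conn i i p)
    - algebraMap ℝ _ (2 * κ - 1 / 6) * phiTrace (hcov.calculus h).tor p

/-- The Bochner formula for `‖τ‖²` if `div τ - κ ‖τ‖²` is locally constant. -/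
theorem sum_mvfderiv_leeSq (hcov : S.IsTorsionConnection cov)
    (hT : IsClosedThree (torsionTensor cov)) {κ : ℝ}
    (hκ : IsLocallyConstant fun x ↦ 7 * codiff S.leeForm x ![] + κ * S.leeSq cov x)
    (h : S.IsAdapted e U) (hx : x ∈ U) :
    ∑ i, (mvfderiv (𝓡 8) (fun z ↦ mvfderiv (𝓡 8) (S.leeSq cov) z (e i z)) x (e i x)
      + smoothRing.eval x (hcov.drift h κ i) * mvfderiv (𝓡 8) (S.leeSq cov) x (e i x)) =
    2 * ∑ i, ∑ p, smoothRing.eval x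
      ((hcov.calculus h).nablaOne (phiTrace (hcov.calculus h).tor) i p) ^ 2 := by
  have hr := hcov.represents h
  have hwu : ∀ y ∈ U, smoothRing.eval y (∑ a, phiTrace (hcov.calculus h).tor a *
      phiTrace (hcov.calculus h).tor a) = S.leeSq cov y := fun y hy ↦
    hcov.eval_sum_phiTrace_sq hT h hy
  have hdiv : ∀ y ∈ U, 7 * codiff S.leeForm y ![] = - smoothRing.eval y
      ((hcov.calculus h).divOne (phiTrace (hcov.calculus h).tor)) := fun y hy ↦
    hcov.codiff_leeForm h hy ![]
  have e4 := congrArg (smoothRing.eval x) (FrameCalculus.Closed.bochner (hcov.closed hT h)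
    ((hcov.phiParallel h).six_mul_ric (hcov.closed hT h)))
  have e5 : ∀ i, smoothRing.eval x (hcov.drift h κ i) =
      - (∑ j, smoothRing.eval x ((hcov.calculus h).conn j j i))
      - (2 * κ - 1 / 6) * smoothRing.eval x (phiTrace (hcov.calculus h).tor i) := fun i ↦ by
    simp only [drift, map_sub, map_neg, map_sum, map_mul, AlgHom.commutes,
      Algebra.algebraMap_self_apply]
  generalize hcov.calculus h = F at *
  generalize phiTrace F.tor = τ at *
  generalize hw : ∑ p, τ p * τ p = w at *
  have e1 : ∀ i, ∀ y ∈ U, smoothRing.eval y (F.D i w) =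
      mvfderiv (𝓡 8) (S.leeSq cov) y (e i y) := fun i y hy ↦ hr.eval_D_of_eqOn hy i hwu
  have e2 : ∀ i, smoothRing.eval x (F.D i (F.D i w)) =
      mvfderiv (𝓡 8) (fun z ↦ mvfderiv (𝓡 8) (S.leeSq cov) z (e i z)) x (e i x) := fun i ↦
    hr.eval_D_of_eqOn hx i (e1 i)
  have e3 : ∀ p, smoothRing.eval x (F.D p (F.divOne τ)) = κ * smoothRing.eval x (F.D p w) := by
    intro p
    have h1 : smoothRing.eval x (F.D p (- F.divOne τ + algebraMap ℝ _ κ * w)) = 0 := by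
      rw [hr.eval_D_of_eqOn hx p (g := fun x ↦ 7 * codiff S.leeForm x ![] + κ * S.leeSq cov x),
        hκ.mvfderiv_eq_zero]
      intro y hy
      rw [map_add, map_mul, map_neg, AlgHom.commutes, Algebra.algebraMap_self_apply, hwu y hy,
        hdiv y hy]
    rw [map_add, map_neg, Derivation.leibniz, Derivation.map_algebraMap, smul_eq_mul, smul_eq_mul,
      mul_zero, add_zero, map_add, map_neg, map_mul, AlgHom.commutes,
      Algebra.algebraMap_self_apply] at h1
    linarith
  rw [Finset.sum_comm (f := fun i p ↦ F.conn i i p * F.D p w)] at e4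
  simp only [map_sub, map_add, map_mul, map_sum, map_ofNat, e3] at e4
  simp only [← e1 _ x hx, ← e2, e5, pow_two, Finset.sum_add_distrib, sub_mul, neg_mul,
    Finset.sum_sub_distrib, Finset.sum_neg_distrib, Finset.sum_mul, mul_assoc, ← Finset.mul_sum]
  have e6 : ∑ p, smoothRing.eval x (τ p) * (κ * smoothRing.eval x (F.D p w)) =
      κ * ∑ p, smoothRing.eval x (τ p) * smoothRing.eval x (F.D p w) := by
    rw [Finset.mul_sum]
    exact Finset.sum_congr rfl fun p _ ↦ by ring
  rw [e6] at e4
  linarith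

theorem isLocallyConstant_leeSq [CompactSpace M] (hcov : S.IsTorsionConnection cov)
    (hT : IsClosedThree (torsionTensor cov)) {κ : ℝ}
    (hκ : IsLocallyConstant fun x ↦ 7 * codiff S.leeForm x ![] + κ * S.leeSq cov x) :
    IsLocallyConstant (S.leeSq cov) := by
  have : LocallyConnectedSpace M :=
    ChartedSpace.locallyConnectedSpace (EuclideanSpace ℝ (Fin 8)) M
  refine IsLocallyConstant.of_forall_localMax (hcov.continuous_leeSq hT) fun x hmax ↦ ?_
  obtain ⟨U, hx, e, h⟩ := S.exists_isAdapted x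
  obtain ⟨W, hW, hWo, hxW⟩ := mem_nhds_iff.1 hmax
  refine eventually_eq_of_frame_operator_nonneg (e := e) (I := 𝓡 8) (h.frame.isOpen.inter hWo)
    (fun i ↦ (h.frame.smooth i).mono Set.inter_subset_left) (fun y hy ↦ h.frame.span y hy.1)
    ⟨hx, hxW⟩ ((hcov.contMDiffOn_leeSq hT h).mono Set.inter_subset_left)
    (b := fun i ↦ (hcov.drift h κ i : M → ℝ))
    (fun i ↦ (ContMDiffOn.continuousOn (hcov.drift h κ i).2).mono Set.inter_subset_left)
    (fun y hy ↦ ?_) fun y hy ↦ hW hy.2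
  refine le_of_le_of_eq ?_ (hcov.sum_mvfderiv_leeSq hT hκ h hy.1).symm
  positivity

/-- If `div τ - κ ‖τ‖²` is locally constant, then the Lee form is parallel. -/
theorem isParallel_leeForm [CompactSpace M] (hcov : S.IsTorsionConnection cov)
    (hT : IsClosedThree (torsionTensor cov)) {κ : ℝ}
    (hκ : IsLocallyConstant fun x ↦ 7 * codiff S.leeForm x ![] + κ * S.leeSq cov x) :
    IsParallel cov S.leeForm := by
  have hu := hcov.isLocallyConstant_leeSq hT hκ
  intro x v
  obtain ⟨U, hx, e, h⟩ := S.exists_isAdapted x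
  refine hcov.isParallel_leeForm_of_forall h hx (fun i j ↦ ?_) v
  have h1 := hcov.sum_mvfderiv_leeSq hT hκ h hx
  simp only [hu.mvfderiv_eq_zero, mvfderiv_const, mul_zero, zero_apply,
    add_zero, Finset.sum_const_zero] at h1
  have h3 := (Finset.sum_eq_zero_iff_of_nonneg (fun i _ ↦ Finset.sum_nonneg fun p _ ↦
    sq_nonneg _)).1 ((mul_eq_zero.1 h1.symm).resolve_left two_ne_zero) i (Finset.mem_univ _)
  exact pow_eq_zero_iff two_ne_zero |>.1 ((Finset.sum_eq_zero_iff_of_nonneg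
    (fun p _ ↦ sq_nonneg _)).1 h3 j (Finset.mem_univ _))

theorem codiff_leeForm_eq_zero (hcov : S.IsTorsionConnection cov)
    (hP : IsParallel cov S.leeForm) : IsCoclosed S.leeForm := by
  intro x v
  obtain ⟨U, hx, e, h⟩ := S.exists_isAdapted x
  have h1 := hcov.codiff_leeForm h hx v
  rw [FrameCalculus.divOne, map_sum, Finset.sum_eq_zero] at h1
  · linarith
  · intro i _
    rw [← hcov.covDeriv_leeForm h hx, hP, mul_zero]

end Spin7Structure.IsTorsionConnection
end Bochner

section Main

variable {M : Type*} [TopologicalSpace M] [CompactSpace M]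
    [ChartedSpace (EuclideanSpace ℝ (Fin 8)) M] [IsManifold (𝓡 8) ∞ M]
    [RiemannianBundle (fun x : M ↦ TangentSpace (𝓡 8) x)]
    [IsContMDiffRiemannianBundle (𝓡 8) ∞ (EuclideanSpace ℝ (Fin 8))
      (fun x : M ↦ TangentSpace (𝓡 8) x)]

/-- The equivalences for any connection with the properties of the torsion connection. -/
theorem Spin7Structure.IsTorsionConnection.tfae {S : Spin7Structure M}
    {cov : CovariantDerivative (𝓡 8) (EuclideanSpace ℝ (Fin 8)) (fun x : M ↦ TangentSpace (𝓡 8) x)}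
    (hcov : S.IsTorsionConnection cov) (hT : IsClosedThree (torsionTensor cov)) :
    List.TFAE
      [∀ x v w, ricci cov x v w = 0,
        IsLocallyConstant (normSq (torsionTensor cov)),
        IsParallel cov S.leeForm,
        ∀ x, scalarCurvature cov x = 0,
        IsLocallyConstant (scalarCurvature (leviCivita (𝓡 8) M)),
        IsCoclosed S.leeForm] := by
  tfae_have 1 ↔ 3 := hcov.ricci_eq_zero_iff hT
  tfae_have 3 → 6 := hcov.codiff_leeForm_eq_zero
  tfae_have 4 ↔ 6 := by
    constructor
    · intro h x v
      have := hcov.scalarCurvature_eq hT x v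
      rw [h] at this
      linarith
    · intro h x
      have := hcov.scalarCurvature_eq hT x ![]
      rw [h] at this
      linarith
  have hκ : IsCoclosed S.leeForm →
      IsLocallyConstant fun x ↦ 7 * codiff S.leeForm x ![] + 0 * S.leeSq cov x := fun h ↦ by
    have h1 : (fun x ↦ 7 * codiff S.leeForm x ![] + 0 * S.leeSq cov x) = fun _ : M ↦ (0 : ℝ) := by
      funext x
      rw [h, mul_zero, zero_mul, add_zero]
    rw [h1]
    exact IsLocallyConstant.const 0
  have hu : IsCoclosed S.leeForm →
      IsLocallyConstant (S.leeSq cov) := fun h ↦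
    hcov.isLocallyConstant_leeSq hT (hκ h)
  tfae_have 6 → 3 := fun h ↦ hcov.isParallel_leeForm hT (hκ h)
  tfae_have 6 → 2 := fun h ↦ by
    have h1 : normSq (torsionTensor cov) = fun x ↦ S.leeSq cov x / 6 := by
      funext x
      rw [leeSq, h]
      ring
    rw [h1]
    exact (hu h).comp (· / 6)
  tfae_have 6 → 5 := fun h ↦ by
    have h1 : scalarCurvature (leviCivita (𝓡 8) M) = fun x ↦ S.leeSq cov x / 24 := by
      funext x
      have := hcov.scalarCurvature_leviCivita_eq hT x
      rw [h] at this
      linarith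
    rw [h1]
    exact (hu h).comp (· / 24)
  tfae_have 2 → 3 := fun h ↦ hcov.isParallel_leeForm hT (κ := 1 / 6) (by
    have h1 : (fun x ↦ 7 * codiff S.leeForm x ![] + 1 / 6 * S.leeSq cov x) =
        normSq (torsionTensor cov) := by
      funext x
      rw [leeSq]
      ring
    rwa [h1])
  tfae_have 5 → 3 := fun h ↦ hcov.isParallel_leeForm hT (κ := 1 / 10) (by
    have h1 : (fun x ↦ 7 * codiff S.leeForm x ![] + 1 / 10 * S.leeSq cov x) =
        fun x ↦ 12 / 5 * scalarCurvature (leviCivita (𝓡 8) M) x := by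
      funext x
      have := hcov.scalarCurvature_leviCivita_eq hT x
      linarith
    rw [h1]
    exact h.comp (12 / 5 * ·))
  tfae_finish
end Main
end


noncomputable section

section HomBundle

set_option linter.unusedSectionVars false

variable {E : Type*} [NormedAddCommGroup E] [NormedSpace ℝ E] [FiniteDimensional ℝ E]
  {H : Type*} [TopologicalSpace H] {I : ModelWithCorners ℝ E H}
  {M : Type*} [TopologicalSpace M] [ChartedSpace H M]

theorem contMDiffAt_clm_of_apply {F : Type*} [NormedAddCommGroup F] [NormedSpace ℝ F]
    {f : M → E →L[ℝ] F} {x : M} (h : ∀ w, ContMDiffAt I 𝓘(ℝ, F) ∞ (fun y ↦ f y w) x) :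
    ContMDiffAt I 𝓘(ℝ, E →L[ℝ] F) ∞ f x := by
  set b := Module.finBasis ℝ E with hb
  have h1 : f = fun y ↦ ∑ i, ContinuousLinearMap.smulRightL ℝ E F
      (LinearMap.toContinuousLinearMap (b.coord i)) (f y (b i)) := by
    funext y
    ext w
    conv_lhs => rw [← b.sum_repr w, map_sum]
    simp
  rw [h1]
  refine ContMDiffAt.sum fun i _ ↦ ?_
  exact (ContinuousLinearMap.contMDiff (n := ∞) (ContinuousLinearMap.smulRightL ℝ E F
    (LinearMap.toContinuousLinearMap (b.coord i)))).contMDiffAt.comp x (h (b i))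

variable [IsManifold I ∞ M]

/-- A field of endomorphisms is smooth if it sends smooth vector fields to smooth vector fields. -/
theorem contMDiffAt_hom_of_apply {φ : Π y : M, TangentSpace I y →L[ℝ] TangentSpace I y} {x : M}
    (h : ∀ W : Π y : M, TangentSpace I y, ContMDiffAt I I.tangent ∞ (T% W) x →
      ContMDiffAt I I.tangent ∞ (T% (fun y ↦ φ y (W y))) x) :
    ContMDiffAt I (I.prod 𝓘(ℝ, E →L[ℝ] E)) ∞
      (fun y ↦ (⟨y, φ y⟩ : TotalSpace (E →L[ℝ] E)
        fun y : M ↦ TangentSpace I y →L[ℝ] TangentSpace I y)) x := by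
  rw [contMDiffAt_hom_bundle]
  refine ⟨contMDiffAt_id, contMDiffAt_clm_of_apply fun w ↦ ?_⟩
  set t := trivializationAt E (TangentSpace I : M → Type _) x with ht
  have hx : x ∈ t.baseSet := FiberBundle.mem_baseSet_trivializationAt' x
  have h1 := h (extend E (t.symm x w)) (contMDiffAt_extend ..)
  rw [contMDiffAt_section] at h1
  refine h1.congr_of_eventuallyEq ?_
  filter_upwards [t.open_baseSet.mem_nhds hx] with y hy
  simp only [ContinuousLinearMap.inCoordinates, ContinuousLinearMap.comp_apply]
  rw [Trivialization.continuousLinearMapAt_apply_of_mem _ _ hy]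
  congr 3
  rw [Trivialization.symmL_apply _ hy]
  simp [extend, ← ht, hx]

variable [RiemannianBundle (fun x : M ↦ TangentSpace I x)]
  [IsContMDiffRiemannianBundle I ∞ E (fun x : M ↦ TangentSpace I x)]
  {ι : Type*} [Fintype ι] {U : Set M} {e : ι → Π y : M, TangentSpace I y} {x : M}

theorem IsOrthoFrame.contMDiffAt_cov (h : IsOrthoFrame e U)
    {cov : CovariantDerivative I E (fun x : M ↦ TangentSpace I x)} (hx : x ∈ U)
    (hs : ∀ i j k, ContMDiffOn I 𝓘(ℝ) ∞ (h.conn cov i j k) U) {σ : Π y : M, TangentSpace I y}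
    (hσ : ContMDiffOn I I.tangent ∞ (T% σ) U) :
    ContMDiffAt I (I.prod 𝓘(ℝ, E →L[ℝ] E)) ∞
      (fun y ↦ (⟨y, cov σ y⟩ : TotalSpace (E →L[ℝ] E)
        fun y : M ↦ TangentSpace I y →L[ℝ] TangentSpace I y)) x := by
  refine contMDiffAt_hom_of_apply fun W hW ↦ ?_
  have hU : U ∈ 𝓝 x := h.isOpen.mem_nhds hx
  have hin : ∀ l, ContMDiffOn I 𝓘(ℝ) ∞ (fun z ↦ ⟪σ z, e l z⟫_ℝ) U := fun l ↦
    contMDiffOn_inner hσ (h.smooth l)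
  have hWin : ∀ l, ContMDiffAt I 𝓘(ℝ) ∞ (fun z ↦ ⟪W z, e l z⟫_ℝ) x := fun l ↦
    ContMDiffAt.inner_bundle (F := E) (E := fun x : M ↦ TangentSpace I x) (b := fun y ↦ y) hW
      ((h.smooth l).contMDiffAt hU)
  have hD : ∀ j l, ContMDiffAt I 𝓘(ℝ) ∞ (fun y ↦ mvfderiv I (fun z ↦ ⟪σ z, e l z⟫_ℝ) y (e j y)) x :=
    fun j l ↦ (contMDiffOn_mvfderiv_apply h.isOpen (hin l) (h.smooth j)).contMDiffAt hU
  have hc : ∀ l, ContMDiffAt I 𝓘(ℝ) ∞ (fun y ↦ ∑ j, ⟪W y, e j y⟫_ℝ *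
      (mvfderiv I (fun z ↦ ⟪σ z, e l z⟫_ℝ) y (e j y)
        + ∑ p, ⟪σ y, e p y⟫_ℝ * h.conn cov j p l y)) x := fun l ↦
    ContMDiffAt.sum fun j _ ↦ (hWin j).mul ((hD j l).add (ContMDiffAt.sum fun p _ ↦
      ((hin p).contMDiffAt hU).mul ((hs j p l).contMDiffAt hU)))
  have h1 : ContMDiffAt I I.tangent ∞ (T% (fun y ↦ ∑ l, (∑ j, ⟪W y, e j y⟫_ℝ *
      (mvfderiv I (fun z ↦ ⟪σ z, e l z⟫_ℝ) y (e j y)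
        + ∑ p, ⟪σ y, e p y⟫_ℝ * h.conn cov j p l y)) • e l y)) x :=
    ContMDiffAt.sum_section fun l _ ↦ (hc l).smul_section ((h.smooth l).contMDiffAt hU)
  refine h1.congr_of_eventuallyEq ?_
  filter_upwards [hU] with y hy
  congr 1
  rw [← h.sum_inner_smul hy (cov σ y (W y))]
  refine Finset.sum_congr rfl fun l _ ↦ ?_
  rw [h.inner_cov_eq_sum cov hy (mdiffAt_of_contMDiffOn h.isOpen hσ hy)]

end HomBundle
end


noncomputable section

section SkewMaps

variable {V : Type*} [AddCommGroup V] [Module ℝ V]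

/-- A 3-linear map which is skew-symmetric in neighbouring arguments is skew-symmetric. -/
theorem MultilinearMap.apply_perm_of_skew (A : MultilinearMap ℝ (fun _ : Fin 3 ↦ V) ℝ)
    (h₁ : ∀ a b c, A ![a, b, c] = - A ![b, a, c]) (h₂ : ∀ a b c, A ![a, b, c] = - A ![a, c, b])
    (v : Fin 3 → V) (σ : Equiv.Perm (Fin 3)) :
    A (v ∘ σ) = ((Equiv.Perm.sign σ : ℤ) : ℝ) * A v := by
  have z₁ : ∀ a c, A ![a, a, c] = 0 := fun a c ↦ by linarith [h₁ a a c]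
  have z₂ : ∀ a c, A ![a, c, c] = 0 := fun a c ↦ by linarith [h₂ a c c]
  have z₃ : ∀ a c, A ![a, c, a] = 0 := fun a c ↦ by rw [h₂, z₁, neg_zero]
  let B : V [⋀^Fin 3]→ₗ[ℝ] ℝ :=
    { A with
      map_eq_zero_of_eq' := by
        intro v i j hv hij
        have e : v = ![v 0, v 1, v 2] := by funext m; fin_cases m <;> rfl
        change A v = 0
        rw [e]
        fin_cases i <;> fin_cases j <;> first
          | exact absurd rfl hij
          | (have hv' : v 0 = v 1 := hv; rw [hv']; exact z₁ _ _)
          | (have hv' : v 1 = v 0 := hv; rw [hv']; exact z₁ _ _)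
          | (have hv' : v 1 = v 2 := hv; rw [hv']; exact z₂ _ _)
          | (have hv' : v 2 = v 1 := hv; rw [hv']; exact z₂ _ _)
          | (have hv' : v 0 = v 2 := hv; rw [hv']; exact z₃ _ _)
          | (have hv' : v 2 = v 0 := hv; rw [hv']; exact z₃ _ _) }
  have h := B.map_perm v σ
  change A (v ∘ σ) = _ at h
  rw [h, Units.smul_def, zsmul_eq_mul]
  rfl

end SkewMaps

section Existence

set_option linter.unusedSectionVars false

variable {M : Type*} [TopologicalSpace M] [ChartedSpace (EuclideanSpace ℝ (Fin 8)) M]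
  [IsManifold (𝓡 8) ∞ M] [RiemannianBundle (fun x : M ↦ TangentSpace (𝓡 8) x)]
  [IsContMDiffRiemannianBundle (𝓡 8) ∞ (EuclideanSpace ℝ (Fin 8))
    (fun x : M ↦ TangentSpace (𝓡 8) x)]

namespace Spin7Structure

variable {S : Spin7Structure M} {e : Fin 8 → (y : M) → TangentSpace (𝓡 8) y} {U : Set M} {x : M}

theorem IsAdapted.torsionComp_spec (h : S.IsAdapted e U) (hx : x ∈ U) :
    (∀ i j k, smoothRing.eval x (h.torsionComp i j k) = - smoothRing.eval x (h.torsionComp j i k)) ∧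
    (∀ i j k, smoothRing.eval x (h.torsionComp i j k) = - smoothRing.eval x (h.torsionComp i k j)) ∧
    ∀ i a b c d, actFour (fun j k ↦ h.frame.conn (leviCivita (𝓡 8) M) i j k x
      + 1 / 2 * smoothRing.eval x (h.torsionComp i j k)) (phiCast ℝ) a b c d = 0 := by
  have hskew := h.frame.conn_leviCivita_skew hx
  obtain ⟨T, h₁, h₂, hT⟩ := exists_skew_eigen
    (fun i j k ↦ h.frame.conn (leviCivita (𝓡 8) M) i j k x) hskew
  have h₁' : ∀ i j k, - 2 * T i j k = - (- 2 * T j i k) := fun i j k ↦ by rw [h₁]; ring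
  have h₂' : ∀ i j k, - 2 * T i j k = - (- 2 * T i k j) := fun i j k ↦ by rw [h₂]; ring
  have hact : ∀ i a b c d, actFour (fun j k ↦ h.frame.conn (leviCivita (𝓡 8) M) i j k x
      + 1 / 2 * (- 2 * T i j k)) (phiCast ℝ) a b c d = 0 := by
    intro i
    have e1 : (fun j k ↦ h.frame.conn (leviCivita (𝓡 8) M) i j k x + 1 / 2 * (- 2 * T i j k)) =
        fun j k ↦ h.frame.conn (leviCivita (𝓡 8) M) i j k x - T i j k := by
      funext j k; ring
    rw [e1]
    refine actFour_eq_zero_of_sum_phi_mul (fun j k ↦ ?_) (hT i)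
    rw [hskew, h₂]
    ring
  have heq := h.eq_torsionComp hx (T := fun i j k ↦ - 2 * T i j k) h₁' h₂' hact
  simp only [← heq]
  exact ⟨h₁', h₂', hact⟩

/-- The torsion 3-form `δΦ + (7/6) ∑ θ(b_a) Φ(b_a, ·, ·, ·)`. -/
def leeTorsion (S : Spin7Structure M) : TensorField (𝓡 8) M 3 := fun x v ↦
  codiff S.fundamentalForm x v + 7 / 6 * ∑ a, S.leeForm x ![orthoBasis (𝓡 8) x a] *
    (S.form x).toMultilinearMap.curryLeft (orthoBasis (𝓡 8) x a) v

theorem isTensorAt_leeTorsion (S : Spin7Structure M) (x : M) : IsTensorAt S.leeTorsion x := by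
  obtain ⟨A, hA⟩ := S.isTensorAt_codiff_fundamentalForm x
  refine ⟨A + (7 / 6 : ℝ) • ∑ a, S.leeForm x ![orthoBasis (𝓡 8) x a] •
    (S.form x).toMultilinearMap.curryLeft (orthoBasis (𝓡 8) x a), fun v ↦ ?_⟩
  simp only [leeTorsion, hA, add_apply, smul_apply,
    sum_apply, smul_eq_mul]

theorem IsAdapted.components_leeTorsion (h : S.IsAdapted e U) :
    h.frame.Components S.leeTorsion fun P ↦ h.torsionComp (P 0) (P 1) (P 2) := by
  intro y hy P
  obtain ⟨A, hA⟩ := S.isTensorAt_leeForm y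
  have hl : ∀ w, IsLinearMap ℝ fun v ↦ S.leeForm y ![v] * w := fun w ↦
    ⟨fun a b ↦ by
      simp only [hA]
      rw [← add_mul]
      exact congrArg (· * w) (A.cons_add ![] a b),
    fun c a ↦ by
      simp only [hA]
      rw [← smul_mul_assoc]
      exact congrArg (· * w) (A.cons_smul ![] c a)⟩
  have h1 := (orthoBasis (𝓡 8) y).sum_apply_apply (h.frame.basisAt hy)
    (f := fun a b ↦ S.leeForm y ![a] * (S.form y).toMultilinearMap.curryLeft b
      fun m ↦ e (P m) y)
    (fun w ↦ hl _)
    (fun v ↦ ⟨fun a b ↦ by rw [map_add, add_apply, mul_add],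
      fun c a ↦ by rw [map_smul, smul_apply, smul_eq_mul, smul_eq_mul]; ring⟩)
  rw [leeTorsion, h1, h.components_codiff y hy]
  simp only [torsionComp, map_add, map_mul, map_sum, map_intCast, AlgHom.commutes,
    Algebra.algebraMap_self_apply, h.frame.basisAt_apply, h.leeForm_apply hy]
  congr 1
  rw [Finset.mul_sum, Finset.mul_sum]
  refine Finset.sum_congr rfl fun a _ ↦ ?_
  have h2 : (S.form y).toMultilinearMap.curryLeft (e a y) (fun m ↦ e (P m) y) =
      phi a (P 0) (P 1) (P 2) := by
    refine Eq.trans ?_ (h.form_apply y hy ![a, P 0, P 1, P 2])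
    rw [MultilinearMap.curryLeft_apply]
    change S.form y _ = S.form y _
    congr 1
    funext m; fin_cases m <;> rfl
  rw [h2]
  ring

theorem exists_oneForm (S : Spin7Structure M) (x : M) :
    ∃ B : TangentSpace (𝓡 8) x →L[ℝ] TangentSpace (𝓡 8) x →L[ℝ] TangentSpace (𝓡 8) x,
      ∀ u v w, ⟪B v u, w⟫_ℝ = 1 / 2 * S.leeTorsion x ![u, v, w] := by
  obtain ⟨A, hA⟩ := S.isTensorAt_leeTorsion x
  set b := orthoBasis (𝓡 8) x with hb
  let B := LinearMap.mk₂ ℝ (fun v u ↦ (1 / 2 : ℝ) • ∑ k, A ![u, v, b k] • b k)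
    (fun v v' u ↦ by
      rw [← smul_add, ← Finset.sum_add_distrib]
      congr 1
      refine Finset.sum_congr rfl fun k _ ↦ ?_
      rw [← add_smul]
      congr 1
      exact (A.curryLeft u).cons_add _ v v')
    (fun c v u ↦ by
      refine (congrArg (fun t ↦ (1 / 2 : ℝ) • t) (?_ : _ = c • ∑ k, A ![u, v, b k] • b k)).trans
        (smul_comm _ _ _)
      rw [Finset.smul_sum]
      refine Finset.sum_congr rfl fun k _ ↦ ?_
      rw [smul_smul]
      congr 1
      exact (A.curryLeft u).cons_smul _ c v)
    (fun v u u' ↦ by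
      rw [← smul_add, ← Finset.sum_add_distrib]
      congr 1
      refine Finset.sum_congr rfl fun k _ ↦ ?_
      rw [← add_smul]
      congr 1
      exact A.cons_add _ u u')
    (fun c v u ↦ by
      refine (congrArg (fun t ↦ (1 / 2 : ℝ) • t) (?_ : _ = c • ∑ k, A ![u, v, b k] • b k)).trans
        (smul_comm _ _ _)
      rw [Finset.smul_sum]
      refine Finset.sum_congr rfl fun k _ ↦ ?_
      rw [smul_smul]
      congr 1
      exact A.cons_smul _ c u)
  refine ⟨B.toContinuousBilinearMap, fun u v w ↦ ?_⟩
  change ⟪(1 / 2 : ℝ) • ∑ k, A ![u, v, b k] • b k, w⟫_ℝ = _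
  rw [inner_smul_left, sum_inner, hA]
  simp only [inner_smul_left, conj_trivial]
  congr 1
  have hL : ∀ a c : TangentSpace (𝓡 8) x, A ![u, v, a + c] = A ![u, v, a] + A ![u, v, c] :=
    fun a c ↦ ((A.curryLeft u).curryLeft v).cons_add _ a c
  have hS : ∀ (r : ℝ) (a : TangentSpace (𝓡 8) x), A ![u, v, r • a] = r • A ![u, v, a] :=
    fun r a ↦ ((A.curryLeft u).curryLeft v).cons_smul _ r a
  let L : TangentSpace (𝓡 8) x →ₗ[ℝ] ℝ :=
    { toFun a := A ![u, v, a], map_add' := hL, map_smul' := hS }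
  change _ = L w
  conv_rhs => rw [← b.sum_repr' w, map_sum]
  refine Finset.sum_congr rfl fun k _ ↦ ?_
  rw [map_smul, smul_eq_mul, mul_comm]
  rfl

/-- A connection with the properties of the `Spin(7)`-torsion connection. -/
theorem exists_isTorsionConnection (S : Spin7Structure M) : ∃ cov, S.IsTorsionConnection cov := by
  choose B hB using S.exists_oneForm
  set cov := (leviCivita (𝓡 8) M).addOneForm B with hcov
  have hconn : ∀ {U : Set M} {e : Fin 8 → (y : M) → TangentSpace (𝓡 8) y} (h : S.IsAdapted e U)
      {y : M}, y ∈ U → ∀ i j k, h.frame.conn cov i j k y =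
        h.frame.conn (leviCivita (𝓡 8) M) i j k y
          + 1 / 2 * smoothRing.eval y (h.torsionComp i j k) := by
    intro U e h y hy i j k
    have h1 : S.leeTorsion y ![e i y, e j y, e k y] = smoothRing.eval y (h.torsionComp i j k) := by
      refine Eq.trans ?_ (h.components_leeTorsion y hy ![i, j, k])
      congr 1
      funext m; fin_cases m <;> rfl
    rw [← h1, ← hB]
    exact inner_add_left _ _ _
  have hskew : ∀ {U : Set M} {e : Fin 8 → (y : M) → TangentSpace (𝓡 8) y} (h : S.IsAdapted e U)
      {y : M}, y ∈ U → ∀ i j k, h.frame.conn cov i j k y = - h.frame.conn cov i k j y := by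
    intro U e h y hy i j k
    rw [hconn h hy, hconn h hy, h.frame.conn_leviCivita_skew hy, (h.torsionComp_spec hy).2.1 i j k]
    ring
  have htor : ∀ {U : Set M} {e : Fin 8 → (y : M) → TangentSpace (𝓡 8) y} (h : S.IsAdapted e U)
      {y : M}, y ∈ U → ∀ i j k, torsionTensor cov y ![e i y, e j y, e k y] =
        smoothRing.eval y (h.torsionComp i j k) := by
    intro U e h y hy i j k
    rw [h.frame.torsion_apply cov hy, hconn h hy, hconn h hy]
    have h1 := h.frame.conn_leviCivita_torsion hy i j k
    have h2 := (h.torsionComp_spec hy).1 i j k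
    linarith
  refine ⟨cov, ⟨⟨fun {σ} hσ ↦ ?_⟩⟩, fun x v ↦ ?_, fun x v ↦ ?_, fun x v σ ↦ ?_⟩
  · intro x _
    obtain ⟨U, hx, e, h⟩ := S.exists_isAdapted x
    refine (h.frame.contMDiffAt_cov hx (fun i j k ↦ ?_) ((hσ.of_le (by simp)).mono
      (Set.subset_univ _))).contMDiffWithinAt
    exact ContMDiffOn.congr (h.frame.leviCalculus.conn i j k
      + algebraMap ℝ _ (1 / 2) * h.torsionComp i j k : smoothRing (𝓡 8) U).2 fun y hy ↦ by
        rw [hconn h hy, ← h.frame.leviCalculus_represents.conn y hy]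
        rfl
  · obtain ⟨U, hx, e, h⟩ := S.exists_isAdapted x
    rw [h.frame.tensor_apply hx (isTensorAt_covDeriv _ isTensorAt_metricTensor
      (diffTensorAt_metricTensor x))]
    refine Finset.sum_eq_zero fun P _ ↦ ?_
    have e1 : (fun m ↦ e (P m) x) = ![e (P 0) x, e (P 1) x, e (P 2) x] := by
      funext m; fin_cases m <;> rfl
    rw [e1, h.frame.covDeriv_metricTensor cov hx, hskew h hx]
    ring
  · obtain ⟨U, hx, e, h⟩ := S.exists_isAdapted x
    rw [h.frame.tensor_apply hx (isTensorAt_covDeriv _ S.isTensorAt_fundamentalForm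
      (h.diffTensorAt_fundamentalForm hx))]
    refine Finset.sum_eq_zero fun P _ ↦ ?_
    have e1 : (fun m ↦ e (P m) x) = ![e (P 0) x, e (P 1) x, e (P 2) x, e (P 3) x, e (P 4) x] := by
      funext m; fin_cases m <;> rfl
    rw [e1, h.covDeriv_fundamentalForm cov hx]
    simp only [hconn h hx, (h.torsionComp_spec hx).2.2, neg_zero, mul_zero]
  · obtain ⟨U, hx, e, h⟩ := S.exists_isAdapted x
    obtain ⟨A, hA⟩ := isTensorAt_torsionTensor cov x
    rw [hA, hA]
    have hexp : ∀ a b c, A ![a, b, c] = ∑ i, ∑ j, ∑ k, ⟪a, e i x⟫_ℝ * ⟪b, e j x⟫_ℝ * ⟪c, e k x⟫_ℝ *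
        smoothRing.eval x (h.torsionComp i j k) := by
      intro a b c
      rw [← hA, h.frame.tensor_apply hx (isTensorAt_torsionTensor cov x), sum_fin_three_pi]
      refine Finset.sum_congr rfl fun i _ ↦ Finset.sum_congr rfl fun j _ ↦
        Finset.sum_congr rfl fun k _ ↦ ?_
      rw [← htor h hx, Fin.prod_univ_three]
      congr 2
      funext m; fin_cases m <;> rfl
    refine A.apply_perm_of_skew (fun a b c ↦ ?_) (fun a b c ↦ ?_) v σ
    · rw [hexp, hexp, Finset.sum_comm]
      simp only [← Finset.sum_neg_distrib]
      refine Finset.sum_congr rfl fun i _ ↦ Finset.sum_congr rfl fun j _ ↦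
        Finset.sum_congr rfl fun k _ ↦ ?_
      rw [(h.torsionComp_spec hx).1]
      ring
    · rw [hexp, hexp]
      simp only [← Finset.sum_neg_distrib]
      refine Finset.sum_congr rfl fun i _ ↦ ?_
      rw [Finset.sum_comm]
      refine Finset.sum_congr rfl fun j _ ↦ Finset.sum_congr rfl fun k _ ↦ ?_
      rw [(h.torsionComp_spec hx).2.1]
      ring

theorem isTorsionConnection_torsionConnection (S : Spin7Structure M) :
    S.IsTorsionConnection S.torsionConnection :=
  Classical.epsilon_spec S.exists_isTorsionConnection

end Spin7Structure
end Existence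
end

theorem theorem1p1 {M : Type*} [TopologicalSpace M] [T2Space M] [CompactSpace M]
    [ChartedSpace (EuclideanSpace ℝ (Fin 8)) M] [IsManifold (𝓡 8) ∞ M]
    [RiemannianBundle (fun x : M ↦ TangentSpace (𝓡 8) x)]
    [IsContMDiffRiemannianBundle (𝓡 8) ∞ (EuclideanSpace ℝ (Fin 8))
      (fun x : M ↦ TangentSpace (𝓡 8) x)]
    (S : Spin7Structure M) (hT : IsClosedThree S.torsionForm) :
    List.TFAE
      [∀ x v w, ricci S.torsionConnection x v w = 0,
        IsLocallyConstant (normSq S.torsionForm),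
        IsParallel S.torsionConnection S.leeForm,
        ∀ x, scalarCurvature S.torsionConnection x = 0,
        IsLocallyConstant (scalarCurvature (leviCivita (𝓡 8) M)),
        IsCoclosed S.leeForm] ∧
    ((∀ x v w, ricci S.torsionConnection x v w = 0) ∨
        IsLocallyConstant (normSq S.torsionForm) ∨
        IsParallel S.torsionConnection S.leeForm ∨
        (∀ x, scalarCurvature S.torsionConnection x = 0) ∨
        IsLocallyConstant (scalarCurvature (leviCivita (𝓡 8) M)) ∨
        IsCoclosed S.leeForm →
      IsHarmonicThree S.torsionForm) := by
  have hcov := S.isTorsionConnection_torsionConnection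
  have htfae := hcov.tfae hT
  refine ⟨htfae, fun h ↦ ⟨hT, hcov.isCoclosed_torsion hT ?_⟩⟩
  rcases h with h | h | h | h | h | h
  · exact h
  · exact (htfae.out 1 0).1 h
  · exact (htfae.out 2 0).1 h
  · exact (htfae.out 3 0).1 h
  · exact (htfae.out 4 0).1 h
  · exact (htfae.out 5 0).1 h
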